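/- Let $R$ be a commutative ring with unity. A filtered space is a Hausdorff space $X$ with closed subspaces $\emptyset=X_{-1}\subseteq X_0\subseteq\dots\subseteq X_{n-1}\subsetneq X_n=X$; its strata are the connected components of the $X_i\setminus X_{i-1}$ (of codimension $n-i$; regular if $i=n$, singular otherwise), and it is stratified if $S\cap\overline{S'}\ne\emptyset$ implies $S\subseteq\overline{S'}$ for all strata $S,S'$. A continuous map $f\colon X\to Y$ of stratified spaces is stratified if every stratum $S$ of $X$ is sent into a stratum $S^f$ of $Y$ with $\operatorname{codim}S\ge\operatorname{codim}S^f$. A regular simplex of $X$ is a continuous map $\sigma\colon\Delta_\sigma=\Delta_0*\dots*\Delta_n\to X$ from an ordered euclidean simplex, the order of the vertices being compatible with the join, such that $\sigma^{-1}(X_i)=\Delta_0*\dots*\Delta_i$ for all $i$ and $\Delta_n\neq\emptyset$. The complex $\widetilde N^*(X;R)$ consists of the families $\omega=(\omega_\sigma)_\sigma$, compatible with regular faces, with $\omega_\sigma\in\widetilde N^*(\Delta_\sigma)=N^*(\mathtt c\Delta_0)\otimes\dots\otimes N^*(\mathtt c\Delta_{n-1})\otimes N^*(\Delta_n)$; its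 differential $\delta$ and its cup product are defined simplexwise. Let $\mathfrak C_*(X;R)$ be the module of chains generated by the regular simplices, let $\cap\colon\widetilde N^*(X;R)\otimes\mathfrak C_m(X;R)\to\mathfrak C_{m-*}(X;R)$ be the intersection cap product, and let $f_*\sigma=f\circ\sigma$ for $\sigma$ a regular simplex. A perversity $\overline p$ assigns to each stratum an element of $\mathbb Z\cup\{\pm\infty\}$, equal to $0$ on regular strata; $\widetilde N^*_{\overline p}(X;R)$ is the complex of those $\omega$ for which the perverse degrees along the strata satisfy $\|\omega\|\le\overline p$ and $\|\delta\omega\|\le\overline p$, and $\mathscr H^*_{\overline p}(X;R)$ is its cohomology. If $\overline q$ is a perversity on $Y$, then $f^*\overline q(S)=\overline q(S^f)$. An elementary amalgamation replaces two consecutive factors $\Delta_j,\Delta_{j+1}$ of a regular simplex $\Delta=\Delta_0*\dots*\Delta_n$ by the single factor $\Delta_j*\Delta_{j+1}$; it is simple if $\Delta_j=\emptyset$. It induces a map $\mathcal A^*\colon\widetilde N^*(\Delta')\to\widetilde N^*(\Delta)$, namely the identity on the other factors, tensored with the dual of the map $\theta\colon N_*(\mathtt c\Delta_j)\otimes N_*(\mathtt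 c\Delta_{j+1})\to N_*(\mathtt c(\Delta_j*\Delta_{j+1}))$ (without the cones on $\Delta_{j+1}$ and on $\Delta_j*\Delta_{j+1}$ if $j+1=n$) given by $\theta((F_0,\varepsilon_0)\otimes(F_1,\varepsilon_1))=(F_0*F_1,\varepsilon_1)$ if $\varepsilon_0=1$, $=(F_0,0)$ if $\varepsilon_0=0$ and $|(F_1,\varepsilon_1)|=0$, and $=0$ otherwise. Here $(F,0)=F$, $(F,1)=\mathtt cF$, and $|\cdot|$ is the dimension. An amalgamation $\mathcal A=\mathcal A_2^{-1}\circ\mathcal A_1$ from $\Delta$ to $\Delta'$ consists of a finite sequence $\mathcal A_1$ of elementary amalgamations from $\Delta$ to some $\Delta''$ and a finite sequence $\mathcal A_2$ of simple ones from $\Delta'$ to $\Delta''$; it induces $\mathcal A^*=\mathcal A_1^*\circ(\mathcal A_2^*)^{-1}$. **Theorem.** Let $f\colon X\to Y$ be a stratified map. There is a unique family of $R$-linear maps $f^*\colon\widetilde N^k(Y;R)\to\widetilde N^k(X;R)$, $k\ge0$, such that for every regular simplex $\sigma$ of $X$ there is an amalgamation $\mathcal A_\sigma$ from $\Delta_\sigma$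 to $\Delta_{f\circ\sigma}$ with $(f^*\omega)_\sigma=\mathcal A_\sigma^*\,\omega_{f\circ\sigma}$ for all $\omega$. Moreover: 1. $f^*$ is a cochain map: $f^*\delta\omega=\delta f^*\omega$. 2. $f^*(\omega\cup\eta)=f^*\omega\cup f^*\eta$ for all $\omega,\eta\in\widetilde N^*(Y;R)$. 3. $f_*(f^*\omega\cap\xi)=\omega\cap f_*\xi$ for all $\omega\in\widetilde N^*(Y;R)$ and $\xi\in\mathfrak C_*(X;R)$. 4. If $\overline p$ is a perversity on $X$ and $\overline q$ a perversity on $Y$ with $\overline p\ge f^*\overline q$, then $f^*$ restricts to a cochain map $\widetilde N^*_{\overline q}(Y;R)\to\widetilde N^*_{\overline p}(X;R)$ and hence induces homomorphisms $\mathscr H^k_{\overline q}(Y;R)\to\mathscr H^k_{\overline p}(X;R)$ for all $k$, $[z]\mapsto[f^*z]$. -/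

import Mathlib

namespace BlownUp

/-! ### The blow up of a filtered euclidean simplex

A filtered euclidean simplex `Δ = Δ_0 * ⋯ * Δ_n` of dimension `m` and formal dimension `n` is given
by the weights `w : Fin (m + 1) → ℕ` of its ordered vertices: `Δ_i` is spanned by the vertices of
weight `i`. -/

/-- A face `(F, ε) = (F_0, ε_0) × ⋯ × (F_n, ε_n)` of the blow up `cΔ_0 × ⋯ × cΔ_{n-1} × Δ_n`:
`F_i` is the set of vertices of `F` of weight `i`, and `ε_i = 1` iff `i ∈ E`. -/
@[ext]
structure Cell {m : ℕ} (n : ℕ) (w : Fin (m + 1) → ℕ) where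
  F : Finset (Fin (m + 1))
  E : Finset ℕ
  lt_of_mem : ∀ i ∈ E, i < n
  weight_le : ∀ v ∈ F, w v ≤ n
  nonempty : ∀ i ≤ n, i ∉ E → ∃ v ∈ F, w v = i

section Cells

variable {m n : ℕ} {w : Fin (m + 1) → ℕ}

noncomputable instance : Fintype (Cell n w) :=
  Fintype.ofInjective
    (fun c => (c.F, (⟨c.E, Finset.mem_powerset.2 fun i hi => Finset.mem_range.2 (c.lt_of_mem i hi)⟩ :
      (Finset.range n).powerset)))
    (by
      intro a b h
      simp only [Prod.mk.injEq, Subtype.mk.injEq] at h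
      exact Cell.ext h.1 h.2)

/-- The vertex set of `F_i`. -/
def Cell.factor (c : Cell n w) (i : ℕ) : Finset (Fin (m + 1)) := c.F.filter fun v => w v = i

/-- The dimension `|(F_i, ε_i)| = dim F_i + ε_i` (with `dim ∅ = -1`). -/
def Cell.degAt (c : Cell n w) (i : ℕ) : ℕ := (c.factor i).card + (if i ∈ c.E then 1 else 0) - 1

/-- The dimension `|(F, ε)|`. -/
def Cell.deg (c : Cell n w) : ℕ := ∑ i ∈ Finset.range (n + 1), c.degAt i

/-- `|(F, ε)|_{< i}`. -/
def Cell.degBelow (c : Cell n w) (i : ℕ) : ℕ := ∑ a ∈ Finset.range i, c.degAt a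

/-- `|(F, ε)|_{> i}`. -/
def Cell.degAbove (c : Cell n w) (i : ℕ) : ℕ := ∑ a ∈ Finset.Ioc i n, c.degAt a

end Cells

/-- The module underlying `Ñ^*(Δ) = N^*(cΔ_0) ⊗ ⋯ ⊗ N^*(cΔ_{n-1}) ⊗ N^*(Δ_n)`, in coordinates for
its basis `1_{(F,ε)} = 1_{(F_0,ε_0)} ⊗ ⋯ ⊗ 1_{(F_n,ε_n)}`: the function `ω` stands for
`∑ ω (F,ε) • 1_{(F,ε)}`. -/
abbrev Cochain (R : Type*) {m : ℕ} (n : ℕ) (w : Fin (m + 1) → ℕ) := Cell n w → R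

section Operations

variable (R : Type*) [CommRing R] {m n : ℕ} {w : Fin (m + 1) → ℕ}

/-- The coefficient of `1_c` in
`δ 1_b = ∑_i (-1)^{|b|_{<i}} 1_{b_0} ⊗ ⋯ ⊗ δ 1_{b_i} ⊗ ⋯ ⊗ 1_{b_n}`, where
`δ 1_{[a_0,…,a_p]} = ∑_e 1_{[a_0,…,a_p,e]}`, the sum being over the vertices of `cΔ_i` (of `Δ_n` for
`i = n`) and the apex being the last vertex of `cΔ_i`. Moving the new vertex `e` to its place gives
one sign for each vertex of `b_i` after `e`. -/
def cobCoeff (b c : Cell n w) : R :=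
  (∑ e, if e ∉ b.F ∧ c.F = insert e b.F ∧ c.E = b.E then
    (-1) ^ (b.degBelow (w e) + ((b.factor (w e)).filter fun u => e < u).card
      + (if w e ∈ b.E then 1 else 0)) else 0)
  + ∑ i ∈ Finset.range n, if i ∉ b.E ∧ c.F = b.F ∧ c.E = insert i b.E then
    (-1) ^ b.degBelow i else 0

/-- The differential `δ` of `Ñ^*(Δ)`. -/
noncomputable def cob : Cochain R n w →ₗ[R] Cochain R n w where
  toFun ω c := ∑ b, cobCoeff R b c * ω b
  map_add' ω η := by ext c; simp [mul_add, Finset.sum_add_distrib]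
  map_smul' r ω := by ext c; simp [Finset.mul_sum, mul_left_comm]

/-- `a_i ∪ b_i` is defined for every `i`: in each factor `cΔ_i` (or `Δ_n`), the last vertex of `a_i`
is the first vertex of `b_i`. The second alternative is `a_i = (F_i, 1)`, `b_i = (∅, 1)`. -/
def Cell.Compatible (a b : Cell n w) : Prop :=
  ∀ i ≤ n, (i ∉ a.E ∧ ∃ v, IsGreatest (a.factor i : Set (Fin (m + 1))) v ∧
      IsLeast (b.factor i : Set (Fin (m + 1))) v) ∨
    (i ∈ a.E ∧ b.factor i = ∅)

open Classical in
/-- The coefficient of `1_c` in `1_a ∪ 1_b`. The product is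
`(-1)^{∑_{i>j} |a_i||b_j|} (1_{a_0} ∪ 1_{b_0}) ⊗ ⋯ ⊗ (1_{a_n} ∪ 1_{b_n})`, where
`1_{a_i} ∪ 1_{b_i} = (-1)^{|a_i||b_i|} 1_{a_i ∪ b_i}` if `a_i`, `b_i` are compatible and `0`
otherwise. -/
noncomputable def cupCoeff (a b c : Cell n w) : R :=
  if a.Compatible b ∧ c.F = a.F ∪ b.F ∧ c.E = b.E then
    (-1) ^ ∑ i ∈ Finset.range (n + 1), ∑ j ∈ Finset.range (i + 1), a.degAt i * b.degAt j
  else 0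

variable {R} in
/-- The cup product of `Ñ^*(Δ)`. -/
noncomputable def cup (ω η : Cochain R n w) : Cochain R n w :=
  fun c => ∑ a, ∑ b, cupCoeff R a b c * (ω a * η b)

/-- The basis of `N_*(Δ)`: the non-empty faces of the simplex with vertices `0, …, m`. -/
abbrev Face (m : ℕ) := {G : Finset (Fin (m + 1)) // G.Nonempty}

open Classical in
/-- The coefficient of the face `g` in `1_c ∩~ Δ~`. In the factor `cΔ_i` (`Δ_n` for `i = n`) the
only `g_i` that occurs is the one with `c_i ∪ g_i = cΔ_i` (`Δ_n`), and the sign is `(-1)^ν`, with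
`ν = ∑_{j<n} (dim Δ_j + 1) ∑_{i>j} |c_i|`. -/
noncomputable def capCoeff (c g : Cell n w) : R :=
  if c.Compatible g ∧ c.F ∪ g.F = Finset.univ ∧ g.E = Finset.range n then
    (-1) ^ ∑ j ∈ Finset.range n, (Finset.univ.filter fun v => w v = j).card * c.degAbove j
  else 0

/-- The cap product `- ∩~ Δ~ : Ñ^*(Δ) → Ñ_*(Δ)`. -/
noncomputable def capTilde : Cochain R n w →ₗ[R] (Cell n w →₀ R) where
  toFun ω := ∑ c, ∑ g, Finsupp.single g (capCoeff R c g * ω c)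
  map_add' ω η := by simp [mul_add, Finset.sum_add_distrib]
  map_smul' r ω := by
    simp only [Pi.smul_apply, smul_eq_mul, RingHom.id_apply, Finset.smul_sum, Finsupp.smul_single,
      mul_left_comm]

/-- The smallest `l` with `ε_l = 0`. -/
noncomputable def Cell.firstFree (c : Cell n w) : ℕ := sInf {i | i ∉ c.E}

lemma Cell.firstFree_spec (c : Cell n w) : c.firstFree ≤ n ∧ c.firstFree ∉ c.E :=
  have h : n ∈ {i | i ∉ c.E} := fun hn => lt_irrefl _ (c.lt_of_mem n hn)
  ⟨Nat.sInf_le h, Nat.sInf_mem (s := {i | i ∉ c.E}) ⟨n, h⟩⟩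

/-- The simplex `F_0 * ⋯ * F_l`, with `l` the smallest integer such that `ε_l = 0`. -/
noncomputable def Cell.joinFace (c : Cell n w) : Face m :=
  ⟨c.F.filter fun v => w v ≤ c.firstFree, by
    obtain ⟨v, hv, h⟩ := c.nonempty _ c.firstFree_spec.1 c.firstFree_spec.2
    exact ⟨v, Finset.mem_filter.2 ⟨hv, h.le⟩⟩⟩

/-- The map `μ_* : Ñ_*(Δ) → N_*(Δ)`: a face is sent to `F_0 * ⋯ * F_l` if the dimensions agree and
to `0` otherwise. -/
noncomputable def muMap : (Cell n w →₀ R) →ₗ[R] (Face m →₀ R) :=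
  Finsupp.linearCombination R fun c =>
    if c.joinFace.1.card = c.deg + 1 then Finsupp.single c.joinFace 1 else 0

end Operations

/-! ### Amalgamations -/

/-- The effect on weights of gathering `Δ_j` and `Δ_{j+1}` in one factor. -/
def collapse (j i : ℕ) : ℕ := if i ≤ j then i else i - 1

section Amalgamation

variable (R : Type*) [CommRing R] {m : ℕ}

/-- `Amalgamates j c c'` means that `𝒜[k]_* c = c'` for the elementary `k`-amalgamation
`Δ = Δ_0 * ⋯ * Δ_{n+1} → Δ' = Δ_0 * ⋯ * (Δ_j * Δ_{j+1}) * ⋯ * Δ_{n+1}`, `k = n - j`. On the factors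
`j` and `j + 1` this is
`θ ((F_0,ε_0) ⊗ (F_1,ε_1)) = (F_0 * F_1, ε_1)` if `ε_0 = 1`, and `(F_0, 0)` if `ε_0 = 0` and
`|(F_1,ε_1)| = 0`. In the remaining case `𝒜[k]_* c = 0`. -/
def Amalgamates {n : ℕ} {w : Fin (m + 1) → ℕ} (j : ℕ) (c : Cell (n + 1) w)
    (c' : Cell n (collapse j ∘ w)) : Prop :=
  (∀ i < j, i ∈ c'.E ↔ i ∈ c.E) ∧ (∀ i > j, i ∈ c'.E ↔ i + 1 ∈ c.E) ∧
    ((j ∈ c.E ∧ c'.F = c.F ∧ (j ∈ c'.E ↔ j + 1 ∈ c.E)) ∨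
      (j ∉ c.E ∧ c.degAt (j + 1) = 0 ∧ c'.F = c.F.filter (fun v => w v ≠ j + 1) ∧ j ∉ c'.E))

open Classical in
/-- The map `𝒜[k]^* = id ⊗ ⋯ ⊗ Ξ ⊗ ⋯ ⊗ id : Ñ^*(Δ') → Ñ^*(Δ)` of an elementary amalgamation, where
`Ξ` is the dual of `θ`:
`Ξ 1_{(F_0 * F_1, ε)} = (-1)^{|(F_0,1)| |(F_1,ε)|} 1_{(F_0,1)} ⊗ 1_{(F_1,ε)}` if
`(F_1,ε) ≠ (∅,0)`, and
`Ξ 1_{(F_0,0)} = 1_{(F_0,0)} ⊗ (1_{(∅,1)} + ∑_e 1_{(e,0)})`. -/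
noncomputable def elemPullback {n : ℕ} {w : Fin (m + 1) → ℕ} (j : ℕ) :
    Cochain R n (collapse j ∘ w) →ₗ[R] Cochain R (n + 1) w where
  toFun ω c := ∑ c', if Amalgamates j c c' then (-1) ^ (c.degAt j * c.degAt (j + 1)) * ω c' else 0
  map_add' ω η := by
    ext c
    simp only [Pi.add_apply, ← Finset.sum_add_distrib]
    exact Finset.sum_congr rfl fun _ _ => by split_ifs <;> simp [mul_add]
  map_smul' r ω := by
    ext c
    simp only [Pi.smul_apply, smul_eq_mul, RingHom.id_apply, Finset.mul_sum]
    exact Finset.sum_congr rfl fun _ _ => by split_ifs <;> simp [mul_left_comm]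

/-- `AmalgSeq R n w n' w' A`: the map `A` is the map `𝒜^*` of a finite sequence `𝒜` of elementary
amalgamations from `(n, w)` to `(n', w')`. -/
inductive AmalgSeq : (n : ℕ) → (w : Fin (m + 1) → ℕ) → (n' : ℕ) → (w' : Fin (m + 1) → ℕ) →
    (Cochain R n' w' →ₗ[R] Cochain R n w) → Prop
  | refl (n : ℕ) (w : Fin (m + 1) → ℕ) : AmalgSeq n w n w LinearMap.id
  | step {j n : ℕ} {w : Fin (m + 1) → ℕ} {n' : ℕ} {w' : Fin (m + 1) → ℕ}
      {A : Cochain R n' w' →ₗ[R] Cochain R n (collapse j ∘ w)} (hj : j ≤ n)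
      (h : AmalgSeq n (collapse j ∘ w) n' w' A) :
      AmalgSeq (n + 1) w n' w' (elemPullback R j ∘ₗ A)

/-- The same for a finite sequence of simple elementary amalgamations, that is, of elementary
amalgamations gathering `Δ_j` and `Δ_{j+1}` with `Δ_j = ∅`. -/
inductive SimpleAmalgSeq : (n : ℕ) → (w : Fin (m + 1) → ℕ) → (n' : ℕ) →
    (w' : Fin (m + 1) → ℕ) → (Cochain R n' w' →ₗ[R] Cochain R n w) → Prop
  | refl (n : ℕ) (w : Fin (m + 1) → ℕ) : SimpleAmalgSeq n w n w LinearMap.id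
  | step {j n : ℕ} {w : Fin (m + 1) → ℕ} {n' : ℕ} {w' : Fin (m + 1) → ℕ}
      {A : Cochain R n' w' →ₗ[R] Cochain R n (collapse j ∘ w)} (hj : j ≤ n)
      (hs : ∀ v, w v ≠ j) (h : SimpleAmalgSeq n (collapse j ∘ w) n' w' A) :
      SimpleAmalgSeq (n + 1) w n' w' (elemPullback R j ∘ₗ A)

/-- `A` is the map `𝒜^* : Ñ^*(Δ') → Ñ^*(Δ)` of an amalgamation `𝒜 = 𝒜_2^{-1} ∘ 𝒜_1` from
`Δ = (n, w)` to `Δ' = (n', w')`, where `𝒜_1` is a finite sequence of elementary amalgamations from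
`Δ` to some `Δ''` and `𝒜_2` is a finite sequence of simple elementary amalgamations from `Δ'`
to `Δ''`. -/
def IsAmalgPullback (n : ℕ) (w : Fin (m + 1) → ℕ) (n' : ℕ) (w' : Fin (m + 1) → ℕ)
    (A : Cochain R n' w' →ₗ[R] Cochain R n w) : Prop :=
  ∃ (n₀ : ℕ) (w₀ : Fin (m + 1) → ℕ) (A₁ : Cochain R n₀ w₀ →ₗ[R] Cochain R n w)
    (A₂ : Cochain R n₀ w₀ ≃ₗ[R] Cochain R n' w'),
    AmalgSeq R n w n₀ w₀ A₁ ∧ SimpleAmalgSeq R n' w' n₀ w₀ A₂.toLinearMap ∧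
      A = A₁ ∘ₗ A₂.symm.toLinearMap

end Amalgamation

/-! ### Faces -/

section Faces

variable {m m' n : ℕ} {w : Fin (m + 1) → ℕ} {w' : Fin (m' + 1) → ℕ}

/-- The map on faces of blow ups induced by a face operator `e : ∇ → Δ`. -/
def Cell.map (e : Fin (m' + 1) ↪o Fin (m + 1)) (h : ∀ v, w' v = w (e v)) (c : Cell n w') :
    Cell n w where
  F := c.F.map e.toEmbedding
  E := c.E
  lt_of_mem := c.lt_of_mem
  weight_le := by
    intro v hv
    obtain ⟨u, hu, rfl⟩ := Finset.mem_map.1 hv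
    have := c.weight_le u hu
    rw [h] at this
    exact this
  nonempty := by
    intro i hi hE
    obtain ⟨v, hv, rfl⟩ := c.nonempty i hi hE
    exact ⟨e v, Finset.mem_map_of_mem _ hv, (h v).symm⟩

variable (e : Fin (m' + 1) ↪o Fin (m + 1)) (h : ∀ v, w' v = w (e v))

lemma Cell.factor_map (c : Cell n w') (i : ℕ) :
    (c.map e h).factor i = (c.factor i).map e.toEmbedding := by
  ext v
  simp only [Cell.factor, Cell.map, Finset.mem_filter, Finset.mem_map]
  constructor
  · rintro ⟨⟨u, hu, rfl⟩, hw⟩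
    exact ⟨u, ⟨hu, (h u).trans hw⟩, rfl⟩
  · rintro ⟨u, ⟨hu, hw⟩, rfl⟩
    exact ⟨⟨u, hu, rfl⟩, (h u).symm.trans hw⟩

lemma Cell.degAt_map (c : Cell n w') (i : ℕ) : (c.map e h).degAt i = c.degAt i := by
  simp only [Cell.degAt, Cell.factor_map, Finset.card_map]
  rfl

lemma Cell.deg_map (c : Cell n w') : (c.map e h).deg = c.deg := by
  simp only [Cell.deg, Cell.degAt_map]

lemma Cell.map_injective : Function.Injective (Cell.map (n := n) e h) := by
  intro a b hab
  have h1 := congrArg Cell.F hab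
  have h2 := congrArg Cell.E hab
  exact Cell.ext (Finset.map_injective _ h1) h2

lemma Cell.exists_map_eq (b : Cell n w) (c : Cell n w') (hb : b.F ⊆ (c.map e h).F) :
    ∃ b' : Cell n w', b'.map e h = b := by
  have hF : (Finset.univ.filter fun v => e v ∈ b.F).map e.toEmbedding = b.F := by
    ext v
    simp only [Finset.mem_map, Finset.mem_filter, Finset.mem_univ, true_and]
    constructor
    · rintro ⟨u, hu, rfl⟩
      exact hu
    · intro hv
      obtain ⟨u, -, rfl⟩ := Finset.mem_map.1 (hb hv)
      exact ⟨u, hv, rfl⟩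
  refine ⟨⟨Finset.univ.filter fun v => e v ∈ b.F, b.E, b.lt_of_mem, ?_, ?_⟩, Cell.ext hF rfl⟩
  · intro v hv
    rw [h]
    exact b.weight_le _ (by simpa using hv)
  · intro i hi hE
    obtain ⟨v, hv, rfl⟩ := b.nonempty i hi hE
    obtain ⟨u, -, rfl⟩ := Finset.mem_map.1 (hb hv)
    exact ⟨u, by simpa using hv, h u⟩

variable (R : Type*) [CommRing R]

lemma cobCoeff_map (b c : Cell n w') :
    cobCoeff R (b.map e h) (c.map e h) = cobCoeff R b c := by
  unfold cobCoeff
  have hd : ∀ i, (b.map e h).degBelow i = b.degBelow i := fun i => by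
    simp only [Cell.degBelow, Cell.degAt_map]
  congr 1
  · symm
    refine Fintype.sum_of_injective e e.injective _ _ ?_ ?_
    · intro v hv
      rw [if_neg]
      rintro ⟨-, h1, -⟩
      have : v ∈ (c.map e h).F := h1 ▸ Finset.mem_insert_self _ _
      obtain ⟨u, -, hu⟩ := Finset.mem_map.1 this
      exact hv ⟨u, hu⟩
    · intro v
      have h1 : (e v ∉ (b.map e h).F) = (v ∉ b.F) := by
        simp [Cell.map]
      have h2 : ((c.map e h).F = insert (e v) (b.map e h).F) = (c.F = insert v b.F) := by
        have : insert (e v) (b.map e h).F = (insert v b.F).map e.toEmbedding := by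
          simp [Cell.map, Finset.map_insert]
        rw [this]
        exact propext (Finset.map_injective _).eq_iff
      have h3 : (((b.map e h).factor (w (e v))).filter fun u => e v < u).card
          = ((b.factor (w (e v))).filter fun u => v < u).card := by
        rw [Cell.factor_map, Finset.filter_map, Finset.card_map]
        congr 1
        ext u
        simp
      refine if_congr (and_congr (iff_of_eq h1.symm) (and_congr (iff_of_eq h2.symm) Iff.rfl)) ?_ rfl
      rw [hd, h3, ← h v]
      rfl
  · refine Finset.sum_congr rfl fun i _ => ?_
    have h2 : ((c.map e h).F = (b.map e h).F) = (c.F = b.F) :=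
      propext (Finset.map_injective _).eq_iff
    rw [hd]
    exact if_congr (and_congr Iff.rfl (and_congr (iff_of_eq h2) Iff.rfl)) rfl rfl

lemma subset_of_cobCoeff_ne_zero (b c : Cell n w) (hb : cobCoeff R b c ≠ 0) : b.F ⊆ c.F := by
  contrapose! hb
  unfold cobCoeff
  rw [Finset.sum_eq_zero, Finset.sum_eq_zero, add_zero]
  · intro i _
    rw [if_neg]
    rintro ⟨-, h1, -⟩
    exact hb h1.symm.subset
  · intro v _
    rw [if_neg]
    rintro ⟨-, h1, -⟩
    exact hb (h1 ▸ Finset.subset_insert _ _)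

lemma cob_map (ω : Cochain R n w) (c : Cell n w') :
    cob R ω (c.map e h) = cob R (fun b => ω (b.map e h)) c := by
  simp only [cob, LinearMap.coe_mk, AddHom.coe_mk]
  symm
  refine Fintype.sum_of_injective (Cell.map e h) (Cell.map_injective e h) _ _ ?_ ?_
  · intro b hb
    by_contra hne
    obtain ⟨b', hb'⟩ := b.exists_map_eq e h c
      (subset_of_cobCoeff_ne_zero R _ _ (left_ne_zero_of_mul hne))
    exact hb ⟨b', hb'⟩
  · intro b
    rw [cobCoeff_map]

lemma Cell.compatible_map (a b : Cell n w') :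
    (a.map e h).Compatible (b.map e h) ↔ a.Compatible b := by
  refine forall₂_congr fun i _ => ?_
  rw [Cell.factor_map, Cell.factor_map, Finset.map_eq_empty]
  refine or_congr (and_congr Iff.rfl ?_) Iff.rfl
  constructor
  · rintro ⟨v, ⟨hv, hv1⟩, hv3, hv2⟩
    obtain ⟨u, hu, rfl⟩ := Finset.mem_map.1 (Finset.mem_coe.1 hv)
    obtain ⟨u', hu', he⟩ := Finset.mem_map.1 (Finset.mem_coe.1 hv3)
    have huu : u' = u := e.injective he
    subst huu
    refine ⟨u', ⟨hu, fun x hx => ?_⟩, hu', fun x hx => ?_⟩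
    · exact e.le_iff_le.1 (hv1 (Finset.mem_coe.2 (Finset.mem_map_of_mem _ hx)))
    · exact e.le_iff_le.1 (hv2 (Finset.mem_coe.2 (Finset.mem_map_of_mem _ hx)))
  · rintro ⟨v, ⟨hv, hv1⟩, hv3, hv2⟩
    refine ⟨e v, ⟨Finset.mem_coe.2 (Finset.mem_map_of_mem _ hv), ?_⟩,
      Finset.mem_coe.2 (Finset.mem_map_of_mem _ hv3), ?_⟩
    · intro x hx
      obtain ⟨u, hu, rfl⟩ := Finset.mem_map.1 (Finset.mem_coe.1 hx)
      exact e.le_iff_le.2 (hv1 hu)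
    · intro x hx
      obtain ⟨u, hu, rfl⟩ := Finset.mem_map.1 (Finset.mem_coe.1 hx)
      exact e.le_iff_le.2 (hv2 hu)

lemma cupCoeff_map (a b c : Cell n w') :
    cupCoeff R (a.map e h) (b.map e h) (c.map e h) = cupCoeff R a b c := by
  unfold cupCoeff
  have h2 : ((c.map e h).F = (a.map e h).F ∪ (b.map e h).F) = (c.F = a.F ∪ b.F) := by
    have : (a.map e h).F ∪ (b.map e h).F = (a.F ∪ b.F).map e.toEmbedding :=
      (Finset.map_union _ _).symm
    rw [this]
    exact propext (Finset.map_injective _).eq_iff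
  simp only [Cell.degAt_map]
  classical
  exact if_congr (and_congr (Cell.compatible_map e h a b) (and_congr (iff_of_eq h2) Iff.rfl)) rfl rfl

lemma cup_map (ω η : Cochain R n w) (c : Cell n w') :
    cup ω η (c.map e h) = cup (fun b => ω (b.map e h)) (fun b => η (b.map e h)) c := by
  unfold cup
  symm
  refine Fintype.sum_of_injective (Cell.map e h) (Cell.map_injective e h) _ _ ?_ ?_
  · intro a ha
    refine Finset.sum_eq_zero fun b _ => ?_
    unfold cupCoeff
    rw [if_neg, zero_mul]
    rintro ⟨-, h1, -⟩
    obtain ⟨a', ha'⟩ := a.exists_map_eq e h c (h1 ▸ Finset.subset_union_left)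
    exact ha ⟨a', ha'⟩
  · intro a
    refine Fintype.sum_of_injective (Cell.map e h) (Cell.map_injective e h) _ _ ?_ ?_
    · intro b hb
      unfold cupCoeff
      rw [if_neg, zero_mul]
      rintro ⟨-, h1, -⟩
      obtain ⟨b', hb'⟩ := b.exists_map_eq e h c (h1 ▸ Finset.subset_union_right)
      exact hb ⟨b', hb'⟩
    · intro b
      rw [cupCoeff_map]

lemma Cell.degAt_add_one (c : Cell n w) {i : ℕ} (hi : i ≤ n) :
    c.degAt i + 1 = (c.factor i).card + if i ∈ c.E then 1 else 0 := by
  have : 1 ≤ (c.factor i).card + if i ∈ c.E then 1 else 0 := by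
    split_ifs with hE
    · omega
    · obtain ⟨v, hv, hw⟩ := c.nonempty i hi hE
      have : 0 < (c.factor i).card := Finset.card_pos.2 ⟨v, Finset.mem_filter.2 ⟨hv, hw⟩⟩
      omega
  unfold Cell.degAt
  omega

lemma Cell.deg_add (c : Cell n w) : c.deg + (n + 1) = c.F.card + c.E.card := by
  have h1 : c.deg + (n + 1) = ∑ i ∈ Finset.range (n + 1), (c.degAt i + 1) := by
    rw [Finset.sum_add_distrib]
    simp [Cell.deg]
  rw [h1, Finset.sum_congr rfl fun i hi =>
    c.degAt_add_one (Nat.lt_succ_iff.1 (Finset.mem_range.1 hi)), Finset.sum_add_distrib]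
  congr 1
  · symm
    exact Finset.card_eq_sum_card_fiberwise fun v hv =>
      Finset.mem_coe.2 (Finset.mem_range.2 (Nat.lt_succ_of_le (c.weight_le v hv)))
  · rw [Finset.sum_ite_mem, Finset.sum_const, smul_eq_mul, mul_one]
    congr 1
    ext i
    simp only [Finset.mem_inter, Finset.mem_range, and_iff_right_iff_imp]
    intro hi
    have := c.lt_of_mem i hi
    omega

lemma deg_of_cobCoeff_ne_zero (b c : Cell n w) (hb : cobCoeff R b c ≠ 0) : c.deg = b.deg + 1 := by
  have hb' := b.deg_add
  have hc' := c.deg_add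
  contrapose! hb
  unfold cobCoeff
  rw [Finset.sum_eq_zero, Finset.sum_eq_zero, add_zero]
  · intro i _
    rw [if_neg]
    rintro ⟨h0, h1, h2⟩
    rw [h1, h2, Finset.card_insert_of_notMem h0] at hc'
    omega
  · intro v _
    rw [if_neg]
    rintro ⟨h0, h1, h2⟩
    rw [h1, h2, Finset.card_insert_of_notMem h0] at hc'
    omega

lemma deg_of_cupCoeff_ne_zero (a b c : Cell n w) (hc : cupCoeff R a b c ≠ 0) :
    c.deg = a.deg + b.deg := by
  unfold cupCoeff at hc
  split_ifs at hc with h0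
  swap
  · exact absurd rfl hc
  obtain ⟨h0, h1, h2⟩ := h0
  unfold Cell.deg
  rw [← Finset.sum_add_distrib]
  refine Finset.sum_congr rfl fun i hi => ?_
  have hi : i ≤ n := Nat.lt_succ_iff.1 (Finset.mem_range.1 hi)
  have ha := a.degAt_add_one hi
  have hb := b.degAt_add_one hi
  have hcc := c.degAt_add_one hi
  have hU : c.factor i = a.factor i ∪ b.factor i := by
    unfold Cell.factor
    rw [h1, Finset.filter_union]
  rw [hU, h2] at hcc
  rcases h0 i hi with ⟨hE, v, hv1, hv2⟩ | ⟨hE, hF⟩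
  · have hI : a.factor i ∩ b.factor i = {v} := by
      ext u
      simp only [Finset.mem_inter, Finset.mem_singleton]
      constructor
      · rintro ⟨hu1, hu2⟩
        exact le_antisymm (hv1.2 hu1) (hv2.2 hu2)
      · rintro rfl
        exact ⟨hv1.1, hv2.1⟩
    have := Finset.card_union_add_card_inter (a.factor i) (b.factor i)
    rw [hI, Finset.card_singleton] at this
    rw [if_neg hE] at ha
    omega
  · rw [hF, Finset.union_empty] at hcc
    rw [hF, Finset.card_empty] at hb
    have : i ∈ b.E := by
      by_contra hbE
      rw [if_neg hbE] at hb
      omega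
    rw [if_pos this] at hb hcc
    rw [if_pos hE] at ha
    omega

end Faces


/-! ### Filtered spaces, strata, stratified maps, perversities -/

/-- A filtration `X_0 ⊆ X_1 ⊆ ⋯ ⊆ X_n = X` of a Hausdorff space by closed subsets with
`X_n \ X_{n-1} ≠ ∅` (`X_{-1} = ∅`). `level i` is `X_i`, hence the whole space for `i ≥ n`, and `dim`
is the formal dimension `n`. -/
structure Filtration (X : Type*) [TopologicalSpace X] where
  hausdorff : T2Space X
  dim : ℕ
  level : ℕ → Set X
  isClosed_level : ∀ i, IsClosed (level i)
  mono : Monotone level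
  level_dim : level dim = Set.univ
  layer_dim_nonempty : (level dim \ ⋃ j < dim, level j).Nonempty

namespace Filtration

variable {X : Type*} [TopologicalSpace X] (𝒳 : Filtration X)

/-- `X_i \ X_{i-1}`. -/
def layer (i : ℕ) : Set X := 𝒳.level i \ ⋃ j < i, 𝒳.level j

/-- The smallest `i` with `x ∈ X_i`. -/
noncomputable def height (x : X) : ℕ := sInf {i | x ∈ 𝒳.level i}

lemma mem_level_iff {x : X} {i : ℕ} : x ∈ 𝒳.level i ↔ 𝒳.height x ≤ i := by
  constructor
  · intro h
    exact Nat.sInf_le h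
  · intro h
    have hne : {i | x ∈ 𝒳.level i}.Nonempty := ⟨𝒳.dim, by simp [𝒳.level_dim]⟩
    exact 𝒳.mono h (Nat.sInf_mem hne)

lemma height_le (x : X) : 𝒳.height x ≤ 𝒳.dim :=
  𝒳.mem_level_iff.1 (by simp [𝒳.level_dim])

lemma mem_layer_iff {x : X} {i : ℕ} : x ∈ 𝒳.layer i ↔ 𝒳.height x = i := by
  simp only [layer, Set.mem_sdiff, Set.mem_iUnion, mem_level_iff, not_exists]
  constructor
  · rintro ⟨h1, h2⟩
    by_contra hne
    exact h2 (𝒳.height x) (by omega) le_rfl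
  · intro h
    exact ⟨h.le, fun j hj => by omega⟩

/-- A stratum: a (non-empty) connected component of some `X_i \ X_{i-1}`, with `dim` its formal
dimension `i`. -/
structure Stratum where
  dim : ℕ
  carrier : Set X
  isComponent : ∃ x ∈ 𝒳.layer dim, carrier = connectedComponentIn (𝒳.layer dim) x

variable {𝒳}

/-- The formal codimension of a stratum. -/
def Stratum.codim (S : 𝒳.Stratum) : ℕ := 𝒳.dim - S.dim

/-- The regular strata are those of `X_n \ X_{n-1}`; the others are singular. -/
def Stratum.IsRegular (S : 𝒳.Stratum) : Prop := S.dim = 𝒳.dim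

lemma Stratum.height_eq {S : 𝒳.Stratum} {x : X} (hx : x ∈ S.carrier) : 𝒳.height x = S.dim := by
  obtain ⟨y, -, h⟩ := S.isComponent
  rw [h] at hx
  exact 𝒳.mem_layer_iff.1 (connectedComponentIn_subset _ _ hx)

lemma Stratum.dim_le (S : 𝒳.Stratum) : S.dim ≤ 𝒳.dim := by
  obtain ⟨y, hy, -⟩ := S.isComponent
  rw [← 𝒳.mem_layer_iff.1 hy]
  exact 𝒳.height_le y

variable (𝒳)

/-- The frontier condition, which makes a filtered space a stratified space. -/
def IsStratified : Prop :=
  ∀ S S' : 𝒳.Stratum, (S.carrier ∩ closure S'.carrier).Nonempty → S.carrier ⊆ closure S'.carrier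

/-- The stratum of a point. -/
noncomputable def stratumOf (x : X) : 𝒳.Stratum where
  dim := 𝒳.height x
  carrier := connectedComponentIn (𝒳.layer (𝒳.height x)) x
  isComponent := ⟨x, 𝒳.mem_layer_iff.2 rfl, rfl⟩

end Filtration

/-- A stratified map between stratified spaces: a continuous map sending each stratum `S` in a
stratum `S^f` with `codim S ≥ codim S^f`. -/
structure IsStratifiedMap {X Y : Type*} [TopologicalSpace X] [TopologicalSpace Y]
    (𝒳 : Filtration X) (𝒴 : Filtration Y) (f : X → Y) : Prop where
  continuous : Continuous f
  isStratified_source : 𝒳.IsStratified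
  isStratified_target : 𝒴.IsStratified
  exists_stratum : ∀ S : 𝒳.Stratum, ∃ S' : 𝒴.Stratum,
    Set.MapsTo f S.carrier S'.carrier ∧ S'.codim ≤ S.codim

/-- The values `ℤ ∪ {-∞, +∞}` of perversities. -/
abbrev PValue := WithBot (WithTop ℤ)

/-- A perversity: a map from the strata to `ℤ ∪ {±∞}` that is `0` on the regular strata. -/
structure Perversity {X : Type*} [TopologicalSpace X] (𝒳 : Filtration X) where
  val : 𝒳.Stratum → PValue
  val_regular : ∀ S : 𝒳.Stratum, S.IsRegular → val S = 0

section StratifiedMap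

variable {X Y : Type*} [TopologicalSpace X] [TopologicalSpace Y] {𝒳 : Filtration X}
  {𝒴 : Filtration Y} {f : X → Y} (hf : IsStratifiedMap 𝒳 𝒴 f)

/-- The stratum `S^f`. -/
noncomputable def IsStratifiedMap.image (S : 𝒳.Stratum) : 𝒴.Stratum := (hf.exists_stratum S).choose

lemma IsStratifiedMap.mapsTo_image (S : 𝒳.Stratum) :
    Set.MapsTo f S.carrier (hf.image S).carrier := (hf.exists_stratum S).choose_spec.1

lemma IsStratifiedMap.codim_image_le (S : 𝒳.Stratum) : (hf.image S).codim ≤ S.codim :=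
  (hf.exists_stratum S).choose_spec.2

lemma IsStratifiedMap.isRegular_image {S : 𝒳.Stratum} (hS : S.IsRegular) :
    (hf.image S).IsRegular := by
  have h1 := hf.codim_image_le S
  have h2 := (hf.image S).dim_le
  unfold Filtration.Stratum.codim at h1
  unfold Filtration.Stratum.IsRegular at *
  omega

/-- The pull-back perversity `f^*q`. -/
noncomputable def Perversity.pullback (q : Perversity 𝒴) : Perversity 𝒳 where
  val S := q.val (hf.image S)
  val_regular _ hS := q.val_regular _ (hf.isRegular_image hS)

end StratifiedMap

/-! ### Regular filtered simplices -/

section Simplices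

variable {X : Type*} [TopologicalSpace X] (𝒳 : Filtration X)

/-- The weight of a vertex of a singular simplex: the smallest `i` such that `X_i` contains its
image. -/
noncomputable def vertexWeight {m : ℕ} (σ : C(stdSimplex ℝ (Fin (m + 1)), X)) (v : Fin (m + 1)) :
    ℕ := 𝒳.height (σ (stdSimplex.vertex v))

/-- A regular filtered simplex `σ : Δ = Δ_0 * ⋯ * Δ_n → X` of dimension `m`: the order of the vertices
is compatible with the join decomposition, `σ⁻¹(X_i) = Δ_0 * ⋯ * Δ_i` for all `i`, and
`Δ_n ≠ ∅`. Necessarily `Δ_i` is spanned by the vertices of weight `i`. -/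
structure RegSimplex (m : ℕ) where
  map : C(stdSimplex ℝ (Fin (m + 1)), X)
  monotone_weight : Monotone (vertexWeight 𝒳 map)
  preimage_level : ∀ i, map ⁻¹' 𝒳.level i = {t | ∀ v, t v ≠ 0 → vertexWeight 𝒳 map v ≤ i}
  regular : ∃ v, vertexWeight 𝒳 map v = 𝒳.dim

namespace RegSimplex

variable {𝒳} {m m' : ℕ}

/-- The weights of the vertices of `Δ_σ`. -/
noncomputable def weight (σ : RegSimplex 𝒳 m) : Fin (m + 1) → ℕ := vertexWeight 𝒳 σ.map

lemma height_le_iff (σ : RegSimplex 𝒳 m) (t : stdSimplex ℝ (Fin (m + 1))) (i : ℕ) :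
    𝒳.height (σ.map t) ≤ i ↔ ∀ v, t v ≠ 0 → σ.weight v ≤ i := by
  rw [← 𝒳.mem_level_iff]
  exact Set.ext_iff.1 (σ.preimage_level i) t

lemma vertexWeight_comp (σ : RegSimplex 𝒳 m) (e : Fin (m' + 1) ↪o Fin (m + 1)) (v : Fin (m' + 1)) :
    vertexWeight 𝒳 (σ.map.comp ⟨stdSimplex.map e, stdSimplex.continuous_map e⟩) v
      = σ.weight (e v) := by
  simp only [vertexWeight, weight, ContinuousMap.comp_apply, ContinuousMap.coe_mk,
    stdSimplex.map_vertex]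

/-- The regular face `σ ∘ e`, for a face operator `e`. -/
noncomputable def face (σ : RegSimplex 𝒳 m) (e : Fin (m' + 1) ↪o Fin (m + 1))
    (h : ∃ v, σ.weight (e v) = 𝒳.dim) : RegSimplex 𝒳 m' where
  map := σ.map.comp ⟨stdSimplex.map e, stdSimplex.continuous_map e⟩
  monotone_weight := by
    intro u v huv
    rw [vertexWeight_comp, vertexWeight_comp]
    exact σ.monotone_weight (e.monotone huv)
  preimage_level := by
    intro i
    ext t
    simp only [vertexWeight_comp]
    rw [Set.mem_preimage, 𝒳.mem_level_iff, Set.mem_ofPred_eq]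
    refine (σ.height_le_iff (stdSimplex.map e t) i).trans ?_
    have key : ∀ u, stdSimplex.map e t (e u) = t u := by
      intro u
      rw [stdSimplex.map_coe, FunOnFinite.linearMap_apply_apply, Finset.sum_eq_single u]
      · intro b hb hbu
        simp only [Finset.mem_filter, Finset.mem_univ, true_and] at hb
        exact absurd (e.injective hb) hbu
      · intro hu
        simp at hu
    constructor
    · intro H v hv
      exact H (e v) (by rwa [key])
    · intro H v hv
      have : ∃ u, e u = v := by
        by_contra hne
        push Not at hne
        apply hv
        rw [stdSimplex.map_coe, FunOnFinite.linearMap_apply_apply]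
        refine Finset.sum_eq_zero fun b hb => ?_
        simp only [Finset.mem_filter, Finset.mem_univ, true_and] at hb
        exact absurd hb (hne b)
      obtain ⟨u, rfl⟩ := this
      exact H u (by rwa [key] at hv)
  regular := by
    obtain ⟨v, hv⟩ := h
    exact ⟨v, by rw [vertexWeight_comp, hv]⟩

lemma weight_face (σ : RegSimplex 𝒳 m) (e : Fin (m' + 1) ↪o Fin (m + 1))
    (h : ∃ v, σ.weight (e v) = 𝒳.dim) (v : Fin (m' + 1)) :
    (σ.face e h).weight v = σ.weight (e v) := vertexWeight_comp σ e v

/-- The restriction of `σ` to the regular face of `Δ` with vertex set `G`. -/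
noncomputable def restrict (σ : RegSimplex 𝒳 m) (G : Face m) (h : ∃ v ∈ G.1, σ.weight v = 𝒳.dim) :
    RegSimplex 𝒳 (G.1.card - 1) :=
  σ.face (G.1.orderEmbOfFin (Nat.sub_add_cancel (Finset.card_pos.2 G.2)).symm) (by
    obtain ⟨v, hv, hw⟩ := h
    rw [← Finset.mem_coe, ← G.1.range_orderEmbOfFin
      (Nat.sub_add_cancel (Finset.card_pos.2 G.2)).symm] at hv
    obtain ⟨u, rfl⟩ := hv
    exact ⟨u, hw⟩)

end RegSimplex

end Simplices

section Composition

variable {X Y : Type*} [TopologicalSpace X] [TopologicalSpace Y] {𝒳 : Filtration X}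
  {𝒴 : Filtration Y} {f : X → Y}

lemma height_comp_le (hf : IsStratifiedMap 𝒳 𝒴 f) {m : ℕ} (σ : RegSimplex 𝒳 m)
    (t s : stdSimplex ℝ (Fin (m + 1))) (h : 𝒳.height (σ.map t) ≤ 𝒳.height (σ.map s)) :
    𝒴.height (f (σ.map t)) ≤ 𝒴.height (f (σ.map s)) := by
  let γ : unitInterval → stdSimplex ℝ (Fin (m + 1)) := fun r =>
    ⟨fun v => (1 - (r : ℝ)) * t v + (r : ℝ) * s v,
      (convex_stdSimplex ℝ (Fin (m + 1))) t.2 s.2 (by linarith [r.2.2]) r.2.1 (by ring)⟩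
  have hγ : Continuous γ := by
    refine Continuous.subtype_mk (continuous_pi fun v => ?_) _
    fun_prop
  have hγv : ∀ r v, γ r v = (1 - (r : ℝ)) * t v + (r : ℝ) * s v := fun r v => rfl
  have hγ0 : γ 0 = t := by
    ext v
    simp [hγv]
  have hγ1 : γ 1 = s := by
    ext v
    simp [hγv]
  -- all the points of the path but the origin lie over the same stratum
  have hpos : ∀ r : unitInterval, 0 < r → 𝒳.height (σ.map (γ r)) = 𝒳.height (σ.map s) := by
    intro r hr
    have hr' : (0 : ℝ) < r := hr
    apply le_antisymm
    · rw [σ.height_le_iff]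
      intro v hv
      by_cases hs : s v = 0
      · have ht : t v ≠ 0 := by
          rintro ht
          apply hv
          rw [hγv, hs, ht]
          simp
        exact ((σ.height_le_iff t _).1 le_rfl v ht).trans h
      · exact (σ.height_le_iff s _).1 le_rfl v hs
    · rw [σ.height_le_iff]
      intro v hv
      refine (σ.height_le_iff (γ r) _).1 le_rfl v ?_
      rw [hγv]
      have h1 : 0 < s v := lt_of_le_of_ne (stdSimplex.zero_le s v) (Ne.symm hv)
      have h2 : 0 ≤ t v := stdSimplex.zero_le t v
      have h3 : 0 ≤ 1 - (r : ℝ) := by linarith [r.2.2]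
      positivity
  have hpre : IsPreconnected ((fun r => σ.map (γ r)) '' Set.Ioi (0 : unitInterval)) :=
    isPreconnected_Ioi.image _ (σ.map.continuous.comp hγ).continuousOn
  let S := 𝒳.stratumOf (σ.map s)
  have hsub : (fun r => σ.map (γ r)) '' Set.Ioi (0 : unitInterval) ⊆ S.carrier := by
    refine hpre.subset_connectedComponentIn ⟨1, ?_, by simp only [hγ1]⟩ ?_
    · exact zero_lt_one' unitInterval
    · rintro _ ⟨r, hr, rfl⟩
      exact 𝒳.mem_layer_iff.2 (hpos r hr)
  have hY : ∀ r : unitInterval, 0 < r →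
      𝒴.height (f (σ.map (γ r))) = 𝒴.height (f (σ.map s)) := by
    have : ∀ r : unitInterval, 0 < r →
        𝒴.height (f (σ.map (γ r))) = (hf.image S).dim := fun r hr =>
      Filtration.Stratum.height_eq (hf.mapsTo_image S (hsub ⟨r, hr, rfl⟩))
    intro r hr
    rw [this r hr, ← this 1 zero_lt_one, hγ1]
  have hcl : IsClosed {r : unitInterval | f (σ.map (γ r)) ∈ 𝒴.level (𝒴.height (f (σ.map s)))} :=
    (𝒴.isClosed_level _).preimage (hf.continuous.comp (σ.map.continuous.comp hγ))
  have hsub2 : closure (Set.Ioi (0 : unitInterval)) ⊆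
      {r : unitInterval | f (σ.map (γ r)) ∈ 𝒴.level (𝒴.height (f (σ.map s)))} :=
    hcl.closure_subset_iff.2 fun r hr => 𝒴.mem_level_iff.2 (hY r hr).le
  have h0 : (0 : unitInterval) ∈ closure (Set.Ioi (0 : unitInterval)) := by
    rw [closure_Ioi' (a := (0 : unitInterval)) ⟨1, zero_lt_one' unitInterval⟩]
    exact Set.self_mem_Ici
  have := hsub2 h0
  rw [Set.mem_ofPred_eq, hγ0] at this
  exact 𝒴.mem_level_iff.1 this

/-- The regular simplex `f ∘ σ` of `Y`, for a stratified map `f : X → Y` and a regular simplex `σ`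
of `X`. -/
noncomputable def RegSimplex.comp (hf : IsStratifiedMap 𝒳 𝒴 f) {m : ℕ} (σ : RegSimplex 𝒳 m) :
    RegSimplex 𝒴 m where
  map := (⟨f, hf.continuous⟩ : C(X, Y)).comp σ.map
  monotone_weight u v huv := height_comp_le hf σ _ _ (σ.monotone_weight huv)
  preimage_level := by
    intro i
    ext t
    rw [Set.mem_preimage, 𝒴.mem_level_iff, Set.mem_ofPred_eq]
    constructor
    · intro H v hv
      refine (height_comp_le hf σ (stdSimplex.vertex v) t ?_).trans H
      exact (σ.height_le_iff t _).1 le_rfl v hv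
    · intro H
      obtain ⟨v, hv, hmax⟩ : ∃ v, t v ≠ 0 ∧ ∀ u, t u ≠ 0 → σ.weight u ≤ σ.weight v := by
        have hne : (Finset.univ.filter fun v => t v ≠ 0).Nonempty := by
          by_contra hempty
          rw [Finset.not_nonempty_iff_eq_empty, Finset.filter_eq_empty_iff] at hempty
          have h1 := stdSimplex.sum_eq_one t
          rw [Finset.sum_eq_zero fun v hv => not_not.1 (hempty hv)] at h1
          exact zero_ne_one h1
        obtain ⟨v, hv, hmax⟩ := Finset.exists_max_image _ σ.weight hne
        exact ⟨v, (Finset.mem_filter.1 hv).2, fun u hu =>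
          hmax u (Finset.mem_filter.2 ⟨Finset.mem_univ _, hu⟩)⟩
      exact (height_comp_le hf σ t (stdSimplex.vertex v) ((σ.height_le_iff t _).2 hmax)).trans
        (H v hv)
  regular := by
    obtain ⟨v, hv⟩ := σ.regular
    refine ⟨v, ?_⟩
    let x := σ.map (stdSimplex.vertex v)
    have hS : (𝒳.stratumOf x).IsRegular := hv
    have hx : x ∈ (𝒳.stratumOf x).carrier := mem_connectedComponentIn (𝒳.mem_layer_iff.2 rfl)
    exact (Filtration.Stratum.height_eq (hf.mapsTo_image _ hx)).trans (hf.isRegular_image hS)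

end Composition

/-! ### The blown-up complex, cup and cap products, blown-up intersection cohomology -/

section BlownUpComplex

variable (R : Type*) [CommRing R] {X : Type*} [TopologicalSpace X] (𝒳 : Filtration X)

/-- Families `(ω_σ)_σ` with `ω_σ ∈ Ñ^*(Δ_σ)`, `σ` running over the regular simplices of `X`. -/
abbrev Family := (m : ℕ) → (σ : RegSimplex 𝒳 m) → Cochain R 𝒳.dim σ.weight

/-- The families `ω` of cochains `ω_σ` of degree `k` such that `e^* ω_σ = ω_{σ ∘ e}` for every regular
face operator `e`. -/
def compatibleFamilies (k : ℕ) : Submodule R (Family R 𝒳) where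
  carrier := {ω | (∀ m (σ : RegSimplex 𝒳 m) c, c.deg ≠ k → ω m σ c = 0) ∧
    ∀ m m' (σ : RegSimplex 𝒳 m) (e : Fin (m' + 1) ↪o Fin (m + 1))
      (h : ∃ v, σ.weight (e v) = 𝒳.dim) (c : Cell 𝒳.dim (σ.face e h).weight),
      ω m' (σ.face e h) c = ω m σ (c.map e (σ.weight_face e h))}
  add_mem' := by
    rintro ω η ⟨h1, h2⟩ ⟨h3, h4⟩
    refine ⟨fun m σ c hc => ?_, fun m m' σ e h c => ?_⟩
    · simp [h1 m σ c hc, h3 m σ c hc]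
    · simp [h2, h4]
  zero_mem' := ⟨fun _ _ _ _ => rfl, fun _ _ _ _ _ _ => rfl⟩
  smul_mem' := by
    rintro r ω ⟨h1, h2⟩
    refine ⟨fun m σ c hc => ?_, fun m m' σ e h c => ?_⟩
    · simp [h1 m σ c hc]
    · simp [h2]

/-- The module `Ñ^k(X; R)` of blown-up cochains of degree `k`. -/
def BlownUpCochain (k : ℕ) : Type _ := compatibleFamilies R 𝒳 k

instance (k : ℕ) : AddCommGroup (BlownUpCochain R 𝒳 k) :=
  inferInstanceAs (AddCommGroup (compatibleFamilies R 𝒳 k))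

instance (k : ℕ) : Module R (BlownUpCochain R 𝒳 k) :=
  inferInstanceAs (Module R (compatibleFamilies R 𝒳 k))

variable {R 𝒳}

lemma deg_eq_of_ne_zero {k : ℕ} (ω : BlownUpCochain R 𝒳 k) {m : ℕ} {σ : RegSimplex 𝒳 m}
    {c : Cell 𝒳.dim σ.weight} (h : ω.1 m σ c ≠ 0) : c.deg = k := by
  by_contra hc
  exact h (ω.2.1 m σ c hc)

/-- The differential `δ : Ñ^k(X; R) → Ñ^{k+1}(X; R)`, `(δ ω)_σ = δ ω_σ`. -/
noncomputable def coboundary (k : ℕ) : BlownUpCochain R 𝒳 k →ₗ[R] BlownUpCochain R 𝒳 (k + 1) where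
  toFun ω := ⟨fun m σ => cob R (ω.1 m σ), by
    refine ⟨fun m σ c hc => ?_, fun m m' σ e h c => ?_⟩
    · refine Finset.sum_eq_zero fun b _ => ?_
      by_contra hne
      apply hc
      rw [deg_of_cobCoeff_ne_zero R b c (left_ne_zero_of_mul hne),
        deg_eq_of_ne_zero ω (right_ne_zero_of_mul hne)]
    · dsimp only
      rw [cob_map]
      refine congrArg (fun η => cob R η c) ?_
      funext b
      exact ω.2.2 m m' σ e h b⟩
  map_add' ω η := Subtype.ext (funext fun m => funext fun σ =>
    (cob R (w := σ.weight)).map_add (ω.1 m σ) (η.1 m σ))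
  map_smul' r ω := Subtype.ext (funext fun m => funext fun σ =>
    (cob R (w := σ.weight)).map_smul r (ω.1 m σ))

/-- The cup product `Ñ^k(X; R) × Ñ^l(X; R) → Ñ^{k+l}(X; R)`, `(ω ∪ η)_σ = ω_σ ∪ η_σ`. -/
noncomputable def cupProduct {k l : ℕ} (ω : BlownUpCochain R 𝒳 k) (η : BlownUpCochain R 𝒳 l) :
    BlownUpCochain R 𝒳 (k + l) :=
  ⟨fun m σ => cup (ω.1 m σ) (η.1 m σ), by
    refine ⟨fun m σ c hc => ?_, fun m m' σ e h c => ?_⟩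
    · refine Finset.sum_eq_zero fun a _ => Finset.sum_eq_zero fun b _ => ?_
      by_contra hne
      apply hc
      rw [deg_of_cupCoeff_ne_zero R a b c (left_ne_zero_of_mul hne),
        deg_eq_of_ne_zero ω (left_ne_zero_of_mul (right_ne_zero_of_mul hne)),
        deg_eq_of_ne_zero η (right_ne_zero_of_mul (right_ne_zero_of_mul hne))]
    · dsimp only
      rw [cup_map]
      congr 1
      · funext b
        exact ω.2.2 m m' σ e h b
      · funext b
        exact η.2.2 m m' σ e h b⟩

variable (R 𝒳)

/-- The module `𝔠_*(X; R)` of chains generated by the regular simplices. -/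
abbrev TameChain := (Σ m, RegSimplex 𝒳 m) →₀ R

variable {𝒳}

open Classical in
/-- The map induced by `σ` on the chains of `Δ`; the non-regular faces are sent to `0`. -/
noncomputable def simplexMap {m : ℕ} (σ : RegSimplex 𝒳 m) : (Face m →₀ R) →ₗ[R] TameChain R 𝒳 :=
  Finsupp.linearCombination R fun G =>
    if h : ∃ v ∈ G.1, σ.weight v = 𝒳.dim then Finsupp.single ⟨_, σ.restrict G h⟩ 1 else 0

variable {R}

/-- The intersection cap product `ω ∩ - : 𝔠_*(X; R) → 𝔠_*(X; R)`, the linear extension of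
`ω ∩ σ = σ_*(μ_*(ω_σ ∩~ Δ~))`. -/
noncomputable def capProduct {k : ℕ} (ω : BlownUpCochain R 𝒳 k) :
    TameChain R 𝒳 →ₗ[R] TameChain R 𝒳 :=
  Finsupp.linearCombination R fun s => simplexMap R s.2 (muMap R (capTilde R (ω.1 s.1 s.2)))

/-- The perverse degree `‖1_c‖_l`. -/
noncomputable def Cell.perverseDegree {m n : ℕ} {w : Fin (m + 1) → ℕ} (c : Cell n w) (l : ℕ) :
    PValue :=
  if n - l ∈ c.E then ⊥ else (((c.degAbove (n - l) : ℤ) : WithTop ℤ) : PValue)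

open Classical in
/-- The perverse degree `‖ω‖_S` of `ω` along a stratum `S`: the supremum of the
`‖ω_σ‖_{codim S} = max {‖1_c‖_{codim S} | ω_σ(c) ≠ 0}`, over the regular simplices `σ` that meet `S`,
if `S` is singular, and `0` if `S` is regular. -/
noncomputable def perverseDegree {k : ℕ} (ω : BlownUpCochain R 𝒳 k) (S : 𝒳.Stratum) : PValue :=
  if S.IsRegular then 0 else
    ⨆ (m : ℕ) (σ : RegSimplex 𝒳 m) (_ : (Set.range σ.map ∩ S.carrier).Nonempty)
      (c : Cell 𝒳.dim σ.weight) (_ : ω.1 m σ c ≠ 0), c.perverseDegree S.codim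

/-- `ω` is `p`-allowable. -/
def IsAllowable (p : Perversity 𝒳) {k : ℕ} (ω : BlownUpCochain R 𝒳 k) : Prop :=
  ∀ S, perverseDegree ω S ≤ p.val S

lemma isAllowable_iff (p : Perversity 𝒳) {k : ℕ} (ω : BlownUpCochain R 𝒳 k) :
    IsAllowable p ω ↔ ∀ S : 𝒳.Stratum, ¬ S.IsRegular → ∀ m (σ : RegSimplex 𝒳 m),
      (Set.range σ.map ∩ S.carrier).Nonempty → ∀ c, ω.1 m σ c ≠ 0 →
        c.perverseDegree S.codim ≤ p.val S := by
  refine forall_congr' fun S => ?_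
  unfold perverseDegree
  split_ifs with hS
  · simp [hS, p.val_regular S hS]
  · simp [hS]

variable (R)

/-- The module `Ñ^k_p(X; R)` of `p`-intersection cochains: those `ω` such that `ω` and `δ ω` are
`p`-allowable. -/
def IntersectionCochain (p : Perversity 𝒳) (k : ℕ) : Submodule R (BlownUpCochain R 𝒳 k) :=
  have hadd : ∀ (j : ℕ) (ω η : BlownUpCochain R 𝒳 j),
      IsAllowable p ω → IsAllowable p η → IsAllowable p (ω + η) := by
    intro j ω η hω hη
    rw [isAllowable_iff] at *
    intro S hS m σ hσ c hc
    by_cases h : ω.1 m σ c = 0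
    · refine hη S hS m σ hσ c fun h' => hc ?_
      exact (congrArg₂ (· + ·) h h').trans (add_zero 0)
    · exact hω S hS m σ hσ c h
  have hsmul : ∀ (j : ℕ) (r : R) (ω : BlownUpCochain R 𝒳 j),
      IsAllowable p ω → IsAllowable p (r • ω) := by
    intro j r ω hω
    rw [isAllowable_iff] at *
    intro S hS m σ hσ c hc
    refine hω S hS m σ hσ c fun h => hc ?_
    exact (congrArg (r * ·) h).trans (mul_zero r)
  have hzero : ∀ j : ℕ, IsAllowable p (0 : BlownUpCochain R 𝒳 j) := by
    intro j
    rw [isAllowable_iff]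
    intro S hS m σ hσ c hc
    exact absurd rfl hc
  { carrier := {ω | IsAllowable p ω ∧ IsAllowable p (coboundary k ω)}
    add_mem' := by
      rintro ω η ⟨h1, h2⟩ ⟨h3, h4⟩
      refine ⟨hadd _ _ _ h1 h3, ?_⟩
      rw [map_add]
      exact hadd _ _ _ h2 h4
    zero_mem' := by
      refine ⟨hzero _, ?_⟩
      rw [map_zero]
      exact hzero _
    smul_mem' := by
      rintro r ω ⟨h1, h2⟩
      refine ⟨hsmul _ _ _ h1, ?_⟩
      rw [map_smul]
      exact hsmul _ _ _ h2 }

/-- The cocycles of degree `k` of the complex `Ñ^*_p(X; R)`. -/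
noncomputable def Cocycle (p : Perversity 𝒳) (k : ℕ) : Submodule R (BlownUpCochain R 𝒳 k) :=
  IntersectionCochain R p k ⊓ LinearMap.ker (coboundary k)

/-- The coboundaries of degree `k` of the complex `Ñ^*_p(X; R)`. -/
noncomputable def Coboundary (p : Perversity 𝒳) :
    (k : ℕ) → Submodule R (BlownUpCochain R 𝒳 k)
  | 0 => ⊥
  | k + 1 => (IntersectionCochain R p k).map (coboundary k)

/-- The blown-up intersection cohomology `ℋ^k_p(X; R)`, the cohomology of `Ñ^*_p(X; R)`. -/
abbrev BlownUpCohomology (p : Perversity 𝒳) (k : ℕ) :=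
  Cocycle R p k ⧸ (Coboundary R p k).comap (Cocycle R p k).subtype

end BlownUpComplex

/-! ### The maps induced by a stratified map -/

section Induced

variable (R : Type*) [CommRing R] {X Y : Type*} [TopologicalSpace X] [TopologicalSpace Y]
  {𝒳 : Filtration X} {𝒴 : Filtration Y} {f : X → Y} (hf : IsStratifiedMap 𝒳 𝒴 f)

/-- The map `f_* : 𝔠_*(X; R) → 𝔠_*(Y; R)`, `f_* σ = f ∘ σ`. -/
noncomputable def chainMap : TameChain R 𝒳 →ₗ[R] TameChain R 𝒴 :=
  Finsupp.lmapDomain R R fun s => ⟨s.1, s.2.comp hf⟩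

variable {R}

/-- `φ` is the map `f^*` induced by `f`: `(f^* ω)_σ = 𝒜_σ^* ω_{f ∘ σ}` for every regular simplex
`σ` of `X`, where `𝒜_σ` is an amalgamation from `Δ_σ` to `Δ_{f ∘ σ}`. -/
def IsInducedMap (φ : (k : ℕ) → BlownUpCochain R 𝒴 k →ₗ[R] BlownUpCochain R 𝒳 k) : Prop :=
  ∀ (m : ℕ) (σ : RegSimplex 𝒳 m),
    ∃ A : Cochain R 𝒴.dim (σ.comp hf).weight →ₗ[R] Cochain R 𝒳.dim σ.weight,
      IsAmalgPullback R 𝒳.dim σ.weight 𝒴.dim (σ.comp hf).weight A ∧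
        ∀ (k : ℕ) (ω : BlownUpCochain R 𝒴 k), (φ k ω).1 m σ = A (ω.1 m (σ.comp hf))

end Induced

end BlownUp

namespace BlownUp

/-! ### Coarsenings of the join decomposition -/

/-! Since `f^*` is prescribed simplex by simplex, everything reduces to a single simplex with two
join decompositions `w` (of `Δ_σ`) and `w'` (of `Δ_{f ∘ σ}`). Up to empty factors `w'` is coarser
than `w`, and it keeps the last factor last (`RegSimplex.coarsens_comp`). The claim is that all
amalgamations from `w` to `w'` induce one and the same map `pullback`, and that this map respects
the differential, products and faces.

Gathering a block of consecutive factors acts on a face of the blow up as follows: inside each block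
one keeps the join of the `F_i` up to the first factor without apex, provided that all later factors
of the block have dimension `0`; otherwise the face is killed (`Cell.Pushes`). This rule composes
(`Cell.Pushes.trans`) and does not see empty factors. The signs are handled by the change of basis
`Cell.sgn`: gathering `j` and `j + 1` removes from its exponent exactly the term `|c_j||c_{j+1}|`,
the sign of `Ξ`. In the new basis the pull-back has no sign, hence it is functorial
(`pullback_comp`). For simple amalgamations it is invertible, as the decompositions coarsen each
other. So `𝒜_1^* ∘ (𝒜_2^*)⁻¹` is always `pullback`, which gives uniqueness; existence follows by
discarding the empty factors of `w'` and gathering `w` onto the result.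

The differential and the cup product need only be compared for elementary amalgamations. A face is
coded by its set of vertices, apexes included, in a linearly ordered set. In the new basis the
differential deletes one vertex, with a sign counting the later ones (`sgn_mul_cob`); the cup
product runs over the ways to cut every factor at a common vertex (`isSplit_code_iff`); an
elementary amalgamation deletes the apex `z` of the factor `j`, or, if `z` is absent, the only
vertex of the factor `j + 1`. The first compatibility is then a comparison of terms
(`codeCob_codePullback`), the second a bijection between cuttings (`pullback_collapse_cup`).

For the cap product, the coefficient of a face `G` in `μ_*(ω ∩~ Δ~)` is, up to a controlled sign,
the value on the top face of the cup product of `ω` with the dual of the face spanned by `G` and all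
the apexes (`muMap_capTilde_eq_cup`), so the projection formula follows from multiplicativity. For
perversities, the dimension beyond a factor without apex cannot drop under gathering, because the
later factors of its block have dimension `0` (`Cell.Pushes.degAbove_le`). -/

/-- The weights of the vertices of a regular simplex of formal dimension `n`. -/
structure IsRegularWeight {m : ℕ} (n : ℕ) (w : Fin (m + 1) → ℕ) : Prop where
  le : ∀ v, w v ≤ n
  exists_eq : ∃ v, w v = n

/-- The decomposition given by `w'` is coarser than the one given by `w`, up to the insertion of
empty factors, and the last factor of `w` is contained in the last factor of `w'`. -/
structure Coarsens {m : ℕ} (n : ℕ) (w : Fin (m + 1) → ℕ) (n' : ℕ) (w' : Fin (m + 1) → ℕ) :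
    Prop where
  mono : ∀ u v, w u ≤ w v → w' u ≤ w' v
  last : ∀ v, w v = n → w' v = n'

namespace Coarsens

variable {m n n₁ n' : ℕ} {w w₁ w' : Fin (m + 1) → ℕ}

lemma refl (n : ℕ) (w : Fin (m + 1) → ℕ) : Coarsens n w n w := ⟨fun _ _ h => h, fun _ h => h⟩

lemma trans (h : Coarsens n w n₁ w₁) (h' : Coarsens n₁ w₁ n' w') : Coarsens n w n' w' :=
  ⟨fun u v huv => h'.mono u v (h.mono u v huv), fun v hv => h'.last v (h.last v hv)⟩

lemma congr (h : Coarsens n w n' w') {u v : Fin (m + 1)} (huv : w u = w v) : w' u = w' v :=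
  le_antisymm (h.mono u v huv.le) (h.mono v u huv.ge)

lemma lt_of_lt (h : Coarsens n w n' w') {u v : Fin (m + 1)} (huv : w' u < w' v) : w u < w v := by
  by_contra hlt
  exact absurd (h.mono v u (not_lt.1 hlt)) (not_le.2 huv)

/-- The blocks of gathered factors are the fibres of `g`. Taking a supremum over the vertices of
weight at most `k` makes `g` defined and monotone on empty factors as well; a vertex of weight `n`
forces `g n = n'`. -/
lemma exists_map (h : Coarsens n w n' w') (hw : IsRegularWeight n w) (hw' : ∀ v, w' v ≤ n') :
    ∃ g : ℕ → ℕ, Monotone g ∧ g n = n' ∧ (∀ k, g k ≤ n') ∧ ∀ v, w' v = g (w v) := by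
  refine ⟨fun k => (Finset.univ.filter fun v => w v ≤ k).sup w', ?_, ?_, ?_, ?_⟩
  · intro a b hab
    exact Finset.sup_mono fun v hv => by
      simp only [Finset.mem_filter, Finset.mem_univ, true_and] at hv ⊢
      exact hv.trans hab
  · apply le_antisymm
    · exact Finset.sup_le fun v _ => hw' v
    · obtain ⟨v, hv⟩ := hw.exists_eq
      rw [← h.last v hv]
      exact Finset.le_sup (f := w') (by simp [hv])
  · exact fun k => Finset.sup_le fun v _ => hw' v
  · intro v
    apply le_antisymm
    · exact Finset.le_sup (f := w') (by simp)
    · exact Finset.sup_le fun u hu => h.mono u v (Finset.mem_filter.1 hu).2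

end Coarsens

section Collapse

variable {m n j : ℕ} {w : Fin (m + 1) → ℕ}

lemma monotone_collapse (j : ℕ) : Monotone (collapse j) := by
  intro a b hab
  unfold collapse
  split_ifs <;> omega

lemma collapse_succ_of_le {n : ℕ} (hj : j ≤ n) : collapse j (n + 1) = n := by
  unfold collapse
  split_ifs <;> omega

lemma IsRegularWeight.collapse (hw : IsRegularWeight (n + 1) w) (hj : j ≤ n) :
    IsRegularWeight n (collapse j ∘ w) where
  le v := (monotone_collapse j (hw.le v)).trans (collapse_succ_of_le hj).le
  exists_eq := by
    obtain ⟨v, hv⟩ := hw.exists_eq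
    exact ⟨v, by rw [Function.comp_apply, hv, collapse_succ_of_le hj]⟩

lemma coarsens_collapse (hj : j ≤ n) (w : Fin (m + 1) → ℕ) :
    Coarsens (n + 1) w n (collapse j ∘ w) where
  mono u v huv := monotone_collapse j huv
  last v hv := by rw [Function.comp_apply, hv, collapse_succ_of_le hj]

end Collapse

/-! ### The push-forward of faces of blow ups -/

section Push

variable {m n n₁ n' : ℕ} {w : Fin (m + 1) → ℕ} {w₁ w' : Fin (m + 1) → ℕ}

namespace Cell

lemma notMem_E_last (c : Cell n w) : n ∉ c.E := fun h => lt_irrefl _ (c.lt_of_mem n h)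

lemma mem_factor {c : Cell n w} {i : ℕ} {v : Fin (m + 1)} :
    v ∈ c.factor i ↔ v ∈ c.F ∧ w v = i := Finset.mem_filter

lemma degAt_of_factor_eq_empty (c : Cell n w) {i : ℕ} (h : c.factor i = ∅) : c.degAt i = 0 := by
  unfold degAt
  rw [h]
  split_ifs <;> simp

/-- An apex alone has dimension `0`, so a factor of positive dimension contains a vertex of `Δ`. -/
lemma exists_mem_of_degAt_ne_zero (c : Cell n w) {i : ℕ} (h : c.degAt i ≠ 0) :
    ∃ v ∈ c.F, w v = i := by
  by_contra hne
  push Not at hne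
  exact h (c.degAt_of_factor_eq_empty (Finset.filter_eq_empty_iff.2 fun v hv => hne v hv))

/-- The amalgamation onto `(n', w')` does not kill the face `c`. -/
def Pushable (c : Cell n w) (w' : Fin (m + 1) → ℕ) : Prop :=
  ∀ u ∈ c.F, ∀ v ∈ c.F, w' u = w' v → w u < w v → w u ∉ c.E → c.degAt (w v) = 0

/-- The amalgamation onto `(n', w')` sends the face `c` to the face `c'`. -/
structure Pushes (c : Cell n w) (c' : Cell n' w') : Prop where
  pushable : c.Pushable w'
  mem_E : ∀ i, i ∈ c'.E ↔ i < n' ∧ ∀ u ∈ c.F, w' u = i → w u ∈ c.E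
  mem_F : ∀ v, v ∈ c'.F ↔ v ∈ c.F ∧ ∀ u ∈ c.F, w' u = w' v → w u < w v → w u ∈ c.E

/-- Supplies the first factor without apex of the `i`-th block. In the last block one always exists:
the factor `n` is non-empty and has no apex. -/
lemma exists_mem_of_notMem_E (h : Coarsens n w n' w') (c : Cell n w) {i : ℕ} (hi : i ≤ n')
    (hE : ¬ (i < n' ∧ ∀ u ∈ c.F, w' u = i → w u ∈ c.E)) :
    ∃ u ∈ c.F, w' u = i ∧ w u ∉ c.E ∧ ∀ v ∈ c.F, w' v = i → w v < w u → w v ∈ c.E := by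
  have h1 : ∃ u ∈ c.F, w' u = i ∧ w u ∉ c.E := by
    by_cases hn : i < n'
    · by_contra hne
      push Not at hne
      exact hE ⟨hn, hne⟩
    · obtain ⟨v, hv, hvn⟩ := c.nonempty n le_rfl c.notMem_E_last
      refine ⟨v, hv, ?_, by rw [hvn]; exact c.notMem_E_last⟩
      rw [h.last v hvn]
      omega
  have hne : (c.F.filter fun u => w' u = i ∧ w u ∉ c.E).Nonempty := by
    obtain ⟨u, hu, h2⟩ := h1
    exact ⟨u, Finset.mem_filter.2 ⟨hu, h2⟩⟩
  obtain ⟨u, hu, hmin⟩ := Finset.exists_min_image _ w hne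
  rw [Finset.mem_filter] at hu
  refine ⟨u, hu.1, hu.2.1, hu.2.2, fun v hv hvi hlt => ?_⟩
  by_contra hvE
  exact absurd (hmin v (Finset.mem_filter.2 ⟨hv, hvi, hvE⟩)) (not_le.2 hlt)

/-- Only non-emptiness needs an argument: in a block whose image has no apex, the first factor
without apex keeps its vertices. An empty block `i < n'` receives the apex vacuously, which gives
the face `(∅, 1)`. -/
lemma Pushable.exists_pushes (h : Coarsens n w n' w') (hw' : ∀ v, w' v ≤ n') {c : Cell n w}
    (hc : c.Pushable w') : ∃ c' : Cell n' w', c.Pushes c' := by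
  refine ⟨⟨c.F.filter fun v => ∀ u ∈ c.F, w' u = w' v → w u < w v → w u ∈ c.E,
    (Finset.range n').filter fun i => ∀ u ∈ c.F, w' u = i → w u ∈ c.E, ?_, ?_, ?_⟩, hc, ?_, ?_⟩
  · exact fun i hi => Finset.mem_range.1 (Finset.mem_filter.1 hi).1
  · exact fun v _ => hw' v
  · intro i hi hE
    rw [Finset.mem_filter, Finset.mem_range] at hE
    obtain ⟨u, hu, hui, -, hmin⟩ := c.exists_mem_of_notMem_E h hi hE
    exact ⟨u, Finset.mem_filter.2 ⟨hu, fun v hv hvu => hmin v hv (hvu.trans hui)⟩, hui⟩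
  · intro i
    rw [Finset.mem_filter, Finset.mem_range]
  · intro v
    rw [Finset.mem_filter]

lemma Pushes.unique {c : Cell n w} {c' d' : Cell n' w'} (hc : c.Pushes c') (hd : c.Pushes d') :
    c' = d' := by
  ext i
  · rw [hc.mem_F, hd.mem_F]
  · rw [hc.mem_E, hd.mem_E]

lemma pushes_self (c d : Cell n w) : c.Pushes d ↔ c = d := by
  have h : c.Pushes c := by
    refine ⟨fun u _ v _ h hlt => absurd h hlt.ne, fun i => ?_, fun v => ?_⟩
    · constructor
      · exact fun hi => ⟨c.lt_of_mem i hi, fun u _ hu => hu ▸ hi⟩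
      · rintro ⟨hi, h⟩
        by_contra hE
        obtain ⟨v, hv, rfl⟩ := c.nonempty i hi.le hE
        exact hE (h v hv rfl)
    · exact ⟨fun hv => ⟨hv, fun u _ h hlt => absurd h hlt.ne⟩, fun h => h.1⟩
  exact ⟨fun hd => h.unique hd, fun hd => hd ▸ h⟩

/-- Pushing forward adds up the dimensions of the factors that are gathered. -/
lemma Pushes.degAt_eq (h : Coarsens n w n' w') {g : ℕ → ℕ} (hg : ∀ v, w' v = g (w v))
    {c : Cell n w} {c' : Cell n' w'} (hc : c.Pushes c') {i : ℕ} (hi : i ≤ n') :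
    c'.degAt i = ∑ k ∈ (Finset.range (n + 1)).filter (fun k => g k = i), c.degAt k := by
  have hmaps : ∀ s ⊆ c.F, (∀ v ∈ s, w' v = i) →
      s.card = ∑ k ∈ (Finset.range (n + 1)).filter (fun k => g k = i),
        (s.filter fun v => w v = k).card := fun s hs hsi =>
    Finset.card_eq_sum_card_fiberwise fun v hv => Finset.mem_coe.2 (Finset.mem_filter.2
      ⟨Finset.mem_range.2 (Nat.lt_succ_of_le (c.weight_le v (hs hv))), by rw [← hg, hsi v hv]⟩)
  -- When the image has its apex, so has every factor of the block, and the dimension of each is its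
  -- number of vertices.
  by_cases hE : i ∈ c'.E
  · have hall := ((hc.mem_E i).1 hE).2
    have hF : c'.factor i = c.F.filter fun v => w' v = i := by
      ext v
      rw [mem_factor, hc.mem_F, Finset.mem_filter]
      constructor
      · exact fun h => ⟨h.1.1, h.2⟩
      · exact fun h => ⟨⟨h.1, fun u hu huv _ => hall u hu (huv.trans h.2)⟩, h.2⟩
    unfold degAt
    rw [if_pos hE, hF, Nat.add_sub_cancel, hmaps _ (Finset.filter_subset _ _)
      fun v hv => (Finset.mem_filter.1 hv).2]
    refine Finset.sum_congr rfl fun k hk => ?_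
    obtain ⟨hk1, hk2⟩ := Finset.mem_filter.1 hk
    have hkE : k ∈ c.E := by
      by_contra hkE
      obtain ⟨v, hv, rfl⟩ := c.nonempty k (Nat.lt_succ_iff.1 (Finset.mem_range.1 hk1)) hkE
      exact hkE (hall v hv ((hg v).trans hk2))
    rw [if_pos hkE, Nat.add_sub_cancel]
    congr 1
    ext v
    simp only [Finset.mem_filter, mem_factor]
    constructor
    · exact fun h => ⟨h.1.1, h.2⟩
    · exact fun h => ⟨⟨h.1, by rw [hg, h.2, hk2]⟩, h.2⟩
  -- Now `w u` is the first factor of the block without apex. Earlier factors contribute as many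
  -- vertices as their dimension, this one contributes one more, and later ones are dropped, having
  -- dimension `0` by pushability. The extra vertex is absorbed by the `- 1` in `degAt`.
  · obtain ⟨u, hu, hui, huE, hmin⟩ := c.exists_mem_of_notMem_E h hi fun hn => hE ((hc.mem_E i).2 hn)
    have hF : c'.factor i = c.F.filter fun v => w' v = i ∧ w v ≤ w u := by
      ext v
      rw [mem_factor, hc.mem_F, Finset.mem_filter]
      constructor
      · rintro ⟨⟨h1, h2⟩, h3⟩
        refine ⟨h1, h3, ?_⟩
        by_contra hlt
        exact huE (h2 u hu (hui.trans h3.symm) (not_le.1 hlt))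
      · rintro ⟨h1, h2, h3⟩
        exact ⟨⟨h1, fun x hx hxv hlt => hmin x hx (hxv.trans h2) (hlt.trans_le h3)⟩, h2⟩
    have hu0 : w u ∈ (Finset.range (n + 1)).filter (fun k => g k = i) :=
      Finset.mem_filter.2 ⟨Finset.mem_range.2 (Nat.lt_succ_of_le (c.weight_le u hu)),
        by rw [← hg, hui]⟩
    have hsum : (c'.factor i).card =
        ∑ k ∈ (Finset.range (n + 1)).filter (fun k => g k = i),
          (c.degAt k + if k = w u then 1 else 0) := by
      rw [hF, hmaps _ (Finset.filter_subset _ _) fun v hv => (Finset.mem_filter.1 hv).2.1]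
      refine Finset.sum_congr rfl fun k hk => ?_
      obtain ⟨hk1, hk2⟩ := Finset.mem_filter.1 hk
      have hkn := Nat.lt_succ_iff.1 (Finset.mem_range.1 hk1)
      have hfac : k ≤ w u → (Finset.filter (fun v => w v = k)
          (c.F.filter fun v => w' v = i ∧ w v ≤ w u)) = c.factor k := by
        intro hku
        ext v
        simp only [Finset.mem_filter, mem_factor]
        constructor
        · exact fun h => ⟨h.1.1, h.2⟩
        · exact fun h => ⟨⟨h.1, by rw [hg, h.2, hk2], by omega⟩, h.2⟩
      have hd := c.degAt_add_one hkn
      rcases lt_trichotomy k (w u) with hlt | rfl | hlt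
      · rw [hfac hlt.le, if_neg hlt.ne]
        have hkE : k ∈ c.E := by
          by_contra hkE
          obtain ⟨v, hv, rfl⟩ := c.nonempty k hkn hkE
          exact hkE (hmin v hv ((hg v).trans hk2) hlt)
        rw [if_pos hkE] at hd
        omega
      · rw [hfac le_rfl, if_pos rfl]
        rw [if_neg huE] at hd
        omega
      · rw [if_neg hlt.ne', Finset.filter_eq_empty_iff.2, Finset.card_empty]
        · by_contra hne
          obtain ⟨v, hv, rfl⟩ := c.exists_mem_of_degAt_ne_zero (i := k) (by omega)
          have := hc.pushable u hu v hv (by rw [hui, hg, hk2]) hlt huE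
          omega
        · intro v hv hvk
          have := (Finset.mem_filter.1 hv).2.2
          omega
    unfold degAt
    rw [if_neg hE, hsum, Finset.sum_add_distrib, Finset.sum_ite_eq' _ _ fun _ => 1, if_pos hu0]
    rfl

/-- A small block has no apex in `c₁` as soon as one of its factors has none in `c`. Hence looking
for the first free factor among the small blocks, then inside the block found, gives the first free
factor of the large block. -/
lemma Pushes.trans (hw : IsRegularWeight n w) (hw₁ : ∀ v, w₁ v ≤ n₁) (h : Coarsens n w n₁ w₁)
    (h' : Coarsens n₁ w₁ n' w') {c : Cell n w} {c₁ : Cell n₁ w₁} {c' : Cell n' w'}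
    (hc : c.Pushes c₁) (hc' : c₁.Pushes c') : c.Pushes c' := by
  have key : ∀ u ∈ c.F, w u ∉ c.E → w₁ u ∉ c₁.E := fun u hu huE hE =>
    huE (((hc.mem_E _).1 hE).2 u hu rfl)
  refine ⟨?_, fun i => ?_, fun v => ?_⟩
  · intro u hu v hv huv hlt huE
    by_cases h1 : w₁ u = w₁ v
    · exact hc.pushable u hu v hv h1 hlt huE
    have hlt1 : w₁ u < w₁ v := lt_of_le_of_ne (h.mono u v hlt.le) h1
    obtain ⟨g, -, -, -, hg⟩ := h.exists_map hw hw₁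
    -- The free factor `w u` makes the block `w₁ u` of `c₁` free, so pushability of `c₁` forces the
    -- block of `v` to have dimension `0`; by additivity so does each of its factors.
    have h0 : c₁.degAt (w₁ v) = 0 := by
      by_contra hne
      obtain ⟨v₁, hv₁, hvv⟩ := c₁.exists_mem_of_degAt_ne_zero hne
      obtain ⟨u₁, hu₁, huu⟩ := c₁.nonempty _ (hw₁ u) (key u hu huE)
      rw [← hvv] at hne
      refine hne (hc'.pushable u₁ hu₁ v₁ hv₁ ?_ (by omega) (by rw [huu]; exact key u hu huE))
      rw [h'.congr huu, h'.congr hvv, huv]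
    rw [hc.degAt_eq h hg (hw₁ v), Finset.sum_eq_zero_iff] at h0
    exact h0 _ (Finset.mem_filter.2 ⟨Finset.mem_range.2 (Nat.lt_succ_of_le (hw.le v)), (hg v).symm⟩)
  · rw [hc'.mem_E]
    refine and_congr_right fun hi => ⟨?_, ?_⟩
    · intro H u hu hui
      by_contra huE
      obtain ⟨u₁, hu₁, huu⟩ := c₁.nonempty _ (hw₁ u) (key u hu huE)
      have := H u₁ hu₁ ((h'.congr huu).trans hui)
      rw [huu] at this
      exact key u hu huE this
    · intro H u hu hui
      refine (hc.mem_E _).2 ⟨lt_of_le_of_ne (hw₁ u) fun hn => ?_, fun x hx hxu =>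
        H x hx ((h'.congr hxu).trans hui)⟩
      have := h'.last u hn
      omega
  · rw [hc'.mem_F, hc.mem_F]
    constructor
    · rintro ⟨⟨hv, h1⟩, h2⟩
      refine ⟨hv, fun u hu huv hlt => ?_⟩
      by_contra huE
      by_cases h3 : w₁ u = w₁ v
      · exact huE (h1 u hu h3 hlt)
      obtain ⟨u₁, hu₁, huu⟩ := c₁.nonempty _ (hw₁ u) (key u hu huE)
      have hlt1 : w₁ u < w₁ v := lt_of_le_of_ne (h.mono u v hlt.le) h3
      have := h2 u₁ hu₁ ((h'.congr huu).trans huv) (by omega)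
      rw [huu] at this
      exact key u hu huE this
    · rintro ⟨hv, h1⟩
      refine ⟨⟨hv, fun u hu huv => h1 u hu (h'.congr huv)⟩, fun u hu huv hlt => ?_⟩
      refine (hc.mem_E _).2 ⟨hlt.trans_le (hw₁ v), fun x hx hxu => ?_⟩
      exact h1 x hx ((h'.congr hxu).trans huv) (h.lt_of_lt (by omega))

/-- A block of `c₁` without apex contains a free factor of `c`. All factors of a later small block
come after it, so they have dimension `0`, and so does their sum. -/
lemma Pushes.pushable_of_pushable (hw : IsRegularWeight n w) (hw₁ : ∀ v, w₁ v ≤ n₁)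
    (h : Coarsens n w n₁ w₁) (h' : Coarsens n₁ w₁ n' w') {c : Cell n w} {c₁ : Cell n₁ w₁}
    (hc : c.Pushes c₁) (hp : c.Pushable w') : c₁.Pushable w' := by
  intro u hu v hv huv hlt huE
  obtain ⟨g, -, -, -, hg⟩ := h.exists_map hw hw₁
  have : ∃ x ∈ c.F, w₁ x = w₁ u ∧ w x ∉ c.E := by
    by_contra hne
    push Not at hne
    exact huE ((hc.mem_E _).2 ⟨hlt.trans_le (hw₁ v), hne⟩)
  obtain ⟨x, hx, hxu, hxE⟩ := this
  rw [hc.degAt_eq h hg (hw₁ v)]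
  refine Finset.sum_eq_zero fun k hk => ?_
  obtain ⟨-, hk2⟩ := Finset.mem_filter.1 hk
  by_contra hne
  obtain ⟨y, hy, rfl⟩ := c.exists_mem_of_degAt_ne_zero hne
  have hyv : w₁ y = w₁ v := (hg y).trans hk2
  exact hne (hp x hx y hy (by rw [h'.congr hxu, h'.congr hyv, huv]) (h.lt_of_lt (by omega)) hxE)

lemma Pushable.of_trans (h' : Coarsens n₁ w₁ n' w') {c : Cell n w} (hp : c.Pushable w') :
    c.Pushable w₁ :=
  fun u hu v hv huv => hp u hu v hv (h'.congr huv)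

end Cell

end Push

/-! ### Signs -/

/-- `∑_{k < i ≤ n} a_i b_k`. -/
def cross (n : ℕ) (a b : ℕ → ℕ) : ℕ :=
  ∑ i ∈ Finset.range (n + 1), ∑ k ∈ Finset.range (n + 1), if k < i then a i * b k else 0

/-- Expanding the sums over the blocks leaves exactly the pairs of factors in different blocks. -/
lemma cross_fiberwise {n n' : ℕ} {g a b a' b' : ℕ → ℕ} (hg : ∀ k ≤ n, g k ≤ n')
    (ha : ∀ i ≤ n', a' i = ∑ k ∈ (Finset.range (n + 1)).filter (fun k => g k = i), a k)
    (hb : ∀ i ≤ n', b' i = ∑ k ∈ (Finset.range (n + 1)).filter (fun k => g k = i), b k) :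
    cross n' a' b' = ∑ i ∈ Finset.range (n + 1), ∑ k ∈ Finset.range (n + 1),
      if g k < g i then a i * b k else 0 := by
  have hmem : ∀ k ∈ Finset.range (n + 1), g k ∈ Finset.range (n' + 1) := fun k hk =>
    Finset.mem_range.2 (Nat.lt_succ_of_le (hg k (Nat.lt_succ_iff.1 (Finset.mem_range.1 hk))))
  unfold cross
  rw [← Finset.sum_fiberwise_of_maps_to hmem]
  refine Finset.sum_congr rfl fun i hi => ?_
  rw [ha i (Nat.lt_succ_iff.1 (Finset.mem_range.1 hi))]
  have h1 : ∀ x ∈ (Finset.range (n + 1)).filter (fun k => g k = i),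
      (∑ k ∈ Finset.range (n + 1), if g k < g x then a x * b k else 0)
        = ∑ k ∈ Finset.range (n' + 1), if k < i then a x * b' k else 0 := by
    intro x hx
    rw [← Finset.sum_fiberwise_of_maps_to hmem]
    refine Finset.sum_congr rfl fun k hk => ?_
    rw [hb k (Nat.lt_succ_iff.1 (Finset.mem_range.1 hk)), (Finset.mem_filter.1 hx).2, Finset.mul_sum]
    by_cases hki : k < i
    · rw [if_pos hki]
      refine Finset.sum_congr rfl fun y hy => ?_
      rw [(Finset.mem_filter.1 hy).2, if_pos hki]
    · rw [if_neg hki]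
      refine Finset.sum_eq_zero fun y hy => ?_
      rw [(Finset.mem_filter.1 hy).2, if_neg hki]
  rw [Finset.sum_congr rfl h1, Finset.sum_comm]
  refine Finset.sum_congr rfl fun k _ => ?_
  split_ifs
  · rw [Finset.sum_mul]
  · simp

/-- Gathering the factors `j` and `j + 1` only removes the term `a_{j+1} b_j`. -/
lemma cross_collapse {n j : ℕ} (hj : j ≤ n) {a b a' b' : ℕ → ℕ}
    (ha : ∀ i ≤ n, a' i = ∑ k ∈ (Finset.range (n + 2)).filter (fun k => collapse j k = i), a k)
    (hb : ∀ i ≤ n, b' i = ∑ k ∈ (Finset.range (n + 2)).filter (fun k => collapse j k = i), b k) :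
    cross (n + 1) a b = cross n a' b' + a (j + 1) * b j := by
  rw [cross_fiberwise (n := n + 1) (fun k hk =>
    (monotone_collapse j hk).trans (collapse_succ_of_le hj).le) ha hb]
  have h1 : a (j + 1) * b j = ∑ i ∈ Finset.range (n + 1 + 1), ∑ k ∈ Finset.range (n + 1 + 1),
      if i = j + 1 ∧ k = j then a i * b k else 0 := by
    rw [Finset.sum_eq_single (j + 1), Finset.sum_eq_single j]
    · simp
    · intro k _ hk
      rw [if_neg]
      exact fun h => hk h.2
    · intro h
      simp only [Finset.mem_range] at h
      omega
    · intro i _ hi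
      refine Finset.sum_eq_zero fun k _ => ?_
      rw [if_neg]
      exact fun h => hi h.1
    · intro h
      simp only [Finset.mem_range] at h
      omega
  rw [h1, cross, ← Finset.sum_add_distrib]
  refine Finset.sum_congr rfl fun i _ => ?_
  rw [← Finset.sum_add_distrib]
  refine Finset.sum_congr rfl fun k _ => ?_
  -- For `k < i` the collapsed indices coincide only if `k = j` and `i = j + 1`.
  unfold collapse
  split_ifs <;> omega

section Sign

variable (R : Type*) [CommRing R] {m n : ℕ} {w : Fin (m + 1) → ℕ}

/-- The sign `(-1)^{∑_{k<i} |c_k||c_i|}`. -/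
def Cell.sgn (c : Cell n w) : R := (-1) ^ cross n c.degAt c.degAt

lemma Cell.sgn_mul_self (c : Cell n w) : c.sgn R * c.sgn R = 1 := by
  unfold sgn
  rw [← pow_add, ← two_mul, pow_mul, neg_one_sq, one_pow]

end Sign

/-! ### The pull-back of cochains -/

section Pullback

variable (R : Type*) [CommRing R] {m : ℕ}

open Classical in
/-- The map `𝒜^*` of an amalgamation `𝒜` from `(n, w)` to `(n', w')`. -/
noncomputable def pullback (n : ℕ) (w : Fin (m + 1) → ℕ) (n' : ℕ) (w' : Fin (m + 1) → ℕ) :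
    Cochain R n' w' →ₗ[R] Cochain R n w where
  toFun ω c := ∑ c', if c.Pushes c' then c.sgn R * c'.sgn R * ω c' else 0
  map_add' ω η := by
    ext c
    simp only [Pi.add_apply, ← Finset.sum_add_distrib]
    exact Finset.sum_congr rfl fun _ _ => by split_ifs <;> simp [mul_add]
  map_smul' r ω := by
    ext c
    simp only [Pi.smul_apply, smul_eq_mul, RingHom.id_apply, Finset.mul_sum]
    exact Finset.sum_congr rfl fun _ _ => by split_ifs <;> simp [mul_left_comm]

variable {R} {n n₁ n' : ℕ} {w w₁ w' : Fin (m + 1) → ℕ}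

lemma pullback_apply_of_pushes {c : Cell n w} {c' : Cell n' w'} (h : c.Pushes c')
    (ω : Cochain R n' w') : pullback R n w n' w' ω c = c.sgn R * c'.sgn R * ω c' := by
  simp only [pullback, LinearMap.coe_mk, AddHom.coe_mk]
  rw [Finset.sum_eq_single c', if_pos h]
  · intro d' _ hd
    rw [if_neg fun hd' => hd (hd'.unique h)]
  · exact fun h => absurd (Finset.mem_univ _) h

lemma pullback_apply_of_not_pushable {c : Cell n w} (h : ¬ c.Pushable w') (ω : Cochain R n' w') :
    pullback R n w n' w' ω c = 0 := by
  simp only [pullback, LinearMap.coe_mk, AddHom.coe_mk]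
  exact Finset.sum_eq_zero fun c' _ => if_neg fun hc => h hc.pushable

lemma exists_pushes_of_pullback_ne_zero {c : Cell n w} {ω : Cochain R n' w'}
    (h : pullback R n w n' w' ω c ≠ 0) : ∃ c' : Cell n' w', c.Pushes c' ∧ ω c' ≠ 0 := by
  simp only [pullback, LinearMap.coe_mk, AddHom.coe_mk] at h
  obtain ⟨c', -, hc'⟩ := Finset.exists_ne_zero_of_sum_ne_zero h
  split_ifs at hc' with h1
  · exact ⟨c', h1, right_ne_zero_of_mul hc'⟩
  · exact absurd rfl hc'

lemma pullback_self (n : ℕ) (w : Fin (m + 1) → ℕ) : pullback R n w n w = LinearMap.id := by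
  ext ω c
  rw [pullback_apply_of_pushes ((Cell.pushes_self c c).2 rfl), Cell.sgn_mul_self, one_mul]
  rfl

/-- The sign of the intermediate face occurs twice and cancels, which is the point of writing the
sign as a product `c.sgn R * c'.sgn R`. A face survives both stages exactly when it survives the
composite. -/
lemma pullback_comp (hw : IsRegularWeight n w) (hw₁ : ∀ v, w₁ v ≤ n₁) (hw' : ∀ v, w' v ≤ n')
    (h : Coarsens n w n₁ w₁) (h' : Coarsens n₁ w₁ n' w') :
    pullback R n w n₁ w₁ ∘ₗ pullback R n₁ w₁ n' w' = pullback R n w n' w' := by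
  refine LinearMap.ext fun ω => funext fun c => ?_
  rw [LinearMap.comp_apply]
  by_cases hc : c.Pushable w'
  · obtain ⟨c₁, hc₁⟩ := (hc.of_trans h').exists_pushes h hw₁
    obtain ⟨c', hc'⟩ := (hc₁.pushable_of_pushable hw hw₁ h h' hc).exists_pushes h' hw'
    rw [pullback_apply_of_pushes hc₁, pullback_apply_of_pushes hc',
      pullback_apply_of_pushes (hc₁.trans hw hw₁ h h' hc')]
    calc c.sgn R * c₁.sgn R * (c₁.sgn R * c'.sgn R * ω c')
        = c.sgn R * (c₁.sgn R * c₁.sgn R) * c'.sgn R * ω c' := by ring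
      _ = _ := by rw [Cell.sgn_mul_self, mul_one]
  · rw [pullback_apply_of_not_pushable hc]
    by_contra hne
    obtain ⟨c₁, hc₁, hne₁⟩ := exists_pushes_of_pullback_ne_zero hne
    obtain ⟨c', hc', -⟩ := exists_pushes_of_pullback_ne_zero hne₁
    exact hc (hc₁.trans hw hw₁ h h' hc').pushable

end Pullback

/-! ### Elementary amalgamations -/

section Elementary

variable {m n j : ℕ} {w : Fin (m + 1) → ℕ}

/-- The only block with two factors is `{j, j + 1}`, and there stopping at the first factor without
apex is the case distinction in `θ`. -/
lemma amalgamates_iff_pushes (hj : j ≤ n) (c : Cell (n + 1) w)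
    (c' : Cell n (collapse j ∘ w)) : Amalgamates j c c' ↔ c.Pushes c' := by
  have hcol : ∀ i k, collapse j i = k ↔ (k < j ∧ i = k) ∨ (k = j ∧ (i = j ∨ i = j + 1)) ∨
      (j < k ∧ i = k + 1) := by
    intro i k
    unfold collapse
    split_ifs <;> omega
  have hcol' : ∀ i k, collapse j i = collapse j k → i < k → i = j ∧ k = j + 1 := by
    intro i k
    unfold collapse
    split_ifs <;> omega
  -- `Pushes` speaks of vertices and `Amalgamates` of factors; they agree because a factor without
  -- apex contains a vertex.
  have hE : ∀ i ≤ n + 1, (∀ u ∈ c.F, w u = i → i ∈ c.E) ↔ i ∈ c.E := by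
    intro i hi
    refine ⟨fun H => ?_, fun h _ _ _ => h⟩
    by_contra hiE
    obtain ⟨v, hv, hvi⟩ := c.nonempty i hi hiE
    exact hiE (H v hv hvi)
  have hE' : (∀ i, i ∈ c'.E ↔ i < n ∧ ∀ u ∈ c.F, (collapse j ∘ w) u = i → w u ∈ c.E) ↔
      (∀ i < j, i ∈ c'.E ↔ i ∈ c.E) ∧ (∀ i > j, i ∈ c'.E ↔ i + 1 ∈ c.E) ∧
        (j ∈ c'.E ↔ j ∈ c.E ∧ j + 1 ∈ c.E) := by
    have h1 : ∀ i < j, (i < n ∧ ∀ u ∈ c.F, (collapse j ∘ w) u = i → w u ∈ c.E) ↔ i ∈ c.E := by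
      intro i hi
      rw [← hE i (by omega), and_iff_right (by omega : i < n)]
      refine forall₂_congr fun u _ => ?_
      rw [Function.comp_apply, hcol]
      constructor
      · intro H hu
        rw [← hu]
        exact H (Or.inl ⟨hi, hu⟩)
      · intro H hu
        have hu : w u = i := by omega
        rw [hu]
        exact H hu
    have h2 : ∀ i > j, (i < n ∧ ∀ u ∈ c.F, (collapse j ∘ w) u = i → w u ∈ c.E) ↔
        i + 1 ∈ c.E := by
      intro i hi
      constructor
      · rintro ⟨hn, H⟩
        rw [← hE (i + 1) (by omega)]
        intro u hu hui
        rw [← hui]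
        exact H u hu ((hcol _ _).2 (Or.inr (Or.inr ⟨hi, hui⟩)))
      · intro hiE
        have := c.lt_of_mem _ hiE
        refine ⟨by omega, fun u _ hui => ?_⟩
        have hui : w u = i + 1 := by
          have := (hcol _ _).1 hui
          omega
        rwa [hui]
    have h3 : (j < n ∧ ∀ u ∈ c.F, (collapse j ∘ w) u = j → w u ∈ c.E) ↔
        j ∈ c.E ∧ j + 1 ∈ c.E := by
      constructor
      · rintro ⟨hn, H⟩
        rw [← hE (j + 1) (by omega), ← hE j (by omega)]
        constructor
        · intro u hu hui
          rw [← hui]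
          exact H u hu ((hcol _ _).2 (by omega))
        · intro u hu hui
          rw [← hui]
          exact H u hu ((hcol _ _).2 (by omega))
      · rintro ⟨hjE, hjE'⟩
        have := c.lt_of_mem _ hjE'
        refine ⟨by omega, fun u _ hui => ?_⟩
        have hui : w u = j ∨ w u = j + 1 := by
          have := (hcol _ _).1 hui
          omega
        rcases hui with h | h <;> rwa [h]
    constructor
    · intro H
      exact ⟨fun i hi => (H i).trans (h1 i hi), fun i hi => (H i).trans (h2 i hi), (H j).trans h3⟩
    · rintro ⟨H1, H2, H3⟩ i
      rcases lt_trichotomy i j with hi | rfl | hi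
      · exact (H1 i hi).trans (h1 i hi).symm
      · exact H3.trans h3.symm
      · exact (H2 i hi).trans (h2 i hi).symm
  have hP : c.Pushable (collapse j ∘ w) ↔ (j ∉ c.E → c.degAt (j + 1) = 0) := by
    constructor
    · intro H hjE
      by_contra hne
      obtain ⟨v, hv, hvj⟩ := c.exists_mem_of_degAt_ne_zero hne
      obtain ⟨u, hu, huj⟩ := c.nonempty j (by omega) hjE
      rw [← hvj] at hne
      refine hne (H u hu v hv ?_ (by omega) (by rwa [huj]))
      rw [Function.comp_apply, Function.comp_apply, huj, hvj]
      unfold collapse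
      split_ifs <;> omega
    · intro H u _ v _ huv hlt huE
      obtain ⟨h1, h2⟩ := hcol' _ _ huv hlt
      rw [h2]
      rw [h1] at huE
      exact H huE
  have hF : (∀ v, v ∈ c'.F ↔ v ∈ c.F ∧ ∀ u ∈ c.F, (collapse j ∘ w) u = (collapse j ∘ w) v →
      w u < w v → w u ∈ c.E) ↔ c'.F = if j ∈ c.E then c.F else c.F.filter fun v => w v ≠ j + 1 := by
    rw [Finset.ext_iff]
    refine forall_congr' fun v => iff_congr Iff.rfl ?_
    split_ifs with hjE
    · refine and_iff_left fun u _ huv hlt => ?_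
      rw [(hcol' _ _ huv hlt).1]
      exact hjE
    · rw [Finset.mem_filter]
      refine and_congr_right fun _ => ⟨fun H hvj => ?_, fun H u _ huv hlt => ?_⟩
      · obtain ⟨u, hu, huj⟩ := c.nonempty j (by omega) hjE
        have := H u hu (by
          rw [Function.comp_apply, Function.comp_apply, huj, hvj]
          unfold collapse
          split_ifs <;> omega) (by omega)
        rw [huj] at this
        exact hjE this
      · exact absurd (hcol' _ _ huv hlt).2 H
  have hsplit : c.Pushes c' ↔ c.Pushable (collapse j ∘ w) ∧
      (∀ i, i ∈ c'.E ↔ i < n ∧ ∀ u ∈ c.F, (collapse j ∘ w) u = i → w u ∈ c.E) ∧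
      (∀ v, v ∈ c'.F ↔ v ∈ c.F ∧ ∀ u ∈ c.F, (collapse j ∘ w) u = (collapse j ∘ w) v →
        w u < w v → w u ∈ c.E) := ⟨fun h => ⟨h.1, h.2, h.3⟩, fun h => ⟨h.1, h.2.1, h.2.2⟩⟩
  rw [hsplit, hP, hE', hF]
  unfold Amalgamates
  split_ifs with hjE
  · simp only [hjE, true_and, not_true_eq_false, false_and, or_false, false_imp_iff]
    exact ⟨fun ⟨h1, h2, h3, h4⟩ => ⟨⟨h1, h2, h4⟩, h3⟩, fun ⟨⟨h1, h2, h4⟩, h3⟩ => ⟨h1, h2, h3, h4⟩⟩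
  · simp only [hjE, false_and, not_false_eq_true, true_and, false_or, true_imp_iff, iff_false]
    exact ⟨fun ⟨h1, h2, h3, h4, h5⟩ => ⟨h3, ⟨h1, h2, h5⟩, h4⟩,
      fun ⟨h3, ⟨h1, h2, h5⟩, h4⟩ => ⟨h1, h2, h3, h4, h5⟩⟩

lemma Cell.Pushes.degAt_collapse (hj : j ≤ n) {c : Cell (n + 1) w} {c' : Cell n (collapse j ∘ w)}
    (hc : c.Pushes c') (i : ℕ) (hi : i ≤ n) : c'.degAt i =
      ∑ k ∈ (Finset.range (n + 2)).filter (fun k => collapse j k = i), c.degAt k :=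
  hc.degAt_eq (coarsens_collapse hj w) (fun _ => rfl) hi

/-- By `cross_collapse` the exponents of the signs of `c` and `c'` differ by `|c_j||c_{j+1}|`, the
exponent in `elemPullback`. -/
lemma elemPullback_eq_pullback (R : Type*) [CommRing R] (hj : j ≤ n) :
    elemPullback R j = pullback R (n + 1) w n (collapse j ∘ w) := by
  classical
  refine LinearMap.ext fun ω => funext fun c => ?_
  simp only [elemPullback, pullback, LinearMap.coe_mk, AddHom.coe_mk]
  refine Finset.sum_congr rfl fun c' _ => ?_
  by_cases hc : c.Pushes c'
  · rw [if_pos ((amalgamates_iff_pushes hj c c').2 hc), if_pos hc]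
    congr 1
    unfold Cell.sgn
    rw [cross_collapse hj (hc.degAt_collapse hj) (hc.degAt_collapse hj), ← pow_add,
      mul_comm (c.degAt j)]
    rw [show ∀ a b : ℕ, a + b + a = 2 * a + b by intros; ring, pow_add, pow_mul (-1 : R) 2,
      neg_one_sq, one_pow, one_mul]
  · rw [if_neg (fun h => hc ((amalgamates_iff_pushes hj c c').1 h)), if_neg hc]

end Elementary

end BlownUp
namespace BlownUp

/-! ### Faces of blow ups as sets of vertices

The vertices of the blow up `cΔ_0 × ⋯ × cΔ_{n-1} × Δ_n` are the vertices of `Δ` and the apexes of the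
cones. They are ordered by their factor first, the apex being the last vertex of its factor. -/

/-- A linearly ordered set containing the vertices of the blow up. -/
structure Coding {m : ℕ} (w : Fin (m + 1) → ℕ) (L : Type*) [LinearOrder L] where
  vert : Fin (m + 1) → L
  apex : ℕ → L
  wt : L → ℕ
  strictMono_vert : StrictMono vert
  wt_vert : ∀ v, wt (vert v) = w v
  wt_apex : ∀ i, wt (apex i) = i
  vert_lt_apex : ∀ v, vert v < apex (w v)
  monotone_wt : Monotone wt

/-- The lexicographic order on the vertices of the blow up. -/
def Coding.lex {m : ℕ} {w : Fin (m + 1) → ℕ} (hw : Monotone w) :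
    Coding w (ℕ ×ₗ WithTop (Fin (m + 1))) where
  vert v := toLex (w v, (v : WithTop (Fin (m + 1))))
  apex i := toLex (i, ⊤)
  wt x := (ofLex x).1
  strictMono_vert u v huv := by
    rw [Prod.Lex.toLex_lt_toLex]
    rcases (hw huv.le).lt_or_eq with h | h
    · exact Or.inl h
    · exact Or.inr ⟨h, WithTop.coe_lt_coe.2 huv⟩
  wt_vert _ := rfl
  wt_apex _ := rfl
  vert_lt_apex v := by
    rw [Prod.Lex.toLex_lt_toLex]
    exact Or.inr ⟨rfl, WithTop.coe_lt_top v⟩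
  monotone_wt x y hxy := by
    rw [Prod.Lex.le_iff] at hxy
    rcases hxy with h | h
    · exact h.le
    · exact h.1.le

/-- The vertices of `P` in the `i`-th factor. -/
def layer {L : Type*} (wt : L → ℕ) (P : Finset L) (i : ℕ) : Finset L := P.filter fun x => wt x = i

lemma mem_layer {L : Type*} {wt : L → ℕ} {P : Finset L} {i : ℕ} {x : L} :
    x ∈ layer wt P i ↔ x ∈ P ∧ wt x = i := Finset.mem_filter

/-- `P` meets the factors `0, …, n`, and no other. -/
structure FullSupport {L : Type*} (n : ℕ) (wt : L → ℕ) (P : Finset L) : Prop where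
  le : ∀ x ∈ P, wt x ≤ n
  exists_eq : ∀ i ≤ n, ∃ x ∈ P, wt x = i

namespace Coding

variable {m n : ℕ} {w : Fin (m + 1) → ℕ} {L : Type*} [LinearOrder L] (K : Coding w L)

lemma lt_of_wt_lt {x y : L} (h : K.wt x < K.wt y) : x < y := by
  by_contra hlt
  exact absurd (K.monotone_wt (not_lt.1 hlt)) (not_le.2 h)

lemma apex_injective : Function.Injective K.apex := fun i k h => by
  rw [← K.wt_apex i, h, K.wt_apex]

lemma vert_ne_apex (v : Fin (m + 1)) (i : ℕ) : K.vert v ≠ K.apex i := by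
  intro h
  have h1 := K.vert_lt_apex v
  have h2 := congrArg K.wt h
  rw [K.wt_vert, K.wt_apex] at h2
  rw [h2, ← h] at h1
  exact lt_irrefl _ h1

/-- The set of vertices of a face of the blow up. -/
def code (c : Cell n w) : Finset L := c.F.image K.vert ∪ c.E.image K.apex

lemma mem_code {c : Cell n w} {x : L} :
    x ∈ K.code c ↔ (∃ v ∈ c.F, K.vert v = x) ∨ ∃ i ∈ c.E, K.apex i = x := by
  unfold code
  rw [Finset.mem_union, Finset.mem_image, Finset.mem_image]

lemma vert_mem_code {c : Cell n w} {v : Fin (m + 1)} : K.vert v ∈ K.code c ↔ v ∈ c.F := by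
  rw [mem_code]
  constructor
  · rintro (⟨u, hu, h⟩ | ⟨i, -, h⟩)
    · rwa [← K.strictMono_vert.injective h]
    · exact absurd h.symm (K.vert_ne_apex v i)
  · exact fun h => Or.inl ⟨v, h, rfl⟩

lemma apex_mem_code {c : Cell n w} {i : ℕ} : K.apex i ∈ K.code c ↔ i ∈ c.E := by
  rw [mem_code]
  constructor
  · rintro (⟨v, -, h⟩ | ⟨k, hk, h⟩)
    · exact absurd h (K.vert_ne_apex v i)
    · rwa [← K.apex_injective h]
  · exact fun h => Or.inr ⟨i, h, rfl⟩

lemma code_injective : Function.Injective (K.code (n := n)) := by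
  intro a b hab
  ext x
  · rw [← K.vert_mem_code, hab, K.vert_mem_code]
  · rw [← K.apex_mem_code, hab, K.apex_mem_code]

lemma card_layer_code (c : Cell n w) {i : ℕ} (hi : i ≤ n) :
    (layer K.wt (K.code c) i).card = c.degAt i + 1 := by
  have h : layer K.wt (K.code c) i =
      (c.factor i).image K.vert ∪ if i ∈ c.E then {K.apex i} else ∅ := by
    ext x
    rw [mem_layer, mem_code, Finset.mem_union, Finset.mem_image]
    constructor
    · rintro ⟨⟨v, hv, rfl⟩ | ⟨k, hk, rfl⟩, hx⟩
      · exact Or.inl ⟨v, Cell.mem_factor.2 ⟨hv, (K.wt_vert v).symm.trans hx⟩, rfl⟩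
      · rw [K.wt_apex] at hx
        subst hx
        rw [if_pos hk]
        exact Or.inr (Finset.mem_singleton_self _)
    · rintro (⟨v, hv, rfl⟩ | hx)
      · exact ⟨Or.inl ⟨v, (Cell.mem_factor.1 hv).1, rfl⟩,
          (K.wt_vert v).trans (Cell.mem_factor.1 hv).2⟩
      · split_ifs at hx with hE
        · rw [Finset.mem_singleton] at hx
          subst hx
          exact ⟨Or.inr ⟨i, hE, rfl⟩, K.wt_apex i⟩
        · simp at hx
  rw [c.degAt_add_one hi, h, Finset.card_union_of_disjoint,
    Finset.card_image_of_injective _ K.strictMono_vert.injective]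
  · split_ifs <;> simp
  · split_ifs
    · rw [Finset.disjoint_singleton_right, Finset.mem_image]
      rintro ⟨v, -, h⟩
      exact K.vert_ne_apex v i h
    · simp

lemma fullSupport_code (c : Cell n w) : FullSupport n K.wt (K.code c) where
  le x hx := by
    rcases K.mem_code.1 hx with ⟨v, hv, rfl⟩ | ⟨i, hi, rfl⟩
    · rw [K.wt_vert]
      exact c.weight_le v hv
    · rw [K.wt_apex]
      exact (c.lt_of_mem i hi).le
  exists_eq i hi := by
    have h : (layer K.wt (K.code c) i).Nonempty := by
      rw [← Finset.card_pos, K.card_layer_code c hi]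
      omega
    obtain ⟨x, hx⟩ := h
    exact ⟨x, mem_layer.1 hx⟩

/-- Meeting every factor is the defining condition of a face, so vertices may be deleted as long as
no factor is emptied. Containment in a code excludes the elements of `L` that are not vertices of
the blow up. -/
lemma exists_code_eq (c : Cell n w) {Q : Finset L} (hQ : FullSupport n K.wt Q)
    (hc : Q ⊆ K.code c) : ∃ b : Cell n w, K.code b = Q := by
  classical
  refine ⟨⟨c.F.filter fun v => K.vert v ∈ Q, c.E.filter fun i => K.apex i ∈ Q, ?_, ?_, ?_⟩, ?_⟩
  · exact fun i hi => c.lt_of_mem i (Finset.mem_filter.1 hi).1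
  · exact fun v hv => c.weight_le v (Finset.mem_filter.1 hv).1
  · intro i hi hE
    obtain ⟨x, hx, hxi⟩ := hQ.exists_eq i hi
    rcases K.mem_code.1 (hc hx) with ⟨v, hv, rfl⟩ | ⟨k, hk, rfl⟩
    · exact ⟨v, Finset.mem_filter.2 ⟨hv, hx⟩, (K.wt_vert v).symm.trans hxi⟩
    · rw [K.wt_apex] at hxi
      subst hxi
      exact absurd (Finset.mem_filter.2 ⟨hk, hx⟩) hE
  · ext x
    rw [mem_code]
    constructor
    · rintro (⟨v, hv, rfl⟩ | ⟨k, hk, rfl⟩)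
      · exact (Finset.mem_filter.1 hv).2
      · exact (Finset.mem_filter.1 hk).2
    · intro hx
      rcases K.mem_code.1 (hc hx) with ⟨v, hv, rfl⟩ | ⟨k, hk, rfl⟩
      · exact Or.inl ⟨v, Finset.mem_filter.2 ⟨hv, hx⟩, rfl⟩
      · exact Or.inr ⟨k, Finset.mem_filter.2 ⟨hk, hx⟩, rfl⟩

/-- The vertices of the blow up of an elementary amalgamation of `Δ`: the apex of the factor `j`
disappears. -/
def collapse (j : ℕ) : Coding (BlownUp.collapse j ∘ w) L where
  vert := K.vert
  -- The gathered factor inherits the apex of the factor `j + 1`, and the later ones are renumbered.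
  apex i := K.apex (if i < j then i else i + 1)
  wt x := BlownUp.collapse j (K.wt x)
  strictMono_vert := K.strictMono_vert
  wt_vert v := by rw [K.wt_vert, Function.comp_apply]
  wt_apex i := by
    rw [K.wt_apex]
    unfold BlownUp.collapse
    split_ifs <;> omega
  vert_lt_apex v := by
    refine (K.vert_lt_apex v).trans_le ?_
    rw [Function.comp_apply]
    have h : w v ≤ if BlownUp.collapse j (w v) < j then BlownUp.collapse j (w v)
        else BlownUp.collapse j (w v) + 1 := by
      unfold BlownUp.collapse
      split_ifs <;> omega
    rcases h.lt_or_eq with h | h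
    · exact (K.lt_of_wt_lt (by rwa [K.wt_apex, K.wt_apex])).le
    · rw [← h]
  monotone_wt := (monotone_collapse j).comp K.monotone_wt

end Coding

/-! ### Elementary amalgamations of sets of vertices -/

section Amalg

variable {L : Type*} [LinearOrder L]

/-- The elementary amalgamation of the factors `j` and `j + 1`, where `z` is the apex of the
factor `j`. -/
def amalg (wt : L → ℕ) (j : ℕ) (z : L) (P : Finset L) : Finset L :=
  if z ∈ P then P.erase z else P.filter fun x => wt x ≠ j + 1

/-- The elementary amalgamation does not kill `P`. -/
def Amalgamable (wt : L → ℕ) (j : ℕ) (z : L) (P : Finset L) : Prop :=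
  z ∈ P ∨ (layer wt P (j + 1)).card = 1

variable {m n j : ℕ} {w : Fin (m + 1) → ℕ} (K : Coding w L)

lemma amalgamable_code_iff (hj : j ≤ n) (c : Cell (n + 1) w) :
    Amalgamable K.wt j (K.apex j) (K.code c) ↔ c.Pushable (collapse j ∘ w) := by
  unfold Amalgamable
  rw [K.apex_mem_code, K.card_layer_code c (by omega)]
  constructor
  · intro H u _ v _ huv hlt huE
    have : w u = j ∧ w v = j + 1 := by
      simp only [Function.comp_apply] at huv
      unfold collapse at huv
      split_ifs at huv <;> omega
    rw [this.1] at huE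
    rw [this.2]
    rcases H with H | H
    · exact absurd H huE
    · omega
  · intro H
    by_contra hne
    push Not at hne
    obtain ⟨v, hv, hvj⟩ := c.exists_mem_of_degAt_ne_zero (i := j + 1) (by omega)
    obtain ⟨u, hu, huj⟩ := c.nonempty j (by omega) hne.1
    have := H u hu v hv (by
      rw [Function.comp_apply, Function.comp_apply, huj, hvj]
      unfold collapse
      split_ifs <;> omega) (by omega) (by rw [huj]; exact hne.1)
    rw [hvj] at this
    omega

/-- Since `L` and its order are unchanged by the amalgamation, pushing forward is an operation on
subsets of `L`. If the apex of the factor `j` is present, it alone is lost; otherwise the factor `j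
+ 1` is a single vertex or apex, and that one is lost. -/
lemma code_collapse_eq (hj : j ≤ n) {c : Cell (n + 1) w} {c' : Cell n (collapse j ∘ w)}
    (h : c.Pushes c') : (K.collapse j).code c' = amalg K.wt j (K.apex j) (K.code c) := by
  obtain ⟨h1, h2, h3⟩ := (amalgamates_iff_pushes hj c c').2 h
  have hvert : ∀ v, (K.vert v ∈ (K.collapse j).code c' ↔
      K.vert v ∈ amalg K.wt j (K.apex j) (K.code c)) := by
    intro v
    refine ((K.collapse j).vert_mem_code).trans ?_
    unfold amalg
    rcases h3 with ⟨hE, hF, -⟩ | ⟨hE, -, hF, -⟩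
    · rw [if_pos (K.apex_mem_code.2 hE), hF, Finset.mem_erase, K.vert_mem_code, and_iff_right (K.vert_ne_apex v j)]
    · rw [if_neg (mt K.apex_mem_code.1 hE), hF, Finset.mem_filter, Finset.mem_filter, K.vert_mem_code, K.wt_vert]
  have hapex : ∀ i, (K.apex i ∈ (K.collapse j).code c' ↔
      K.apex i ∈ amalg K.wt j (K.apex j) (K.code c)) := by
    intro i
    have h4 : K.apex i ∈ (K.collapse j).code c' ↔ ∃ k ∈ c'.E, (if k < j then k else k + 1) = i := by
      rw [Coding.mem_code]
      constructor
      · rintro (⟨v, -, hv⟩ | ⟨k, hk, hki⟩)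
        · exact absurd hv (K.vert_ne_apex v i)
        · exact ⟨k, hk, K.apex_injective hki⟩
      · rintro ⟨k, hk, hki⟩
        exact Or.inr ⟨k, hk, congrArg K.apex hki⟩
    have h5 : K.apex i ∈ amalg K.wt j (K.apex j) (K.code c) ↔
        i ∈ c.E ∧ i ≠ if j ∈ c.E then j else j + 1 := by
      unfold amalg
      by_cases hE : j ∈ c.E
      · rw [if_pos (K.apex_mem_code.2 hE), if_pos hE, Finset.mem_erase, K.apex_mem_code,
          K.apex_injective.ne_iff, and_comm]
      · rw [if_neg (mt K.apex_mem_code.1 hE), if_neg hE, Finset.mem_filter, K.apex_mem_code,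
          K.wt_apex]
    rw [h4, h5]
    constructor
    · rintro ⟨k, hk, rfl⟩
      rcases lt_trichotomy k j with hkj | rfl | hkj
      · rw [if_pos hkj]
        refine ⟨(h1 k hkj).1 hk, ?_⟩
        split_ifs <;> omega
      · rw [if_neg (lt_irrefl k)]
        rcases h3 with ⟨hE, -, h6⟩ | ⟨-, -, -, h6⟩
        · exact ⟨h6.1 hk, by rw [if_pos hE]; omega⟩
        · exact absurd hk h6
      · rw [if_neg (by omega)]
        refine ⟨(h2 k hkj).1 hk, ?_⟩
        split_ifs <;> omega
    · rintro ⟨hi, hne⟩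
      rcases lt_trichotomy i j with hij | rfl | hij
      · exact ⟨i, (h1 i hij).2 hi, if_pos hij⟩
      · rw [if_pos hi] at hne
        exact absurd rfl hne
      · refine ⟨i - 1, ?_, by rw [if_neg (by omega)]; omega⟩
        by_cases hij' : i = j + 1
        · subst hij'
          rcases h3 with ⟨-, -, h6⟩ | ⟨hE, -⟩
          · exact h6.2 hi
          · rw [if_neg hE] at hne
            exact absurd rfl hne
        · refine (h2 (i - 1) (by omega)).2 ?_
          rwa [Nat.sub_add_cancel (by omega)]
  ext x
  constructor
  · intro hx
    rcases (K.collapse j).mem_code.1 hx with ⟨v, -, rfl⟩ | ⟨i, -, rfl⟩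
    · exact (hvert v).1 hx
    · exact (hapex _).1 hx
  · intro hx
    have hx' : x ∈ K.code c := by
      unfold amalg at hx
      split_ifs at hx
      · exact Finset.mem_of_mem_erase hx
      · exact (Finset.mem_filter.1 hx).1
    rcases K.mem_code.1 hx' with ⟨v, -, rfl⟩ | ⟨i, -, rfl⟩
    · exact (hvert v).2 hx
    · exact (hapex i).2 hx

/-- Injectivity of the coding turns an equality of vertex sets back into a push-forward;
surjectivity in the bijection for cup products relies on this. -/
lemma pushes_iff_code (hj : j ≤ n) (hw : IsRegularWeight (n + 1) w) (c : Cell (n + 1) w)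
    (c' : Cell n (collapse j ∘ w)) :
    c.Pushes c' ↔ Amalgamable K.wt j (K.apex j) (K.code c) ∧
      (K.collapse j).code c' = amalg K.wt j (K.apex j) (K.code c) := by
  constructor
  · exact fun h => ⟨(amalgamable_code_iff K hj c).2 h.pushable, code_collapse_eq K hj h⟩
  · rintro ⟨h1, h2⟩
    obtain ⟨d, hd⟩ := ((amalgamable_code_iff K hj c).1 h1).exists_pushes (coarsens_collapse hj w)
      (hw.collapse hj).le
    have := (K.collapse j).code_injective (h2.trans (code_collapse_eq K hj hd).symm)
    rwa [this]

end Amalg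

/-! ### The differential in terms of sets of vertices -/

section Differential

variable {R : Type*} [CommRing R] {L : Type*} [LinearOrder L]

/-- The differential on functions on sets of vertices. -/
def codeCob (n : ℕ) (wt : L → ℕ) (W : Finset L → R) (P : Finset L) : R :=
  ∑ x ∈ P, (-1) ^ ((P.filter fun y => x < y).card + (n - wt x)) * W (P.erase x)

variable {m n : ℕ} {w : Fin (m + 1) → ℕ} (K : Coding w L)

/-- Adding a vertex of `Δ` and adding an apex become the same operation. No vertex of its factor
comes after an apex, so the second exponent vanishes for apexes, as in `cobCoeff`. -/
lemma cobCoeff_eq_sum_code (b c : Cell n w) :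
    cobCoeff R b c = ∑ x ∈ K.code c, if K.code b = (K.code c).erase x then
      (-1) ^ (b.degBelow (K.wt x) +
        ((K.code b).filter fun y => x < y ∧ K.wt y = K.wt x).card) else 0 := by
  have hdisj : Disjoint (c.F.image K.vert) (c.E.image K.apex) := by
    rw [Finset.disjoint_left]
    rintro x hx hx'
    obtain ⟨v, -, rfl⟩ := Finset.mem_image.1 hx
    obtain ⟨i, -, h⟩ := Finset.mem_image.1 hx'
    exact K.vert_ne_apex v i h.symm
  have hsum : ∀ f : L → R, ∑ x ∈ K.code c, f x =
      ∑ v ∈ c.F, f (K.vert v) + ∑ i ∈ c.E, f (K.apex i) := by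
    intro f
    unfold Coding.code
    rw [Finset.sum_union hdisj, Finset.sum_image fun u _ v _ h => K.strictMono_vert.injective h,
      Finset.sum_image fun u _ v _ h => K.apex_injective h]
  rw [hsum]
  unfold cobCoeff
  have hv : ∀ e, (e ∉ b.F ∧ c.F = insert e b.F ∧ c.E = b.E) ↔
      e ∈ c.F ∧ K.code b = (K.code c).erase (K.vert e) := by
    intro e
    constructor
    · rintro ⟨h1, h2, h3⟩
      refine ⟨h2 ▸ Finset.mem_insert_self _ _, ?_⟩
      ext x
      rw [Finset.mem_erase, K.mem_code, K.mem_code, h2, h3]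
      constructor
      · rintro (⟨v, hv, rfl⟩ | ⟨i, hi, rfl⟩)
        · refine ⟨fun h => h1 ?_, Or.inl ⟨v, Finset.mem_insert_of_mem hv, rfl⟩⟩
          rwa [← K.strictMono_vert.injective h]
        · exact ⟨(K.vert_ne_apex e i).symm, Or.inr ⟨i, hi, rfl⟩⟩
      · rintro ⟨hne, ⟨v, hv, rfl⟩ | h⟩
        · rcases Finset.mem_insert.1 hv with rfl | hv
          · exact absurd rfl hne
          · exact Or.inl ⟨v, hv, rfl⟩
        · exact Or.inr h
    · rintro ⟨h1, h2⟩
      have hF : ∀ v, v ∈ b.F ↔ v ≠ e ∧ v ∈ c.F := fun v => by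
        rw [← K.vert_mem_code, h2, Finset.mem_erase, K.vert_mem_code,
          K.strictMono_vert.injective.ne_iff]
      refine ⟨fun h => ((hF e).1 h).1 rfl, ?_, ?_⟩
      · ext v
        rw [Finset.mem_insert, hF]
        by_cases hve : v = e
        · subst hve
          simp [h1]
        · simp [hve]
      · ext i
        rw [← K.apex_mem_code, ← K.apex_mem_code, h2, Finset.mem_erase,
          and_iff_right (K.vert_ne_apex e i).symm]
  have ha : ∀ i, (i ∉ b.E ∧ c.F = b.F ∧ c.E = insert i b.E) ↔
      i ∈ c.E ∧ K.code b = (K.code c).erase (K.apex i) := by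
    intro i
    constructor
    · rintro ⟨h1, h2, h3⟩
      refine ⟨h3 ▸ Finset.mem_insert_self _ _, ?_⟩
      ext x
      rw [Finset.mem_erase, K.mem_code, K.mem_code, h2, h3]
      constructor
      · rintro (⟨v, hv, rfl⟩ | ⟨k, hk, rfl⟩)
        · exact ⟨K.vert_ne_apex v i, Or.inl ⟨v, hv, rfl⟩⟩
        · refine ⟨fun h => h1 ?_, Or.inr ⟨k, Finset.mem_insert_of_mem hk, rfl⟩⟩
          rwa [← K.apex_injective h]
      · rintro ⟨hne, h | ⟨k, hk, rfl⟩⟩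
        · exact Or.inl h
        · rcases Finset.mem_insert.1 hk with rfl | hk
          · exact absurd rfl hne
          · exact Or.inr ⟨k, hk, rfl⟩
    · rintro ⟨h1, h2⟩
      have hE : ∀ k, k ∈ b.E ↔ k ≠ i ∧ k ∈ c.E := fun k => by
        rw [← K.apex_mem_code, h2, Finset.mem_erase, K.apex_mem_code, K.apex_injective.ne_iff]
      refine ⟨fun h => ((hE i).1 h).1 rfl, ?_, ?_⟩
      · ext v
        rw [← K.vert_mem_code, ← K.vert_mem_code, h2, Finset.mem_erase,
          and_iff_right (K.vert_ne_apex v i)]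
      · ext k
        rw [Finset.mem_insert, hE]
        by_cases hki : k = i
        · subst hki
          simp [h1]
        · simp [hki]
  congr 1
  · rw [← Finset.sum_filter_add_sum_filter_not Finset.univ (fun e => e ∈ c.F),
      Finset.filter_univ_mem, Finset.sum_eq_zero (s := Finset.filter _ _), add_zero]
    · refine Finset.sum_congr rfl fun e he => ?_
      refine if_congr ((hv e).trans (and_iff_right he)) ?_ rfl
      rw [K.wt_vert, add_assoc]
      congr 2
      have hset : (K.code b).filter (fun y => K.vert e < y ∧ K.wt y = w e) =
          ((b.factor (w e)).filter fun u => e < u).image K.vert ∪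
            if w e ∈ b.E then {K.apex (w e)} else ∅ := by
        ext x
        rw [Finset.mem_filter, K.mem_code, Finset.mem_union, Finset.mem_image]
        constructor
        · rintro ⟨⟨v, hv, rfl⟩ | ⟨k, hk, rfl⟩, hx1, hx2⟩
          · rw [K.wt_vert] at hx2
            exact Or.inl ⟨v, Finset.mem_filter.2 ⟨Cell.mem_factor.2 ⟨hv, hx2⟩,
              K.strictMono_vert.lt_iff_lt.1 hx1⟩, rfl⟩
          · rw [K.wt_apex] at hx2
            subst hx2
            rw [if_pos hk]
            exact Or.inr (Finset.mem_singleton_self _)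
        · rintro (⟨v, hv, rfl⟩ | hx)
          · obtain ⟨h1, h2⟩ := Finset.mem_filter.1 hv
            obtain ⟨h1, h3⟩ := Cell.mem_factor.1 h1
            exact ⟨Or.inl ⟨v, h1, rfl⟩, K.strictMono_vert h2, (K.wt_vert v).trans h3⟩
          · split_ifs at hx with hE
            · rw [Finset.mem_singleton] at hx
              subst hx
              exact ⟨Or.inr ⟨_, hE, rfl⟩, K.vert_lt_apex e, K.wt_apex _⟩
            · simp at hx
      rw [hset, Finset.card_union_of_disjoint,
        Finset.card_image_of_injective _ K.strictMono_vert.injective]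
      · split_ifs <;> simp
      · split_ifs
        · rw [Finset.disjoint_singleton_right, Finset.mem_image]
          rintro ⟨v, -, h⟩
          exact K.vert_ne_apex v _ h
        · simp
    · intro e he
      rw [if_neg]
      exact fun h => (Finset.mem_filter.1 he).2 ((hv e).1 h).1
  · rw [← Finset.sum_subset (s₁ := c.E)
      (fun i hi => Finset.mem_range.2 (c.lt_of_mem i hi))]
    · refine Finset.sum_congr rfl fun i hi => ?_
      refine if_congr ((ha i).trans (and_iff_right hi)) ?_ rfl
      rw [K.wt_apex, Finset.card_eq_zero.2, add_zero]
      rw [Finset.filter_eq_empty_iff]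
      rintro x hx ⟨hx1, hx2⟩
      rcases K.mem_code.1 hx with ⟨v, hv, rfl⟩ | ⟨k, hk, rfl⟩
      · rw [K.wt_vert] at hx2
        have := K.vert_lt_apex v
        rw [hx2] at this
        exact lt_asymm this hx1
      · rw [K.wt_apex] at hx2
        rw [hx2] at hx1
        exact lt_irrefl _ hx1
    · intro i _ hi
      rw [if_neg]
      exact fun h => hi ((ha i).1 h).1

/-- Raising the dimension of the factor `i` by one adds one pairing with each of the other factors.
-/
lemma cross_add_single {n i : ℕ} (hi : i ≤ n) (a b : ℕ → ℕ)
    (h : ∀ k ≤ n, a k = b k + if k = i then 1 else 0) :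
    cross n a a = cross n b b + (∑ k ∈ Finset.range i, b k + ∑ k ∈ Finset.Ioc i n, b k) := by
  have h1 : ∑ k ∈ Finset.range i, b k = ∑ p ∈ Finset.range (n + 1), ∑ k ∈ Finset.range (n + 1),
      if p = i then (if k < i then b k else 0) else 0 := by
    symm
    rw [Finset.sum_eq_single i]
    · simp only [if_true, ← Finset.sum_filter]
      refine Finset.sum_congr ?_ fun _ _ => rfl
      ext k
      simp only [Finset.mem_range, Finset.mem_filter]
      omega
    · intro p _ hp
      exact Finset.sum_eq_zero fun k _ => if_neg hp
    · intro h
      simp only [Finset.mem_range] at h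
      omega
  have h2 : ∑ k ∈ Finset.Ioc i n, b k = ∑ p ∈ Finset.range (n + 1), ∑ k ∈ Finset.range (n + 1),
      if k = i then (if i < p then b p else 0) else 0 := by
    symm
    rw [Finset.sum_comm, Finset.sum_eq_single i]
    · simp only [if_true, ← Finset.sum_filter]
      refine Finset.sum_congr ?_ fun _ _ => rfl
      ext k
      simp only [Finset.mem_range, Finset.mem_filter, Finset.mem_Ioc]
      omega
    · intro p _ hp
      exact Finset.sum_eq_zero fun k _ => if_neg hp
    · intro h
      simp only [Finset.mem_range] at h
      omega
  rw [h1, h2, cross, cross, ← Finset.sum_add_distrib, ← Finset.sum_add_distrib]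
  refine Finset.sum_congr rfl fun p hp => ?_
  rw [← Finset.sum_add_distrib, ← Finset.sum_add_distrib]
  refine Finset.sum_congr rfl fun k hk => ?_
  rw [h p (Nat.lt_succ_iff.1 (Finset.mem_range.1 hp)),
    h k (Nat.lt_succ_iff.1 (Finset.mem_range.1 hk))]
  split_ifs <;> first | omega | (subst_vars; ring)

/-- The exponents of the signs of `c` and `b` differ by `degBelow + degAbove`, so the twist trades
`degBelow` for `degAbove`. A later factor of dimension `d` has `d + 1` vertices; the summand `n -
K.wt x` cancels, modulo `2`, the excess of one for each of these factors. -/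
lemma sgn_mul_sign_eq {b c : Cell n w} {x : L} (hx : x ∈ K.code c)
    (h : K.code b = (K.code c).erase x) :
    c.sgn R * (-1) ^ (b.degBelow (K.wt x) +
        ((K.code b).filter fun y => x < y ∧ K.wt y = K.wt x).card)
      = (-1) ^ (((K.code c).filter fun y => x < y).card + (n - K.wt x)) * b.sgn R := by
  have hxn : K.wt x ≤ n := (K.fullSupport_code c).le x hx
  have hdeg : ∀ k ≤ n, c.degAt k = b.degAt k + if k = K.wt x then 1 else 0 := by
    intro k hk
    have h1 := K.card_layer_code b hk
    have h2 := K.card_layer_code c hk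
    have h3 : layer K.wt (K.code b) k = (layer K.wt (K.code c) k).erase x := by
      rw [h]
      exact Finset.filter_erase _ _ _
    rw [h3] at h1
    split_ifs with hkx
    · rw [Finset.card_erase_of_mem (mem_layer.2 ⟨hx, hkx.symm⟩)] at h1
      omega
    · rw [Finset.erase_eq_of_notMem fun hx' => hkx (mem_layer.1 hx').2.symm] at h1
      omega
  have hcard : ((K.code c).filter fun y => x < y).card =
      ((K.code b).filter fun y => x < y ∧ K.wt y = K.wt x).card
        + (b.degAbove (K.wt x) + (n - K.wt x)) := by
    have h1 : ((K.code c).filter fun y => K.wt x < K.wt y).card =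
        b.degAbove (K.wt x) + (n - K.wt x) := by
      rw [Finset.card_eq_sum_card_fiberwise (f := K.wt) (t := Finset.Ioc (K.wt x) n)]
      · have : ∀ k ∈ Finset.Ioc (K.wt x) n, (Finset.filter (fun y => K.wt y = k)
            ((K.code c).filter fun y => K.wt x < K.wt y)).card = b.degAt k + 1 := by
          intro k hk
          obtain ⟨hk1, hk2⟩ := Finset.mem_Ioc.1 hk
          have h2 := hdeg k hk2
          rw [if_neg (by omega)] at h2
          rw [← Nat.add_zero (b.degAt k), ← h2, ← K.card_layer_code c hk2]
          congr 1
          ext y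
          rw [Finset.mem_filter, Finset.mem_filter, mem_layer]
          constructor
          · exact fun h => ⟨h.1.1, h.2⟩
          · exact fun h => ⟨⟨h.1, by omega⟩, h.2⟩
        rw [Finset.sum_congr rfl this, Finset.sum_add_distrib, Finset.sum_const, Nat.card_Ioc,
          smul_eq_mul, mul_one]
        rfl
      · intro y hy
        obtain ⟨h2, h3⟩ := Finset.mem_filter.1 (Finset.mem_coe.1 hy)
        exact Finset.mem_coe.2 (Finset.mem_Ioc.2 ⟨h3, (K.fullSupport_code c).le y h2⟩)
    rw [← h1, ← Finset.card_union_of_disjoint]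
    · congr 1
      ext y
      simp only [Finset.mem_union, Finset.mem_filter, h, Finset.mem_erase]
      constructor
      · rintro ⟨hy, hxy⟩
        rcases (K.monotone_wt hxy.le).lt_or_eq with h2 | h2
        · exact Or.inr ⟨hy, h2⟩
        · exact Or.inl ⟨⟨hxy.ne', hy⟩, hxy, h2.symm⟩
      · rintro (h2 | h2)
        · exact ⟨h2.1.2, h2.2.1⟩
        · exact ⟨h2.1, K.lt_of_wt_lt h2.2⟩
    · rw [Finset.disjoint_left]
      intro y hy hy'
      have h2 := (Finset.mem_filter.1 hy).2.2
      have h3 := (Finset.mem_filter.1 hy').2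
      omega
  have hcross := cross_add_single hxn c.degAt b.degAt hdeg
  unfold Cell.sgn
  rw [hcard, hcross, ← pow_add, ← pow_add]
  refine neg_one_pow_congr ?_
  change Even (_ + (b.degBelow (K.wt x) + b.degAbove (K.wt x)) + _) ↔ _
  simp only [Nat.even_add]
  tauto

/-- Extension by zero allows every element to be deleted in `codeCob`, even when this empties a
factor. -/
lemma sgn_mul_cob (ω : Cochain R n w) (c : Cell n w) :
    c.sgn R * cob R ω c =
      codeCob n K.wt (Function.extend K.code (fun b => b.sgn R * ω b) 0) (K.code c) := by
  unfold codeCob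
  simp only [cob, LinearMap.coe_mk, AddHom.coe_mk, cobCoeff_eq_sum_code K, Finset.sum_mul]
  rw [Finset.sum_comm, Finset.mul_sum]
  refine Finset.sum_congr rfl fun x hx => ?_
  by_cases hex : ∃ b : Cell n w, K.code b = (K.code c).erase x
  · obtain ⟨b, hb⟩ := hex
    rw [Finset.sum_eq_single b, if_pos hb, ← hb, K.code_injective.extend_apply, ← mul_assoc,
      ← mul_assoc, sgn_mul_sign_eq K hx hb]
    · intro d _ hd
      rw [if_neg, zero_mul]
      exact fun h => hd (K.code_injective (h.trans hb.symm))
    · exact fun h => absurd (Finset.mem_univ _) h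
  · rw [Function.extend_apply' _ _ _ hex, Pi.zero_apply, mul_zero, Finset.sum_eq_zero, mul_zero]
    intro b _
    rw [if_neg fun h => hex ⟨b, h⟩, zero_mul]

end Differential

end BlownUp
namespace BlownUp

/-! ### Elementary amalgamations commute with the differential -/

section AmalgCob

variable {R : Type*} [CommRing R] {L : Type*} [LinearOrder L]

open Classical in
/-- The pull-back of functions on sets of vertices by an elementary amalgamation. -/
noncomputable def codePullback (n : ℕ) (wt : L → ℕ) (j : ℕ) (z : L) (W : Finset L → R)
    (P : Finset L) : R :=
  if FullSupport (n + 1) wt P ∧ Amalgamable wt j z P then W (amalg wt j z P) else 0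

/-- For `x` in a factor up to `j`, the count of later vertices and the count of later factors both
drop by one; for `x` beyond `j` neither changes. -/
lemma card_filter_erase_add {P : Finset L} {t x : L} {n j : ℕ} {wt : L → ℕ} (ht : t ∈ P)
    (hx : wt x ≤ n + 1) (hj : j ≤ n) (h1 : wt x ≤ j → x < t) (h2 : j < wt x → ¬ x < t) :
    (-1 : R) ^ ((P.filter fun y => x < y).card + (n + 1 - wt x)) =
      (-1) ^ (((P.erase t).filter fun y => x < y).card + (n - collapse j (wt x))) := by
  refine neg_one_pow_congr ?_
  rw [Finset.filter_erase]
  unfold collapse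
  split_ifs with hxj
  · have h3 : t ∈ P.filter fun y => x < y := Finset.mem_filter.2 ⟨ht, h1 hxj⟩
    have h4 := Finset.card_pos.2 ⟨t, h3⟩
    rw [Finset.card_erase_of_mem h3]
    have h5 : (P.filter fun y => x < y).card + (n + 1 - wt x) =
      (P.filter fun y => x < y).card - 1 + (n - wt x) + 2 := by omega
    rw [h5, Nat.even_add]
    simp
  · rw [Finset.erase_eq_of_notMem fun h => h2 (by omega) (Finset.mem_filter.1 h).2]
    have h5 : n + 1 - wt x = n - (wt x - 1) := by omega
    rw [h5]

/-- Away from `j` and `j + 1` the weight can be read off after collapsing, so full support of `Q` is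
enough; the last hypothesis treats these two factors. -/
lemma fullSupport_erase_of_collapse {n j : ℕ} {wt : L → ℕ} {P Q : Finset L} {x : L}
    (hP : FullSupport (n + 1) wt P) (hj : j ≤ n) (hQ : FullSupport n (fun y => collapse j (wt y)) Q)
    (hQP : Q ⊆ P.erase x) (hx : wt x = j ∨ wt x = j + 1 → ∃ y ∈ P.erase x, wt y = wt x) :
    FullSupport (n + 1) wt (P.erase x) where
  le y hy := hP.le y (Finset.mem_of_mem_erase hy)
  exists_eq i hi := by
    obtain ⟨y, hy, hyi⟩ := hP.exists_eq i hi
    by_cases hyx : y = x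
    · subst hyx
      by_cases hyj : wt y = j ∨ wt y = j + 1
      · obtain ⟨u, hu, huy⟩ := hx hyj
        exact ⟨u, hu, huy.trans hyi⟩
      · obtain ⟨u, hu, hui⟩ := hQ.exists_eq (collapse j i)
          ((monotone_collapse j hi).trans (collapse_succ_of_le hj).le)
        refine ⟨u, hQP hu, ?_⟩
        unfold collapse at hui
        split_ifs at hui <;> omega
    · exact ⟨y, Finset.mem_erase.2 ⟨hyx, hy⟩, hyi⟩

variable {n j : ℕ} {wt : L → ℕ} {z : L} {W : Finset L → R} {P : Finset L}

/-- Deleting `x ≠ z` commutes with deleting `z`, with one exception: if the factor `j + 1` has a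
single vertex `y`, deleting `y` gives `0` on the left. The missing term comes from deleting `z` on
the left, as the amalgamation of the remaining set then removes `y`. -/
lemma codeCob_codePullback_of_mem (hmono : Monotone wt) (hj : j ≤ n) (hz : wt z = j)
    (hmax : ∀ x, wt x = j → x ≤ z)
    (hW : ∀ Q, W Q ≠ 0 → FullSupport n (fun y => collapse j (wt y)) Q)
    (hP : FullSupport (n + 1) wt P) (hzP : z ∈ P) :
    codeCob (n + 1) wt (codePullback n wt j z W) P =
      codeCob n (fun y => collapse j (wt y)) W (P.erase z) := by
  have hlt : ∀ {x y}, wt x < wt y → x < y := fun {x y} h => by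
    by_contra hle
    exact absurd (hmono (not_lt.1 hle)) (not_le.2 h)
  have hterm : ∀ x ∈ P.erase z, layer wt P (j + 1) ≠ {x} →
      (-1) ^ ((P.filter fun y => x < y).card + (n + 1 - wt x)) *
        codePullback n wt j z W (P.erase x) =
      (-1) ^ (((P.erase z).filter fun y => x < y).card + (n - collapse j (wt x))) *
        W ((P.erase z).erase x) := by
    intro x hx hlay
    obtain ⟨hxz, hxP⟩ := Finset.mem_erase.1 hx
    rw [card_filter_erase_add hzP (hP.le x hxP) hj]
    · congr 1
      have hz' : z ∈ P.erase x := Finset.mem_erase.2 ⟨hxz.symm, hzP⟩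
      have ham : amalg wt j z (P.erase x) = (P.erase z).erase x := by
        unfold amalg
        rw [if_pos hz', Finset.erase_right_comm]
      unfold codePullback
      rw [ham]
      split_ifs with h
      · rfl
      · by_contra hne
        refine h ⟨fullSupport_erase_of_collapse hP hj (hW _ (Ne.symm hne)) ?_ ?_, Or.inl hz'⟩
        · rw [Finset.erase_right_comm]
          exact Finset.erase_subset _ _
        · rintro (hxj | hxj)
          · exact ⟨z, hz', hz.trans hxj.symm⟩
          · by_contra hno
            push Not at hno
            apply hlay
            ext y
            rw [mem_layer, Finset.mem_singleton]
            constructor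
            · rintro ⟨hy, hyj⟩
              by_contra hyx
              exact hno y (Finset.mem_erase.2 ⟨hyx, hy⟩) (hyj.trans hxj.symm)
            · rintro rfl
              exact ⟨hxP, hxj⟩
    · intro hxj
      rcases hxj.lt_or_eq with h | h
      · exact hlt (by omega)
      · exact lt_of_le_of_ne (hmax x h) hxz
    · exact fun hxj => not_lt.2 (hlt (by omega)).le
  have hzz : z ∉ P.erase z := Finset.notMem_erase z P
  unfold codeCob
  rw [← Finset.add_sum_erase P _ hzP]
  by_cases hcard : ∃ y, layer wt P (j + 1) = {y}
  · obtain ⟨y, hy⟩ := hcard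
    have hy' : y ∈ P ∧ wt y = j + 1 := mem_layer.1 (hy ▸ Finset.mem_singleton_self y)
    have hyz : y ≠ z := fun h => by
      rw [h] at hy'
      omega
    have hyP : y ∈ P.erase z := Finset.mem_erase.2 ⟨hyz, hy'.1⟩
    rw [← Finset.add_sum_erase (P.erase z) _ hyP, ← Finset.add_sum_erase (P.erase z) _ hyP,
      ← add_assoc]
    congr 1
    · have h0 : codePullback n wt j z W (P.erase y) = 0 := by
        unfold codePullback
        rw [if_neg]
        rintro ⟨h, -⟩
        obtain ⟨u, hu, huj⟩ := h.exists_eq (j + 1) (by omega)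
        obtain ⟨huy, hu⟩ := Finset.mem_erase.1 hu
        have : u ∈ layer wt P (j + 1) := mem_layer.2 ⟨hu, huj⟩
        rw [hy] at this
        exact huy (Finset.mem_singleton.1 this)
      rw [h0, mul_zero, add_zero]
      have hzy : z < y := hlt (by omega)
      have hamalg : amalg wt j z (P.erase z) = (P.erase z).erase y := by
        unfold amalg
        rw [if_neg hzz]
        ext u
        rw [Finset.mem_filter, Finset.mem_erase (a := u) (b := y), and_comm]
        refine and_congr_left fun hu => not_congr ⟨fun huj => ?_, fun huy => huy ▸ hy'.2⟩
        have : u ∈ layer wt P (j + 1) := mem_layer.2 ⟨Finset.mem_of_mem_erase hu, huj⟩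
        rw [hy] at this
        exact Finset.mem_singleton.1 this
      -- The exponents differ by `2`: once for the vertex `y` itself, once for the passage from `n +
      -- 1` to `n`.
      have hsign : (-1 : R) ^ ((P.filter fun x => z < x).card + (n + 1 - wt z)) =
          (-1) ^ (((P.erase z).filter fun x => y < x).card + (n - collapse j (wt y))) := by
        have h1 : (P.filter fun x => z < x) =
            insert y ((P.erase z).filter fun x => y < x) := by
          ext u
          simp only [Finset.mem_filter, Finset.mem_insert, Finset.mem_erase]
          constructor
          · rintro ⟨hu, hzu⟩
            have h2 := hmono hzu.le
            by_cases huy : u = y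
            · exact Or.inl huy
            refine Or.inr ⟨⟨hzu.ne', hu⟩, ?_⟩
            by_cases h3 : wt u = j
            · exact absurd (hmax u h3) (not_le.2 hzu)
            · refine hlt ?_
              by_contra h4
              have : u ∈ layer wt P (j + 1) := mem_layer.2 ⟨hu, by omega⟩
              rw [hy] at this
              exact huy (Finset.mem_singleton.1 this)
          · rintro (rfl | ⟨⟨-, hu⟩, hyu⟩)
            · exact ⟨hy'.1, hzy⟩
            · exact ⟨hu, hzy.trans hyu⟩
        rw [h1, Finset.card_insert_of_notMem fun h => lt_irrefl _ (Finset.mem_filter.1 h).2, hz,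
          hy'.2]
        refine neg_one_pow_congr ?_
        have h2 : collapse j (j + 1) = j := by
          unfold collapse
          split_ifs <;> omega
        rw [h2]
        have h3 : ∀ a : ℕ, a + 1 + (n + 1 - j) = a + (n - j) + 2 := fun a => by omega
        rw [h3, Nat.even_add]
        simp
      rw [hsign]
      congr 1
      unfold codePullback
      rw [hamalg]
      split_ifs with h
      · rfl
      · by_contra hne
        refine h ⟨fullSupport_erase_of_collapse hP hj (hW _ (Ne.symm hne)) ?_ ?_, Or.inr ?_⟩
        · exact Finset.erase_subset _ _
        · rintro (hzj | hzj)
          · obtain ⟨u, hu, huj⟩ := (hW _ (Ne.symm hne)).exists_eq j hj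
            obtain ⟨huy, hu⟩ := Finset.mem_erase.1 hu
            refine ⟨u, hu, ?_⟩
            have : wt u ≠ j + 1 := fun huj' => by
              have : u ∈ layer wt P (j + 1) := mem_layer.2 ⟨Finset.mem_of_mem_erase hu, huj'⟩
              rw [hy] at this
              exact huy (Finset.mem_singleton.1 this)
            unfold collapse at huj
            split_ifs at huj <;> omega
          · omega
        · unfold layer at hy ⊢
          rw [Finset.filter_erase, hy, Finset.erase_eq_of_notMem]
          · exact Finset.card_singleton y
          · exact fun h => hyz (Finset.mem_singleton.1 h).symm
    · refine Finset.sum_congr rfl fun x hx => ?_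
      obtain ⟨hxy, hx⟩ := Finset.mem_erase.1 hx
      refine hterm x hx fun h => hxy ?_
      rw [hy] at h
      exact (Finset.singleton_injective h).symm
  -- Without `z`, a face whose factor `j + 1` is not a single vertex is killed.
  · have h0 : codePullback n wt j z W (P.erase z) = 0 := by
      unfold codePullback
      rw [if_neg]
      rintro ⟨-, h | h⟩
      · exact hzz h
      · unfold layer at h hcard
        rw [Finset.filter_erase, Finset.erase_eq_of_notMem] at h
        · exact hcard (Finset.card_eq_one.1 h)
        · intro hz'
          have := (Finset.mem_filter.1 hz').2
          omega
    rw [h0, mul_zero, zero_add]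
    exact Finset.sum_congr rfl fun x hx => hterm x hx fun h => hcard ⟨x, h⟩

/-- Here amalgamating means deleting `t`. The term of `t` on the left is `0`, since the factor `j +
1` becomes empty, and deleting any other vertex commutes with deleting `t`. -/
lemma codeCob_codePullback_of_card_eq_one (hmono : Monotone wt) (hj : j ≤ n) (hz : wt z = j)
    (hW : ∀ Q, W Q ≠ 0 → FullSupport n (fun y => collapse j (wt y)) Q)
    (hP : FullSupport (n + 1) wt P) (hzP : z ∉ P) {t : L} (ht : layer wt P (j + 1) = {t}) :
    codeCob (n + 1) wt (codePullback n wt j z W) P =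
      codeCob n (fun y => collapse j (wt y)) W (P.erase t) := by
  have hlt : ∀ {x y}, wt x < wt y → x < y := fun {x y} h => by
    by_contra hle
    exact absurd (hmono (not_lt.1 hle)) (not_le.2 h)
  have ht' : t ∈ P ∧ wt t = j + 1 := mem_layer.1 (ht ▸ Finset.mem_singleton_self t)
  have huniq : ∀ u ∈ P, wt u = j + 1 → u = t := fun u hu huj => by
    have : u ∈ layer wt P (j + 1) := mem_layer.2 ⟨hu, huj⟩
    rw [ht] at this
    exact Finset.mem_singleton.1 this
  unfold codeCob
  rw [← Finset.add_sum_erase P _ ht'.1]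
  have h0 : codePullback n wt j z W (P.erase t) = 0 := by
    unfold codePullback
    rw [if_neg]
    rintro ⟨h, -⟩
    obtain ⟨u, hu, huj⟩ := h.exists_eq (j + 1) (by omega)
    obtain ⟨hut, hu⟩ := Finset.mem_erase.1 hu
    exact hut (huniq u hu huj)
  rw [h0, mul_zero, zero_add]
  refine Finset.sum_congr rfl fun x hx => ?_
  obtain ⟨hxt, hxP⟩ := Finset.mem_erase.1 hx
  rw [card_filter_erase_add ht'.1 (hP.le x hxP) hj]
  · congr 1
    have ham : amalg wt j z (P.erase x) = (P.erase t).erase x := by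
      unfold amalg
      rw [if_neg fun h => hzP (Finset.mem_of_mem_erase h)]
      ext u
      rw [Finset.mem_filter, Finset.mem_erase, Finset.mem_erase, Finset.mem_erase]
      constructor
      · rintro ⟨⟨h1, h2⟩, h3⟩
        exact ⟨h1, fun h => h3 (h ▸ ht'.2), h2⟩
      · rintro ⟨h1, h2, h3⟩
        exact ⟨⟨h1, h3⟩, fun h => h2 (huniq u h3 h)⟩
    unfold codePullback
    rw [ham]
    split_ifs with h
    · rfl
    · by_contra hne
      refine h ⟨fullSupport_erase_of_collapse hP hj (hW _ (Ne.symm hne)) ?_ ?_, Or.inr ?_⟩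
      · rw [Finset.erase_right_comm]
        exact Finset.erase_subset _ _
      · rintro (hxj | hxj)
        · obtain ⟨u, hu, huj⟩ := (hW _ (Ne.symm hne)).exists_eq j hj
          rw [Finset.mem_erase, Finset.mem_erase] at hu
          refine ⟨u, Finset.mem_erase.2 ⟨hu.1, hu.2.2⟩, ?_⟩
          have : wt u ≠ j + 1 := fun huj' => hu.2.1 (huniq u hu.2.2 huj')
          unfold collapse at huj
          split_ifs at huj <;> omega
        · exact absurd (huniq x hxP hxj) hxt
      · unfold layer at ht ⊢
        rw [Finset.filter_erase, ht, Finset.erase_eq_of_notMem]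
        · exact Finset.card_singleton t
        · exact fun h => hxt (Finset.mem_singleton.1 h)
  · exact fun hxj => hlt (by omega)
  · intro hxj
    refine not_lt.2 (hlt ?_).le
    have : wt x ≠ j + 1 := fun h => hxt (huniq x hxP h)
    omega

/-- Deleting one vertex can make `P` amalgamable only if the factor `j + 1` consists of two vertices
`a < b`. Deleting either gives the same amalgamated set, and the signs are opposite because `b` is
the only vertex after `a` that is not after `b`. -/
lemma codeCob_codePullback_of_not_amalgamable (hmono : Monotone wt) (hj : j ≤ n)
    (hP : FullSupport (n + 1) wt P) (hnot : ¬ Amalgamable wt j z P) :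
    codeCob (n + 1) wt (codePullback n wt j z W) P = 0 := by
  unfold Amalgamable at hnot
  push Not at hnot
  obtain ⟨hzP, hcard⟩ := hnot
  have hpos : 0 < (layer wt P (j + 1)).card := by
    obtain ⟨x, hx⟩ := hP.exists_eq (j + 1) (by omega)
    exact Finset.card_pos.2 ⟨x, mem_layer.2 hx⟩
  have hlayer : ∀ x, layer wt (P.erase x) (j + 1) = (layer wt P (j + 1)).erase x := fun x =>
    Finset.filter_erase _ _ _
  by_cases hcard2 : (layer wt P (j + 1)).card = 2
  · obtain ⟨a, b, hab, hlay⟩ : ∃ a b, a < b ∧ layer wt P (j + 1) = {a, b} := by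
      obtain ⟨a, b, hne, h⟩ := Finset.card_eq_two.1 hcard2
      rcases lt_or_gt_of_ne hne with h1 | h1
      · exact ⟨a, b, h1, h⟩
      · exact ⟨b, a, h1, h.trans (Finset.pair_comm a b)⟩
    have hmem : ∀ u, u ∈ P ∧ wt u = j + 1 ↔ u = a ∨ u = b := fun u => by
      rw [← mem_layer, hlay, Finset.mem_insert, Finset.mem_singleton]
    have ha := (hmem a).2 (Or.inl rfl)
    have hb := (hmem b).2 (Or.inr rfl)
    have hsupp : ∀ {x y}, x ∈ P → y ∈ P → wt x = j + 1 → wt y = j + 1 → x ≠ y →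
        codePullback n wt j z W (P.erase x) = W (P.filter fun u => wt u ≠ j + 1) := by
      intro x y hx hy hxj hyj hxy
      have hfull : FullSupport (n + 1) wt (P.erase x) := by
        refine ⟨fun u hu => hP.le u (Finset.mem_of_mem_erase hu), fun i hi => ?_⟩
        obtain ⟨u, hu, hui⟩ := hP.exists_eq i hi
        by_cases hux : u = x
        · exact ⟨y, Finset.mem_erase.2 ⟨hxy.symm, hy⟩, by rw [hyj, ← hxj, ← hux, hui]⟩
        · exact ⟨u, Finset.mem_erase.2 ⟨hux, hu⟩, hui⟩
      have hz' : z ∉ P.erase x := fun h => hzP (Finset.mem_of_mem_erase h)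
      have hcard1 : (layer wt (P.erase x) (j + 1)).card = 1 := by
        rw [hlayer, Finset.card_erase_of_mem (mem_layer.2 ⟨hx, hxj⟩), hcard2]
      have hnm : x ∉ P.filter fun u => wt u ≠ j + 1 := fun h => (Finset.mem_filter.1 h).2 hxj
      unfold codePullback amalg
      rw [if_pos ⟨hfull, Or.inr hcard1⟩, if_neg hz', Finset.filter_erase,
        Finset.erase_eq_of_notMem hnm]
    unfold codeCob
    rw [← Finset.sum_subset (s₁ := {a, b}), Finset.sum_pair hab.ne,
      hsupp ha.1 hb.1 ha.2 hb.2 hab.ne, hsupp hb.1 ha.1 hb.2 ha.2 hab.ne', ← add_mul]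
    · have h1 : (P.filter fun y => a < y) = insert b (P.filter fun y => b < y) := by
        ext u
        rw [Finset.mem_insert, Finset.mem_filter, Finset.mem_filter]
        constructor
        · rintro ⟨hu, hau⟩
          by_cases hub : u = b
          · exact Or.inl hub
          refine Or.inr ⟨hu, ?_⟩
          by_contra hlt
          have h1 := hmono hau.le
          have h2 := hmono (not_lt.1 hlt)
          rcases (hmem u).1 ⟨hu, by omega⟩ with h | h
          · exact hau.ne' h
          · exact hub h
        · rintro (rfl | ⟨hu, hbu⟩)
          · exact ⟨hb.1, hab⟩
          · exact ⟨hu, hab.trans hbu⟩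
      rw [h1, Finset.card_insert_of_notMem fun h => lt_irrefl _ (Finset.mem_filter.1 h).2, ha.2,
        hb.2]
      rw [add_right_comm, pow_succ, mul_neg_one, neg_add_cancel, zero_mul]
    · intro x hx
      rcases Finset.mem_insert.1 hx with rfl | hx
      · exact ha.1
      · rw [Finset.mem_singleton.1 hx]
        exact hb.1
    · intro x hx hx'
      have h1 : codePullback n wt j z W (P.erase x) = 0 := by
        unfold codePullback
        rw [if_neg]
        rintro ⟨-, h | h⟩
        · exact hzP (Finset.mem_of_mem_erase h)
        · rw [hlayer, hlay, Finset.erase_eq_of_notMem hx', ← hlay, hcard2] at h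
          omega
      rw [h1, mul_zero]
  · refine Finset.sum_eq_zero fun x _ => ?_
    have h1 : codePullback n wt j z W (P.erase x) = 0 := by
      unfold codePullback
      rw [if_neg]
      rintro ⟨-, h | h⟩
      · exact hzP (Finset.mem_of_mem_erase h)
      · rw [hlayer] at h
        have := Finset.pred_card_le_card_erase (s := layer wt P (j + 1)) (a := x)
        omega
    rw [h1, mul_zero]

lemma codeCob_codePullback (hmono : Monotone wt) (hj : j ≤ n) (hz : wt z = j)
    (hmax : ∀ x, wt x = j → x ≤ z)
    (hW : ∀ Q, W Q ≠ 0 → FullSupport n (fun y => collapse j (wt y)) Q)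
    (hP : FullSupport (n + 1) wt P) :
    codeCob (n + 1) wt (codePullback n wt j z W) P =
      codePullback n wt j z (codeCob n (fun y => collapse j (wt y)) W) P := by
  by_cases ham : Amalgamable wt j z P
  · conv_rhs => unfold codePullback
    rw [if_pos ⟨hP, ham⟩]
    unfold amalg
    by_cases hzP : z ∈ P
    · rw [if_pos hzP, codeCob_codePullback_of_mem hmono hj hz hmax hW hP hzP]
    · obtain ⟨t, ht⟩ := Finset.card_eq_one.1 (ham.resolve_left hzP)
      rw [if_neg hzP, codeCob_codePullback_of_card_eq_one hmono hj hz hW hP hzP ht]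
      congr 1
      rw [← Finset.sdiff_singleton_eq_erase, ← ht]
      unfold layer
      rw [Finset.filter_not]
  · rw [codeCob_codePullback_of_not_amalgamable hmono hj hP ham]
    unfold codePullback
    rw [if_neg fun h => ham h.2]

end AmalgCob

end BlownUp
namespace BlownUp

/-! ### Front and back faces of sets of vertices -/

lemma eq_of_layer_card_eq_one {L : Type*} {wt : L → ℕ} {j : ℕ} {P : Finset L}
    (h : (layer wt P j).card = 1) {x y : L} (hx : x ∈ P) (hxj : wt x = j)
    (hy : y ∈ P) (hyj : wt y = j) : x = y := by
  obtain ⟨t, ht⟩ := Finset.card_eq_one.1 h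
  have h1 : x ∈ layer wt P j := mem_layer.2 ⟨hx, hxj⟩
  have h2 : y ∈ layer wt P j := mem_layer.2 ⟨hy, hyj⟩
  rw [ht, Finset.mem_singleton] at h1 h2
  rw [h1, h2]

lemma layer_card_eq_one {L : Type*} {wt : L → ℕ} {j : ℕ} {P : Finset L} {x : L} (hx : x ∈ P) (hxj : wt x = j)
    (h : ∀ y ∈ P, wt y = j → y = x) : (layer wt P j).card = 1 := by
  refine Finset.card_eq_one.2 ⟨x, ?_⟩
  ext y
  rw [mem_layer, Finset.mem_singleton]
  exact ⟨fun hy => h y hy.1 hy.2, fun hy => hy ▸ ⟨hx, hxj⟩⟩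

section Split

variable {L : Type*} [LinearOrder L]

/-- In each factor, the last vertex of `A` is the first vertex of `B`, and `P` is the union of `A`
and `B`. -/
structure IsSplit (n : ℕ) (wt : L → ℕ) (P A B : Finset L) : Prop where
  union_eq : A ∪ B = P
  exists_mid : ∀ i ≤ n, ∃ x ∈ A, x ∈ B ∧ wt x = i ∧ (∀ y ∈ A, wt y = i → y ≤ x) ∧
    ∀ y ∈ B, wt y = i → x ≤ y

lemma IsSplit.card_layer {n : ℕ} {wt : L → ℕ} {P A B : Finset L} (h : IsSplit n wt P A B) {i : ℕ}
    (hi : i ≤ n) : (layer wt P i).card + 1 = (layer wt A i).card + (layer wt B i).card := by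
  obtain ⟨x, hA, hB, hx, h1, h2⟩ := h.exists_mid i hi
  have hU : layer wt P i = layer wt A i ∪ layer wt B i := by
    rw [← h.union_eq]
    exact Finset.filter_union _ _ _
  have hI : layer wt A i ∩ layer wt B i = {x} := by
    ext y
    rw [Finset.mem_inter, mem_layer, mem_layer, Finset.mem_singleton]
    constructor
    · rintro ⟨⟨hy1, hy2⟩, hy3, -⟩
      exact le_antisymm (h1 y hy1 hy2) (h2 y hy3 hy2)
    · rintro rfl
      exact ⟨⟨hA, hx⟩, hB, hx⟩
  rw [hU, ← Finset.card_union_add_card_inter, hI, Finset.card_singleton]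

variable {wt : L → ℕ} {n j : ℕ} {z : L} {P A B : Finset L}

lemma amalg_subset : amalg wt j z P ⊆ P := by
  unfold amalg
  split_ifs
  · exact Finset.erase_subset _ _
  · exact Finset.filter_subset _ _

lemma mem_amalg_of_mem (h : z ∈ P) {x : L} : x ∈ amalg wt j z P ↔ x ≠ z ∧ x ∈ P := by
  unfold amalg
  rw [if_pos h, Finset.mem_erase]

lemma mem_amalg_of_notMem (h : z ∉ P) {x : L} : x ∈ amalg wt j z P ↔ x ∈ P ∧ wt x ≠ j + 1 := by
  unfold amalg
  rw [if_neg h, Finset.mem_filter]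

lemma collapse_eq_iff {j i k : ℕ} : collapse j i = k ↔
    (k < j ∧ i = k) ∨ (k = j ∧ (i = j ∨ i = j + 1)) ∨ (j < k ∧ i = k + 1) := by
  unfold collapse
  split_ifs <;> omega

/-- The middle vertices of the factors that are not gathered. -/
lemma IsSplit.exists_mid_amalg (hz : wt z = j) (h : IsSplit (n + 1) wt P A B) {i : ℕ} (hi : i ≤ n)
    (hij : i ≠ j) : ∃ x ∈ amalg wt j z A, x ∈ amalg wt j z B ∧ collapse j (wt x) = i ∧
      (∀ y ∈ amalg wt j z A, collapse j (wt y) = i → y ≤ x) ∧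
      ∀ y ∈ amalg wt j z B, collapse j (wt y) = i → x ≤ y := by
  have hk : ∃ k ≤ n + 1, k ≠ j ∧ k ≠ j + 1 ∧ ∀ a, collapse j a = i ↔ a = k := by
    rcases lt_or_gt_of_ne hij with h1 | h1
    · exact ⟨i, by omega, by omega, by omega, fun a => by rw [collapse_eq_iff]; omega⟩
    · exact ⟨i + 1, by omega, by omega, by omega, fun a => by rw [collapse_eq_iff]; omega⟩
  obtain ⟨k, hkn, hk1, hk2, hk⟩ := hk
  obtain ⟨x, hxA, hxB, hx, h1, h2⟩ := h.exists_mid k hkn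
  have hmem : ∀ Q : Finset L, x ∈ Q → x ∈ amalg wt j z Q := by
    intro Q hxQ
    by_cases hzQ : z ∈ Q
    · exact (mem_amalg_of_mem hzQ).2 ⟨fun h => hk1 (by rw [← hx, h, hz]), hxQ⟩
    · exact (mem_amalg_of_notMem hzQ).2 ⟨hxQ, by omega⟩
  exact ⟨x, hmem A hxA, hmem B hxB, (hk _).2 hx,
    fun y hy hyi => h1 y (amalg_subset hy) ((hk _).1 hyi),
    fun y hy hyi => h2 y (amalg_subset hy) ((hk _).1 hyi)⟩

/-- Being last in its factor, `z` can belong to the front part only as the common vertex. -/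
lemma IsSplit.mem_right (hj : j ≤ n) (hz : wt z = j)
    (hmax : ∀ x, wt x = j → x ≤ z) (h : IsSplit (n + 1) wt P A B) (hzP : z ∈ P) : z ∈ B := by
  obtain ⟨x, hxA, hxB, hx, h1, h2⟩ := h.exists_mid j (by omega)
  rw [← h.union_eq, Finset.mem_union] at hzP
  rcases hzP with hzA | hzB
  · rwa [le_antisymm (h1 z hzA hz) (hmax x hx)]
  · exact hzB

/-- The gathered factor is cut at the middle vertex of the factor `j + 1` if `z ∈ A`, and at that of
the factor `j` otherwise. In the first case `B` meets the factor `j` only in `z`; in the second `A`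
meets the factor `j + 1` in a single vertex. This is the last conclusion, by which `|a_{j+1}||b_j| =
0`. -/
lemma IsSplit.isSplit_amalg (hmono : Monotone wt) (hj : j ≤ n) (hz : wt z = j)
    (hmax : ∀ x, wt x = j → x ≤ z) (h : IsSplit (n + 1) wt P A B)
    (hA : Amalgamable wt j z A) (hB : Amalgamable wt j z B) :
    Amalgamable wt j z P ∧
      IsSplit n (fun y => collapse j (wt y)) (amalg wt j z P) (amalg wt j z A) (amalg wt j z B) ∧
      ((layer wt A (j + 1)).card = 1 ∨ (layer wt B j).card = 1) := by
  have hlt : ∀ {x y}, wt x < wt y → x < y := fun {x y} h => by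
    by_contra hle
    exact absurd (hmono (not_lt.1 hle)) (not_le.2 h)
  have hjj : ∀ a, collapse j a = j ↔ a = j ∨ a = j + 1 := fun a => by
    rw [collapse_eq_iff]
    omega
  obtain ⟨x, hxA, hxB, hx, hx1, hx2⟩ := h.exists_mid j (by omega)
  obtain ⟨t, htA, htB, ht, ht1, ht2⟩ := h.exists_mid (j + 1) (by omega)
  have hAP : A ⊆ P := h.union_eq ▸ Finset.subset_union_left
  have hBP : B ⊆ P := h.union_eq ▸ Finset.subset_union_right
  have htz : t ≠ z := fun h => by
    rw [h] at ht
    omega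
  have hmem : ∀ y, y ∈ P ↔ y ∈ A ∨ y ∈ B := fun y => by
    rw [← h.union_eq, Finset.mem_union]
  by_cases hzA : z ∈ A
  · have hxz : x = z := le_antisymm (hmax x hx) (hx1 z hzA hz)
    subst hxz
    have hzP := hAP hzA
    have hBj : ∀ y ∈ B, wt y = j → y = x := fun y hy hyj =>
      le_antisymm (hmax y hyj) (hx2 y hy hyj)
    refine ⟨Or.inl hzP, ⟨?_, fun i hi => ?_⟩, Or.inr (layer_card_eq_one hxB hx hBj)⟩
    · ext y
      rw [Finset.mem_union, mem_amalg_of_mem hzA, mem_amalg_of_mem hxB, mem_amalg_of_mem hzP, hmem]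
      tauto
    · by_cases hij : i = j
      · subst hij
        refine ⟨t, (mem_amalg_of_mem hzA).2 ⟨htz, htA⟩, (mem_amalg_of_mem hxB).2 ⟨htz, htB⟩,
          (hjj _).2 (Or.inr ht), fun y hy hyi => ?_, fun y hy hyi => ?_⟩
        · obtain ⟨hyz, hy⟩ := (mem_amalg_of_mem hzA).1 hy
          rcases (hjj _).1 hyi with h3 | h3
          · exact (hlt (by omega)).le
          · exact ht1 y hy h3
        · obtain ⟨hyz, hy⟩ := (mem_amalg_of_mem hxB).1 hy
          rcases (hjj _).1 hyi with h3 | h3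
          · exact absurd (hBj y hy h3) hyz
          · exact ht2 y hy h3
      · exact h.exists_mid_amalg hz hi hij
  · have hA1 := hA.resolve_left hzA
    have hAt : ∀ y ∈ A, wt y = j + 1 → y = t := fun y hy hyj =>
      eq_of_layer_card_eq_one hA1 hy hyj htA ht
    have hxz : x ≠ z := fun h => hzA (h ▸ hxA)
    by_cases hzB : z ∈ B
    · have hzP := hBP hzB
      refine ⟨Or.inl hzP, ⟨?_, fun i hi => ?_⟩, Or.inl hA1⟩
      · ext y
        rw [Finset.mem_union, mem_amalg_of_notMem hzA, mem_amalg_of_mem hzB, mem_amalg_of_mem hzP,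
          hmem]
        constructor
        · rintro (⟨h1, -⟩ | ⟨h1, h2⟩)
          · exact ⟨fun h => hzA (h ▸ h1), Or.inl h1⟩
          · exact ⟨h1, Or.inr h2⟩
        · rintro ⟨h1, h2 | h2⟩
          · by_cases hyj : wt y = j + 1
            · rw [hAt y h2 hyj]
              exact Or.inr ⟨htz, htB⟩
            · exact Or.inl ⟨h2, hyj⟩
          · exact Or.inr ⟨h1, h2⟩
      · by_cases hij : i = j
        · subst hij
          refine ⟨x, (mem_amalg_of_notMem hzA).2 ⟨hxA, by omega⟩,
            (mem_amalg_of_mem hzB).2 ⟨hxz, hxB⟩, (hjj _).2 (Or.inl hx), fun y hy hyi => ?_,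
            fun y hy hyi => ?_⟩
          · obtain ⟨hy, hyz⟩ := (mem_amalg_of_notMem hzA).1 hy
            exact hx1 y hy (((hjj _).1 hyi).resolve_right hyz)
          · rcases (hjj _).1 hyi with h3 | h3
            · exact hx2 y (amalg_subset hy) h3
            · exact (hlt (by omega)).le
        · exact h.exists_mid_amalg hz hi hij
    · have hB1 := hB.resolve_left hzB
      have hBt : ∀ y ∈ B, wt y = j + 1 → y = t := fun y hy hyj =>
        eq_of_layer_card_eq_one hB1 hy hyj htB ht
      have hzP : z ∉ P := fun h => ((hmem z).1 h).elim hzA hzB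
      refine ⟨Or.inr (layer_card_eq_one (hAP htA) ht fun y hy hyj =>
        ((hmem y).1 hy).elim (fun h => hAt y h hyj) fun h => hBt y h hyj),
        ⟨?_, fun i hi => ?_⟩, Or.inl hA1⟩
      · ext y
        rw [Finset.mem_union, mem_amalg_of_notMem hzA, mem_amalg_of_notMem hzB,
          mem_amalg_of_notMem hzP, hmem]
        tauto
      · by_cases hij : i = j
        · subst hij
          refine ⟨x, (mem_amalg_of_notMem hzA).2 ⟨hxA, by omega⟩,
            (mem_amalg_of_notMem hzB).2 ⟨hxB, by omega⟩, (hjj _).2 (Or.inl hx), fun y hy hyi => ?_,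
            fun y hy hyi => ?_⟩
          · obtain ⟨hy, hyz⟩ := (mem_amalg_of_notMem hzA).1 hy
            exact hx1 y hy (((hjj _).1 hyi).resolve_right hyz)
          · obtain ⟨hy, hyz⟩ := (mem_amalg_of_notMem hzB).1 hy
            exact hx2 y hy (((hjj _).1 hyi).resolve_right hyz)
        · exact h.exists_mid_amalg hz hi hij

/-- What the amalgamation forgets is recovered from `P`. One has `z ∈ A` if and only if the
amalgamation of `A` meets the factor `j + 1`, and `z ∈ B` if and only if `z ∈ P`. If `z ∉ A`, then
`A` meets the factor `j + 1` only in the least vertex of `P` there, and `B` contains all the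
vertices of `P` there. -/
lemma IsSplit.eq_of_amalg_eq (hj : j ≤ n) (hz : wt z = j)
    (hmax : ∀ x, wt x = j → x ≤ z) {A' B' : Finset L} (h : IsSplit (n + 1) wt P A B)
    (h' : IsSplit (n + 1) wt P A' B') (hA : Amalgamable wt j z A) (hA' : Amalgamable wt j z A')
    (hAA : amalg wt j z A = amalg wt j z A') (hBB : amalg wt j z B = amalg wt j z B') :
    A = A' ∧ B = B' := by
  -- a set is determined by its amalgamation and the vertices of the factor `j + 1`
  have key : ∀ Q Q' : Finset L, amalg wt j z Q = amalg wt j z Q' → (z ∈ Q ↔ z ∈ Q') →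
      (z ∉ Q → ∀ y, wt y = j + 1 → (y ∈ Q ↔ y ∈ Q')) → Q = Q' := by
    intro Q Q' h1 h2 h3
    ext y
    have h4 : y ∈ amalg wt j z Q ↔ y ∈ amalg wt j z Q' := by rw [h1]
    by_cases hzQ : z ∈ Q
    · rw [mem_amalg_of_mem hzQ, mem_amalg_of_mem (h2.1 hzQ)] at h4
      by_cases hyz : y = z
      · rw [hyz]
        exact h2
      · tauto
    · rw [mem_amalg_of_notMem hzQ, mem_amalg_of_notMem (mt h2.2 hzQ)] at h4
      by_cases hyj : wt y = j + 1
      · exact h3 hzQ y hyj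
      · tauto
  have hmem : ∀ {A B : Finset L}, IsSplit (n + 1) wt P A B → ∀ y, y ∈ P ↔ y ∈ A ∨ y ∈ B :=
    fun h y => by rw [← h.union_eq, Finset.mem_union]
  have hleast : ∀ {A B : Finset L}, IsSplit (n + 1) wt P A B → Amalgamable wt j z A → z ∉ A →
      ∃ t ∈ A, t ∈ B ∧ wt t = j + 1 ∧ (∀ y ∈ A, wt y = j + 1 → y = t) ∧
        ∀ y ∈ P, wt y = j + 1 → t ≤ y := by
    intro A B h hA hzA
    obtain ⟨t, htA, htB, ht, ht1, ht2⟩ := h.exists_mid (j + 1) (by omega)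
    have h1 : ∀ y ∈ A, wt y = j + 1 → y = t := fun y hy hyj =>
      eq_of_layer_card_eq_one (hA.resolve_left hzA) hy hyj htA ht
    refine ⟨t, htA, htB, ht, h1, fun y hy hyj => ?_⟩
    rcases (hmem h y).1 hy with hy | hy
    · exact (h1 y hy hyj).ge
    · exact ht2 y hy hyj
  have hnot : ∀ {A B A' : Finset L}, IsSplit (n + 1) wt P A B → z ∈ A → z ∉ A' →
      amalg wt j z A ≠ amalg wt j z A' := by
    intro A B A' h hzA hzA' heq
    obtain ⟨t, htA, -, ht, -⟩ := h.exists_mid (j + 1) (by omega)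
    have h1 : t ∈ amalg wt j z A := (mem_amalg_of_mem hzA).2
      ⟨fun h => by rw [h] at ht; omega, htA⟩
    rw [heq, mem_amalg_of_notMem hzA'] at h1
    exact h1.2 ht
  constructor
  · have hzz : z ∈ A ↔ z ∈ A' := by
      constructor
      · intro hzA
        by_contra hzA'
        exact hnot h hzA hzA' hAA
      · intro hzA'
        by_contra hzA
        exact hnot h' hzA' hzA hAA.symm
    refine key A A' hAA hzz fun hzA y hyj => ?_
    obtain ⟨t, htA, -, ht, ht1, ht2⟩ := hleast h hA hzA
    obtain ⟨t', htA', -, ht', ht1', ht2'⟩ := hleast h' hA' (mt hzz.2 hzA)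
    have htt : t = t' := le_antisymm (ht2 t' ((hmem h' t').2 (Or.inl htA')) ht')
      (ht2' t ((hmem h t).2 (Or.inl htA)) ht)
    subst htt
    exact ⟨fun hy => ht1 y hy hyj ▸ htA', fun hy => ht1' y hy hyj ▸ htA⟩
  · have hzz : ∀ {A B : Finset L}, IsSplit (n + 1) wt P A B → (z ∈ B ↔ z ∈ P) := fun h =>
      ⟨fun hzB => (hmem h z).2 (Or.inr hzB), fun hzP => h.mem_right hj hz hmax hzP⟩
    refine key B B' hBB ((hzz h).trans (hzz h').symm) fun hzB y hyj => ?_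
    have hzP : z ∉ P := mt (hzz h).2 hzB
    have hP : ∀ {A B : Finset L}, IsSplit (n + 1) wt P A B → Amalgamable wt j z A →
        (y ∈ B ↔ y ∈ P) := by
      intro A B h hA
      refine ⟨fun hy => (hmem h y).2 (Or.inr hy), fun hy => ?_⟩
      obtain ⟨t, -, htB, -, ht1, -⟩ := hleast h hA fun hzA => hzP ((hmem h z).2 (Or.inl hzA))
      rcases (hmem h y).1 hy with hy | hy
      · rwa [ht1 y hy hyj]
      · exact hy
    exact (hP h hA).trans (hP h' hA').symm

/-- The lost vertices are restored according to the place of the cut `x`. Suppose `z ∈ P`: if `x`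
lies in the factor `j + 1`, both parts receive `z`; if it lies in the factor `j`, the back part
receives `z` and the front part the first vertex of the factor `j + 1`. If `z ∉ P`, both parts
receive the only vertex of the factor `j + 1`. -/
lemma IsSplit.exists_of_amalg (hmono : Monotone wt) (hj : j ≤ n) (hz : wt z = j)
    (hmax : ∀ x, wt x = j → x ≤ z) (hP : FullSupport (n + 1) wt P) (hPa : Amalgamable wt j z P)
    {A' B' : Finset L}
    (h : IsSplit n (fun y => collapse j (wt y)) (amalg wt j z P) A' B') :
    ∃ A B, IsSplit (n + 1) wt P A B ∧ Amalgamable wt j z A ∧ Amalgamable wt j z B ∧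
      amalg wt j z A = A' ∧ amalg wt j z B = B' := by
  have hlt : ∀ {x y}, wt x < wt y → x < y := fun {x y} h => by
    by_contra hle
    exact absurd (hmono (not_lt.1 hle)) (not_le.2 h)
  have hjj : ∀ a, collapse j a = j ↔ a = j ∨ a = j + 1 := fun a => by
    rw [collapse_eq_iff]
    omega
  obtain ⟨x, hxA, hxB, hx, hx1, hx2⟩ := h.exists_mid j hj
  have hmem : ∀ y, y ∈ A' ∨ y ∈ B' ↔ y ∈ amalg wt j z P := fun y => by
    rw [← h.union_eq, Finset.mem_union]
  -- the factors that are not gathered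
  have hother : ∀ {A B : Finset L}, (∀ y, wt y ≠ j → wt y ≠ j + 1 → (y ∈ A ↔ y ∈ A')) →
      (∀ y, wt y ≠ j → wt y ≠ j + 1 → (y ∈ B ↔ y ∈ B')) → ∀ i ≤ n + 1, i ≠ j → i ≠ j + 1 →
      ∃ x ∈ A, x ∈ B ∧ wt x = i ∧ (∀ y ∈ A, wt y = i → y ≤ x) ∧ ∀ y ∈ B, wt y = i → x ≤ y := by
    intro A B hA hB i hi hij hij'
    have hk : ∃ k ≤ n, ∀ a, collapse j a = k ↔ a = i := by
      rcases lt_or_gt_of_ne hij with h1 | h1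
      · exact ⟨i, by omega, fun a => by rw [collapse_eq_iff]; omega⟩
      · exact ⟨i - 1, by omega, fun a => by rw [collapse_eq_iff]; omega⟩
    obtain ⟨k, hkn, hk⟩ := hk
    obtain ⟨x, hxA, hxB, hx, hx1, hx2⟩ := h.exists_mid k hkn
    have hxi := (hk _).1 hx
    refine ⟨x, (hA x (by omega) (by omega)).2 hxA, (hB x (by omega) (by omega)).2 hxB, hxi,
      fun y hy hyi => ?_, fun y hy hyi => ?_⟩
    · exact hx1 y ((hA y (by omega) (by omega)).1 hy) ((hk _).2 hyi)
    · exact hx2 y ((hB y (by omega) (by omega)).1 hy) ((hk _).2 hyi)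
  by_cases hzP : z ∈ P
  · have hzA : z ∉ A' := fun hzA => ((mem_amalg_of_mem hzP).1 ((hmem z).1 (Or.inl hzA))).1 rfl
    have hzB : z ∉ B' := fun hzB => ((mem_amalg_of_mem hzP).1 ((hmem z).1 (Or.inr hzB))).1 rfl
    have hmem' : ∀ y, y ∈ A' ∨ y ∈ B' ↔ y ≠ z ∧ y ∈ P := fun y =>
      (hmem y).trans (mem_amalg_of_mem hzP)
    have hins : ∀ Q : Finset L, z ∉ Q → amalg wt j z (insert z Q) = Q := by
      intro Q hQ
      unfold amalg
      rw [if_pos (Finset.mem_insert_self _ _), Finset.erase_insert hQ]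
    rcases (hjj _).1 hx with hxj | hxj
    · obtain ⟨t, htP, ht, htmin⟩ : ∃ t ∈ P, wt t = j + 1 ∧ ∀ y ∈ P, wt y = j + 1 → t ≤ y := by
        obtain ⟨u, hu⟩ := hP.exists_eq (j + 1) (by omega)
        have hne : (layer wt P (j + 1)).Nonempty := ⟨u, mem_layer.2 hu⟩
        have h1 := mem_layer.1 (Finset.min'_mem _ hne)
        exact ⟨_, h1.1, h1.2, fun y hy hyj => Finset.min'_le _ _ (mem_layer.2 ⟨hy, hyj⟩)⟩
      have htz : t ≠ z := fun h => by
        rw [h] at ht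
        omega
      have hAj : ∀ y ∈ A', wt y ≠ j + 1 := fun y hy hyj => by
        have h1 := hmono (hx1 y hy ((hjj _).2 (Or.inr hyj)))
        omega
      have htB : t ∈ B' := ((hmem' t).2 ⟨htz, htP⟩).resolve_left fun h => hAj t h ht
      have hzA1 : z ∉ insert t A' := fun h =>
        (Finset.mem_insert.1 h).elim (fun h => htz h.symm) hzA
      refine ⟨insert t A', insert z B', ⟨?_, fun i hi => ?_⟩, Or.inr ?_,
        Or.inl (Finset.mem_insert_self _ _), ?_, hins B' hzB⟩
      · ext y
        have h1 := hmem' y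
        rw [Finset.mem_union, Finset.mem_insert, Finset.mem_insert]
        by_cases hyz : y = z
        · subst hyz
          simp [hzP]
        · by_cases hyt : y = t
          · subst hyt
            simp [htP]
          · tauto
      · by_cases hij : i = j
        · refine ⟨x, Finset.mem_insert_of_mem hxA, Finset.mem_insert_of_mem hxB, by omega,
            fun y hy hyi => ?_, fun y hy hyi => ?_⟩
          · rcases Finset.mem_insert.1 hy with rfl | hy
            · omega
            · exact hx1 y hy ((hjj _).2 (by omega))
          · rcases Finset.mem_insert.1 hy with rfl | hy
            · exact hmax x hxj
            · exact hx2 y hy ((hjj _).2 (by omega))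
        by_cases hij' : i = j + 1
        · refine ⟨t, Finset.mem_insert_self _ _, Finset.mem_insert_of_mem htB, by omega,
            fun y hy hyi => ?_, fun y hy hyi => ?_⟩
          · rcases Finset.mem_insert.1 hy with rfl | hy
            · exact le_rfl
            · exact absurd (hyi.trans hij') (hAj y hy)
          · rcases Finset.mem_insert.1 hy with rfl | hy
            · omega
            · exact htmin y ((hmem' y).1 (Or.inr hy)).2 (by omega)
        refine hother (fun y h1 h2 => ?_) (fun y h1 h2 => ?_) i hi hij hij'
        · rw [Finset.mem_insert, or_iff_right fun h : y = t => h2 (h ▸ ht)]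
        · rw [Finset.mem_insert, or_iff_right fun h : y = z => h1 (h ▸ hz)]
      · refine layer_card_eq_one (Finset.mem_insert_self _ _) ht fun y hy hyj => ?_
        exact (Finset.mem_insert.1 hy).resolve_right fun h => hAj y h hyj
      · ext y
        rw [mem_amalg_of_notMem hzA1, Finset.mem_insert]
        constructor
        · rintro ⟨rfl | h1, h2⟩
          · exact absurd ht h2
          · exact h1
        · exact fun h => ⟨Or.inr h, hAj y h⟩
    · have hBj : ∀ y ∈ B', wt y ≠ j := fun y hy hyj => by
        have h1 := hmono (hx2 y hy ((hjj _).2 (Or.inl hyj)))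
        omega
      refine ⟨insert z A', insert z B', ⟨?_, fun i hi => ?_⟩,
        Or.inl (Finset.mem_insert_self _ _), Or.inl (Finset.mem_insert_self _ _), hins A' hzA,
        hins B' hzB⟩
      · ext y
        have h1 := hmem' y
        rw [Finset.mem_union, Finset.mem_insert, Finset.mem_insert]
        by_cases hyz : y = z
        · subst hyz
          simp [hzP]
        · tauto
      · by_cases hij : i = j
        · refine ⟨z, Finset.mem_insert_self _ _, Finset.mem_insert_self _ _, by omega,
            fun y hy hyi => hmax y (by omega), fun y hy hyi => ?_⟩
          rcases Finset.mem_insert.1 hy with rfl | hy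
          · exact le_rfl
          · exact absurd (hyi.trans hij) (hBj y hy)
        by_cases hij' : i = j + 1
        · refine ⟨x, Finset.mem_insert_of_mem hxA, Finset.mem_insert_of_mem hxB, by omega,
            fun y hy hyi => ?_, fun y hy hyi => ?_⟩
          · rcases Finset.mem_insert.1 hy with rfl | hy
            · omega
            · exact hx1 y hy ((hjj _).2 (by omega))
          · rcases Finset.mem_insert.1 hy with rfl | hy
            · omega
            · exact hx2 y hy ((hjj _).2 (by omega))
        refine hother (fun y h1 h2 => ?_) (fun y h1 h2 => ?_) i hi hij hij'
        · rw [Finset.mem_insert, or_iff_right fun h : y = z => h1 (h ▸ hz)]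
        · rw [Finset.mem_insert, or_iff_right fun h : y = z => h1 (h ▸ hz)]
  · obtain ⟨t, hlay⟩ := Finset.card_eq_one.1 (hPa.resolve_left hzP)
    have htt : ∀ y, y ∈ P ∧ wt y = j + 1 ↔ y = t := fun y => by
      rw [← mem_layer, hlay, Finset.mem_singleton]
    obtain ⟨htP, ht⟩ := (htt t).2 rfl
    have hmem' : ∀ y, y ∈ A' ∨ y ∈ B' ↔ y ∈ P ∧ wt y ≠ j + 1 := fun y =>
      (hmem y).trans (mem_amalg_of_notMem hzP)
    have htz : t ≠ z := fun h => hzP (h ▸ htP)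
    have hQ : ∀ Q : Finset L, (∀ y ∈ Q, y ∈ P ∧ wt y ≠ j + 1) →
        Amalgamable wt j z (insert t Q) ∧ amalg wt j z (insert t Q) = Q := by
      intro Q hQ
      have hzQ : z ∉ insert t Q := fun h =>
        (Finset.mem_insert.1 h).elim (fun h => htz h.symm) fun h => hzP (hQ z h).1
      refine ⟨Or.inr (layer_card_eq_one (Finset.mem_insert_self _ _) ht fun y hy hyj =>
        (Finset.mem_insert.1 hy).resolve_right fun h => (hQ y h).2 hyj), ?_⟩
      ext y
      rw [mem_amalg_of_notMem hzQ, Finset.mem_insert]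
      constructor
      · rintro ⟨rfl | h1, h2⟩
        · exact absurd ht h2
        · exact h1
      · exact fun h => ⟨Or.inr h, (hQ y h).2⟩
    have hA' : ∀ y ∈ A', y ∈ P ∧ wt y ≠ j + 1 := fun y hy => (hmem' y).1 (Or.inl hy)
    have hB' : ∀ y ∈ B', y ∈ P ∧ wt y ≠ j + 1 := fun y hy => (hmem' y).1 (Or.inr hy)
    have hxj : wt x = j := ((hjj _).1 hx).resolve_right (hA' x hxA).2
    refine ⟨insert t A', insert t B', ⟨?_, fun i hi => ?_⟩, (hQ A' hA').1, (hQ B' hB').1,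
      (hQ A' hA').2, (hQ B' hB').2⟩
    · ext y
      have h1 := hmem' y
      have h2 := htt y
      rw [Finset.mem_union, Finset.mem_insert, Finset.mem_insert]
      tauto
    · by_cases hij : i = j
      · refine ⟨x, Finset.mem_insert_of_mem hxA, Finset.mem_insert_of_mem hxB, by omega,
          fun y hy hyi => ?_, fun y hy hyi => ?_⟩
        · rcases Finset.mem_insert.1 hy with rfl | hy
          · omega
          · exact hx1 y hy ((hjj _).2 (by omega))
        · rcases Finset.mem_insert.1 hy with rfl | hy
          · omega
          · exact hx2 y hy ((hjj _).2 (by omega))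
      by_cases hij' : i = j + 1
      · refine ⟨t, Finset.mem_insert_self _ _, Finset.mem_insert_self _ _, by omega,
          fun y hy hyi => ?_, fun y hy hyi => ?_⟩
        · rcases Finset.mem_insert.1 hy with rfl | hy
          · exact le_rfl
          · exact absurd (hyi.trans hij') (hA' y hy).2
        · rcases Finset.mem_insert.1 hy with rfl | hy
          · exact le_rfl
          · exact absurd (hyi.trans hij') (hB' y hy).2
      refine hother (fun y h1 h2 => ?_) (fun y h1 h2 => ?_) i hi hij hij'
      · rw [Finset.mem_insert, or_iff_right fun h : y = t => h2 (h ▸ ht)]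
      · rw [Finset.mem_insert, or_iff_right fun h : y = t => h2 (h ▸ ht)]

end Split

end BlownUp
namespace BlownUp

/-! ### Elementary amalgamations, the differential and the cup product -/

/-- A general `Coding` puts an apex only after the vertices of `Δ` in its factor. The lemmas on
vertex sets need it to be last among all elements of `L` of that weight, which the lexicographic
order provides. -/
lemma le_apex_lex {m : ℕ} {w : Fin (m + 1) → ℕ} (hw : Monotone w) {j : ℕ}
    (x : ℕ ×ₗ WithTop (Fin (m + 1))) (hx : (Coding.lex hw).wt x = j) :
    x ≤ (Coding.lex hw).apex j := by
  rw [Prod.Lex.le_iff]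
  exact Or.inr ⟨hx, le_top⟩

lemma Cell.Pushes.deg_eq {m n n' : ℕ} {w w' : Fin (m + 1) → ℕ} (hw : IsRegularWeight n w)
    (hw' : ∀ v, w' v ≤ n') (h : Coarsens n w n' w') {c : Cell n w} {c' : Cell n' w'}
    (hc : c.Pushes c') : c'.deg = c.deg := by
  obtain ⟨g, -, -, hgn, hg⟩ := h.exists_map hw hw'
  unfold Cell.deg
  rw [← Finset.sum_fiberwise_of_maps_to (s := Finset.range (n + 1)) (t := Finset.range (n' + 1))
    (g := g) fun k _ => Finset.mem_range.2 (Nat.lt_succ_of_le (hgn k))]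
  exact Finset.sum_congr rfl fun i hi =>
    hc.degAt_eq h hg (Nat.lt_succ_iff.1 (Finset.mem_range.1 hi))

/-! ### Elementary amalgamations and the differential -/

section Cob

variable {R : Type*} [CommRing R] {m n j : ℕ} {w : Fin (m + 1) → ℕ} {L : Type*} [LinearOrder L]
  (K : Coding w L)

lemma exists_of_extend_ne_zero {α β : Type*} {f : α → β} {g : α → R} {y : β}
    (h : Function.extend f g 0 y ≠ 0) : ∃ x, f x = y := by
  by_contra hne
  exact h (Function.extend_apply' _ _ _ hne)

/-- Once twisted by `sgn`, the pull-back is composition with the amalgamation of vertex sets,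
without signs. The bound on `Q` ensures that a set of full support is the code of a face. -/
lemma extend_code_pullback (hj : j ≤ n) (hw : IsRegularWeight (n + 1) w)
    (ω : Cochain R n (collapse j ∘ w)) {c : Cell (n + 1) w} {Q : Finset L} (hQ : Q ⊆ K.code c) :
    Function.extend K.code (fun b => b.sgn R * pullback R (n + 1) w n (collapse j ∘ w) ω b) 0 Q =
      codePullback n K.wt j (K.apex j)
        (Function.extend (K.collapse j).code (fun b => b.sgn R * ω b) 0) Q := by
  unfold codePullback
  by_cases hex : ∃ b : Cell (n + 1) w, K.code b = Q
  · obtain ⟨b, rfl⟩ := hex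
    rw [K.code_injective.extend_apply]
    by_cases hb : b.Pushable (collapse j ∘ w)
    · obtain ⟨b', hb'⟩ := hb.exists_pushes (coarsens_collapse hj w) (hw.collapse hj).le
      rw [pullback_apply_of_pushes hb',
        if_pos ⟨K.fullSupport_code b, (amalgamable_code_iff K hj b).2 hb⟩,
        ← code_collapse_eq K hj hb', (K.collapse j).code_injective.extend_apply, ← mul_assoc,
        ← mul_assoc, Cell.sgn_mul_self, one_mul]
    · rw [pullback_apply_of_not_pushable hb, mul_zero,
        if_neg fun h => hb ((amalgamable_code_iff K hj b).1 h.2)]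
  · rw [Function.extend_apply' _ _ _ hex, if_neg, Pi.zero_apply]
    exact fun h => hex (K.exists_code_eq c h.1 hQ)

lemma pullback_collapse_cob (hj : j ≤ n) (hw : IsRegularWeight (n + 1) w) (hm : Monotone w)
    (ω : Cochain R n (collapse j ∘ w)) :
    pullback R (n + 1) w n (collapse j ∘ w) (cob R ω) =
      cob R (pullback R (n + 1) w n (collapse j ∘ w) ω) := by
  funext c
  let K := Coding.lex hm
  -- Signs are invertible, so the identity can be checked in the twisted basis.
  have hsgn : ∀ x y : R, c.sgn R * x = c.sgn R * y → x = y := fun x y hxy => by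
    have := congrArg (c.sgn R * ·) hxy
    simpa only [← mul_assoc, Cell.sgn_mul_self, one_mul] using this
  apply hsgn
  rw [sgn_mul_cob K]
  have h1 : codeCob (n + 1) K.wt (Function.extend K.code
      (fun b => b.sgn R * pullback R (n + 1) w n (collapse j ∘ w) ω b) 0) (K.code c) =
      codeCob (n + 1) K.wt (codePullback n K.wt j (K.apex j)
        (Function.extend (K.collapse j).code (fun b => b.sgn R * ω b) 0)) (K.code c) := by
    unfold codeCob
    refine Finset.sum_congr rfl fun x _ => ?_
    rw [extend_code_pullback K hj hw ω (Finset.erase_subset x (K.code c))]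
  rw [h1, codeCob_codePullback K.monotone_wt hj (K.wt_apex j) (fun x hx => le_apex_lex hm x hx) _
    (K.fullSupport_code c)]
  · unfold codePullback
    by_cases hc : c.Pushable (collapse j ∘ w)
    · obtain ⟨c', hc'⟩ := hc.exists_pushes (coarsens_collapse hj w) (hw.collapse hj).le
      rw [pullback_apply_of_pushes hc', if_pos ⟨K.fullSupport_code c,
        (amalgamable_code_iff K hj c).2 hc⟩, ← code_collapse_eq K hj hc', ← mul_assoc,
        ← mul_assoc, Cell.sgn_mul_self, one_mul, sgn_mul_cob (K.collapse j)]
      rfl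
    · rw [pullback_apply_of_not_pushable hc, mul_zero,
        if_neg fun h => hc ((amalgamable_code_iff K hj c).1 h.2)]
  · intro Q hQ
    obtain ⟨b, rfl⟩ := exists_of_extend_ne_zero hQ
    exact (K.collapse j).fullSupport_code b

end Cob

/-! ### Elementary amalgamations and the cup product -/

section Cup

variable {R : Type*} [CommRing R] {m n j : ℕ} {w : Fin (m + 1) → ℕ} {L : Type*} [LinearOrder L]
  (K : Coding w L)

/-- The two alternatives of `Compatible` are the two kinds of common vertex: a vertex of `Δ`, or the
apex if `i ∈ a.E`. In the latter case nothing comes after the common vertex, so `b` has only the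
apex in that factor. -/
lemma isSplit_code_iff (a b c : Cell n w) :
    IsSplit n K.wt (K.code c) (K.code a) (K.code b) ↔
      a.Compatible b ∧ c.F = a.F ∪ b.F ∧ c.E = b.E := by
  constructor
  · intro h
    have hU : ∀ x, x ∈ K.code c ↔ x ∈ K.code a ∨ x ∈ K.code b := fun x => by
      rw [← h.union_eq, Finset.mem_union]
    have hE : ∀ i, i ∈ a.E → i ∈ b.E ∧ b.factor i = ∅ := by
      intro i hi
      obtain ⟨x, hxa, hxb, hx, h1, h2⟩ := h.exists_mid i (a.lt_of_mem i hi).le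
      have hle := h1 (K.apex i) (K.apex_mem_code.2 hi) (K.wt_apex i)
      have hno : ∀ v ∈ b.F, w v ≠ i := by
        intro v hv hvi
        have h3 := h2 (K.vert v) (K.vert_mem_code.2 hv) ((K.wt_vert v).trans hvi)
        have h4 := K.vert_lt_apex v
        rw [hvi] at h4
        exact absurd (hle.trans h3) (not_le.2 h4)
      refine ⟨?_, Finset.filter_eq_empty_iff.2 fun v hv => hno v hv⟩
      by_contra hiE
      obtain ⟨v, hv, hvi⟩ := b.nonempty i (a.lt_of_mem i hi).le hiE
      exact hno v hv hvi
    refine ⟨fun i hi => ?_, ?_, ?_⟩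
    · by_cases hiE : i ∈ a.E
      · exact Or.inr ⟨hiE, (hE i hiE).2⟩
      · obtain ⟨x, hxa, hxb, hx, h1, h2⟩ := h.exists_mid i hi
        rcases K.mem_code.1 hxa with ⟨v, hv, rfl⟩ | ⟨k, hk, rfl⟩
        · rw [K.wt_vert] at hx
          refine Or.inl ⟨hiE, v, ⟨Finset.mem_coe.2 (Cell.mem_factor.2 ⟨hv, hx⟩), fun u hu => ?_⟩,
            Finset.mem_coe.2 (Cell.mem_factor.2 ⟨K.vert_mem_code.1 hxb, hx⟩), fun u hu => ?_⟩
          · obtain ⟨hu, hui⟩ := Cell.mem_factor.1 (Finset.mem_coe.1 hu)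
            exact K.strictMono_vert.le_iff_le.1
              (h1 _ (K.vert_mem_code.2 hu) ((K.wt_vert u).trans hui))
          · obtain ⟨hu, hui⟩ := Cell.mem_factor.1 (Finset.mem_coe.1 hu)
            exact K.strictMono_vert.le_iff_le.1
              (h2 _ (K.vert_mem_code.2 hu) ((K.wt_vert u).trans hui))
        · rw [K.wt_apex] at hx
          exact absurd (hx ▸ hk) hiE
    · ext v
      rw [Finset.mem_union, ← K.vert_mem_code, hU, K.vert_mem_code, K.vert_mem_code]
    · ext i
      rw [← K.apex_mem_code, hU, K.apex_mem_code, K.apex_mem_code]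
      exact or_iff_right_of_imp fun hi => (hE i hi).1
  · rintro ⟨h, hF, hE⟩
    have hEE : ∀ i ∈ a.E, i ∈ b.E := by
      intro i hi
      have hin := (a.lt_of_mem i hi).le
      rcases h i hin with ⟨h1, -⟩ | ⟨-, h1⟩
      · exact absurd hi h1
      · by_contra hiE
        obtain ⟨v, hv, hvi⟩ := b.nonempty i hin hiE
        exact Finset.filter_eq_empty_iff.1 h1 hv hvi
    refine ⟨?_, fun i hi => ?_⟩
    · ext x
      rw [Finset.mem_union, K.mem_code, K.mem_code, K.mem_code, hF, hE]
      constructor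
      · rintro ((⟨v, hv, rfl⟩ | ⟨k, hk, rfl⟩) | (⟨v, hv, rfl⟩ | ⟨k, hk, rfl⟩))
        · exact Or.inl ⟨v, Finset.mem_union_left _ hv, rfl⟩
        · exact Or.inr ⟨k, hEE k hk, rfl⟩
        · exact Or.inl ⟨v, Finset.mem_union_right _ hv, rfl⟩
        · exact Or.inr ⟨k, hk, rfl⟩
      · rintro (⟨v, hv, rfl⟩ | ⟨k, hk, rfl⟩)
        · rcases Finset.mem_union.1 hv with hv | hv
          · exact Or.inl (Or.inl ⟨v, hv, rfl⟩)
          · exact Or.inr (Or.inl ⟨v, hv, rfl⟩)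
        · exact Or.inr (Or.inr ⟨k, hk, rfl⟩)
    · rcases h i hi with ⟨h1, v, ⟨hv1, hv2⟩, hv3, hv4⟩ | ⟨h1, h2⟩
      · obtain ⟨hva, hvi⟩ := Cell.mem_factor.1 (Finset.mem_coe.1 hv1)
        obtain ⟨hvb, -⟩ := Cell.mem_factor.1 (Finset.mem_coe.1 hv3)
        refine ⟨K.vert v, K.vert_mem_code.2 hva, K.vert_mem_code.2 hvb, (K.wt_vert v).trans hvi,
          fun y hy hyi => ?_, fun y hy hyi => ?_⟩
        · rcases K.mem_code.1 hy with ⟨u, hu, rfl⟩ | ⟨k, hk, rfl⟩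
          · rw [K.wt_vert] at hyi
            exact K.strictMono_vert.monotone (hv2 (Finset.mem_coe.2 (Cell.mem_factor.2 ⟨hu, hyi⟩)))
          · rw [K.wt_apex] at hyi
            exact absurd (hyi ▸ hk) h1
        · rcases K.mem_code.1 hy with ⟨u, hu, rfl⟩ | ⟨k, hk, rfl⟩
          · rw [K.wt_vert] at hyi
            exact K.strictMono_vert.monotone (hv4 (Finset.mem_coe.2 (Cell.mem_factor.2 ⟨hu, hyi⟩)))
          · rw [K.wt_apex] at hyi
            rw [hyi, ← hvi]
            exact (K.vert_lt_apex v).le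
      · refine ⟨K.apex i, K.apex_mem_code.2 h1, K.apex_mem_code.2 (hEE i h1), K.wt_apex i,
          fun y hy hyi => ?_, fun y hy hyi => ?_⟩
        · rcases K.mem_code.1 hy with ⟨u, hu, rfl⟩ | ⟨k, hk, rfl⟩
          · rw [K.wt_vert] at hyi
            rw [← hyi]
            exact (K.vert_lt_apex u).le
          · rw [K.wt_apex] at hyi
            rw [hyi]
        · rcases K.mem_code.1 hy with ⟨u, hu, rfl⟩ | ⟨k, hk, rfl⟩
          · rw [K.wt_vert] at hyi
            exact absurd hyi (Finset.filter_eq_empty_iff.1 h2 hu)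
          · rw [K.wt_apex] at hyi
            rw [hyi]

lemma degAt_of_isSplit {a b c : Cell n w} (h : IsSplit n K.wt (K.code c) (K.code a) (K.code b))
    {i : ℕ} (hi : i ≤ n) : c.degAt i = a.degAt i + b.degAt i := by
  have h1 := h.card_layer hi
  rw [K.card_layer_code a hi, K.card_layer_code b hi, K.card_layer_code c hi] at h1
  omega

lemma cross_add (n : ℕ) (a b c : ℕ → ℕ) (h : ∀ i ≤ n, c i = a i + b i) :
    cross n c c = cross n a a + cross n b b + cross n a b + cross n b a := by
  unfold cross
  simp only [← Finset.sum_add_distrib]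
  refine Finset.sum_congr rfl fun i hi => Finset.sum_congr rfl fun k hk => ?_
  rw [h i (Nat.lt_succ_iff.1 (Finset.mem_range.1 hi)),
    h k (Nat.lt_succ_iff.1 (Finset.mem_range.1 hk))]
  split_ifs
  · ring
  · rfl

lemma sum_mul_sum_eq_cross (n : ℕ) (a b : ℕ → ℕ) :
    (∑ i ∈ Finset.range (n + 1), a i) * ∑ i ∈ Finset.range (n + 1), b i =
      cross n a b + cross n b a + ∑ i ∈ Finset.range (n + 1), a i * b i := by
  have h1 : cross n b a = ∑ i ∈ Finset.range (n + 1), ∑ k ∈ Finset.range (n + 1),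
      if i < k then a i * b k else 0 := by
    rw [cross, Finset.sum_comm]
    exact Finset.sum_congr rfl fun i _ => Finset.sum_congr rfl fun k _ => by rw [mul_comm]
  have h2 : ∑ i ∈ Finset.range (n + 1), a i * b i = ∑ i ∈ Finset.range (n + 1),
      ∑ k ∈ Finset.range (n + 1), if i = k then a i * b k else 0 :=
    Finset.sum_congr rfl fun i hi => by rw [Finset.sum_ite_eq, if_pos hi]
  rw [h1, h2, cross, ← Finset.sum_add_distrib, ← Finset.sum_add_distrib, Finset.sum_mul_sum]
  refine Finset.sum_congr rfl fun i _ => ?_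
  rw [← Finset.sum_add_distrib, ← Finset.sum_add_distrib]
  refine Finset.sum_congr rfl fun k _ => ?_
  rcases lt_trichotomy k i with h | rfl | h
  · rw [if_pos h, if_neg h.not_gt, if_neg h.ne', add_zero, add_zero]
  · rw [if_neg (lt_irrefl k), if_pos rfl, zero_add, zero_add]
  · rw [if_neg h.not_gt, if_pos h, if_neg h.ne, zero_add, add_zero]

lemma sum_range_le_eq_cross (n : ℕ) (a b : ℕ → ℕ) :
    ∑ i ∈ Finset.range (n + 1), ∑ k ∈ Finset.range (i + 1), a i * b k =
      cross n a b + ∑ i ∈ Finset.range (n + 1), a i * b i := by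
  rw [cross, ← Finset.sum_add_distrib]
  refine Finset.sum_congr rfl fun i hi => ?_
  rw [Finset.sum_range_succ, ← Finset.sum_filter]
  congr 1
  refine Finset.sum_congr ?_ fun _ _ => rfl
  ext k
  have := Finset.mem_range.1 hi
  simp only [Finset.mem_range, Finset.mem_filter]
  omega

/-- The sign of the cup product after the change of basis given by `Cell.sgn`. -/
lemma cupCoeff_of_isSplit {a b c : Cell n w}
    (h : IsSplit n K.wt (K.code c) (K.code a) (K.code b)) : cupCoeff R a b c =
      a.sgn R * b.sgn R * c.sgn R * (-1) ^ (a.deg * b.deg + cross n a.degAt b.degAt) := by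
  unfold cupCoeff
  rw [if_pos ((isSplit_code_iff K a b c).1 h)]
  unfold Cell.sgn Cell.deg
  rw [cross_add n a.degAt b.degAt c.degAt fun i hi => degAt_of_isSplit K h hi,
    sum_mul_sum_eq_cross, sum_range_le_eq_cross, ← pow_add, ← pow_add, ← pow_add]
  -- In this order the letters are the values of `cross` at `(a, a)`, `(b, b)`, `(a, b)` and `(b,
  -- a)`, and the sum of the `|a_i||b_i|`.
  have key : ∀ x y u v s : ℕ, x + y + (x + y + u + v) + (u + v + s + u) =
      u + s + 2 * (x + y + u + v) := fun x y u v s => by ring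
  rw [key, pow_add _ _ (2 * _), pow_mul (-1 : R) 2, neg_one_sq, one_pow, mul_one]

lemma cupCoeff_of_not_isSplit {a b c : Cell n w}
    (h : ¬ IsSplit n K.wt (K.code c) (K.code a) (K.code b)) : cupCoeff R a b c = 0 := by
  unfold cupCoeff
  rw [if_neg]
  exact fun h' => h ((isSplit_code_iff K a b c).2 h')

/-- The two sides are sums over cuttings of `c'` and over cuttings of `c` into faces that survive.
Amalgamating both parts is a bijection between them, by `IsSplit.isSplit_amalg`,
`IsSplit.eq_of_amalg_eq` and `IsSplit.exists_of_amalg`. If `c` is killed, every cutting of it has a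
part that is killed. -/
lemma pullback_collapse_cup (hj : j ≤ n) (hw : IsRegularWeight (n + 1) w) (hm : Monotone w)
    (ω η : Cochain R n (collapse j ∘ w)) :
    pullback R (n + 1) w n (collapse j ∘ w) (cup ω η) =
      cup (pullback R (n + 1) w n (collapse j ∘ w) ω)
        (pullback R (n + 1) w n (collapse j ∘ w) η) := by
  classical
  funext c
  let K := Coding.lex hm
  have hz : K.wt (K.apex j) = j := K.wt_apex j
  have hmax : ∀ x, K.wt x = j → x ≤ K.apex j := fun x hx => le_apex_lex hm x hx
  have hcoll := coarsens_collapse hj w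
  have hexi : ∀ {b : Cell (n + 1) w}, b.Pushable (collapse j ∘ w) →
      ∃ b' : Cell n (collapse j ∘ w), b.Pushes b' := fun hb =>
    hb.exists_pushes hcoll (hw.collapse hj).le
  unfold cup
  rw [← Fintype.sum_prod_type']
  by_cases hc : c.Pushable (collapse j ∘ w)
  swap
  · rw [pullback_apply_of_not_pushable hc]
    symm
    refine Finset.sum_eq_zero fun p _ => ?_
    by_contra hne
    have hs : IsSplit (n + 1) K.wt (K.code c) (K.code p.1) (K.code p.2) := by
      by_contra hs
      exact left_ne_zero_of_mul hne (cupCoeff_of_not_isSplit K hs)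
    obtain ⟨a', ha', -⟩ :=
      exists_pushes_of_pullback_ne_zero (left_ne_zero_of_mul (right_ne_zero_of_mul hne))
    obtain ⟨b', hb', -⟩ :=
      exists_pushes_of_pullback_ne_zero (right_ne_zero_of_mul (right_ne_zero_of_mul hne))
    exact hc ((amalgamable_code_iff K hj c).1 (hs.isSplit_amalg K.monotone_wt hj hz hmax
      ((amalgamable_code_iff K hj p.1).2 ha'.pushable)
      ((amalgamable_code_iff K hj p.2).2 hb'.pushable)).1)
  obtain ⟨c', hc'⟩ := hexi hc
  rw [pullback_apply_of_pushes hc', ← Fintype.sum_prod_type', Finset.mul_sum]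
  let S : Finset (Cell (n + 1) w × Cell (n + 1) w) := Finset.univ.filter fun p =>
    IsSplit (n + 1) K.wt (K.code c) (K.code p.1) (K.code p.2) ∧
      p.1.Pushable (collapse j ∘ w) ∧ p.2.Pushable (collapse j ∘ w)
  let S' : Finset (Cell n (collapse j ∘ w) × Cell n (collapse j ∘ w)) := Finset.univ.filter fun p =>
    IsSplit n (K.collapse j).wt ((K.collapse j).code c') ((K.collapse j).code p.1)
      ((K.collapse j).code p.2)
  have hS : ∀ p, p ∈ S ↔ IsSplit (n + 1) K.wt (K.code c) (K.code p.1) (K.code p.2) ∧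
      p.1.Pushable (collapse j ∘ w) ∧ p.2.Pushable (collapse j ∘ w) := fun p => by
    simp only [S, Finset.mem_filter, Finset.mem_univ, true_and]
  have hS' : ∀ p, p ∈ S' ↔ IsSplit n (K.collapse j).wt ((K.collapse j).code c')
      ((K.collapse j).code p.1) ((K.collapse j).code p.2) := fun p => by
    simp only [S', Finset.mem_filter, Finset.mem_univ, true_and]
  rw [← Finset.sum_subset (Finset.subset_univ S'), ← Finset.sum_subset (Finset.subset_univ S)]
  · have hex : ∀ p ∈ S, ∃ p' : Cell n (collapse j ∘ w) × Cell n (collapse j ∘ w),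
        p.1.Pushes p'.1 ∧ p.2.Pushes p'.2 := by
      intro p hp
      obtain ⟨-, h1, h2⟩ := (hS p).1 hp
      obtain ⟨a', ha'⟩ := hexi h1
      obtain ⟨b', hb'⟩ := hexi h2
      exact ⟨(a', b'), ha', hb'⟩
    choose f hf using hex
    have hsplit : ∀ p hp, IsSplit n (K.collapse j).wt ((K.collapse j).code c')
        ((K.collapse j).code (f p hp).1) ((K.collapse j).code (f p hp).2) ∧
        (p.1.degAt (j + 1) = 0 ∨ p.2.degAt j = 0) := by
      intro p hp
      obtain ⟨h1, h2⟩ := hf p hp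
      have h3 := ((hS p).1 hp).1.isSplit_amalg K.monotone_wt hj hz hmax
        ((amalgamable_code_iff K hj p.1).2 h1.pushable)
        ((amalgamable_code_iff K hj p.2).2 h2.pushable)
      rw [code_collapse_eq K hj h1, code_collapse_eq K hj h2, code_collapse_eq K hj hc']
      refine ⟨h3.2.1, ?_⟩
      have h4 := h3.2.2
      rw [K.card_layer_code p.1 (by omega), K.card_layer_code p.2 (by omega)] at h4
      omega
    symm
    refine Finset.sum_bij f (fun p hp => (hS' _).2 (hsplit p hp).1) ?_ ?_ ?_
    · intro p hp q hq hpq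
      obtain ⟨h1, h2⟩ := hf p hp
      obtain ⟨h3, h4⟩ := hf q hq
      have h5 := ((hS p).1 hp).1.eq_of_amalg_eq hj hz hmax ((hS q).1 hq).1
        ((amalgamable_code_iff K hj p.1).2 h1.pushable)
        ((amalgamable_code_iff K hj q.1).2 h3.pushable)
        (by rw [← code_collapse_eq K hj h1, ← code_collapse_eq K hj h3, hpq])
        (by rw [← code_collapse_eq K hj h2, ← code_collapse_eq K hj h4, hpq])
      exact Prod.ext (K.code_injective h5.1) (K.code_injective h5.2)
    · intro q hq
      have h1 := (hS' q).1 hq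
      rw [code_collapse_eq K hj hc'] at h1
      obtain ⟨A, B, hAB, hA, hB, hA', hB'⟩ := IsSplit.exists_of_amalg K.monotone_wt hj hz hmax
        (K.fullSupport_code c) ((amalgamable_code_iff K hj c).2 hc) h1
      have hfull : FullSupport (n + 1) K.wt A ∧ FullSupport (n + 1) K.wt B := by
        constructor
        · refine ⟨fun x hx => (K.fullSupport_code c).le x
            (hAB.union_eq ▸ Finset.mem_union_left _ hx), fun i hi => ?_⟩
          obtain ⟨x, hx, -, hxi, -⟩ := hAB.exists_mid i hi
          exact ⟨x, hx, hxi⟩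
        · refine ⟨fun x hx => (K.fullSupport_code c).le x
            (hAB.union_eq ▸ Finset.mem_union_right _ hx), fun i hi => ?_⟩
          obtain ⟨x, -, hx, hxi, -⟩ := hAB.exists_mid i hi
          exact ⟨x, hx, hxi⟩
      obtain ⟨a, rfl⟩ := K.exists_code_eq c hfull.1 (hAB.union_eq ▸ Finset.subset_union_left)
      obtain ⟨b, rfl⟩ := K.exists_code_eq c hfull.2 (hAB.union_eq ▸ Finset.subset_union_right)
      have hp : (a, b) ∈ S := (hS _).2 ⟨hAB, (amalgamable_code_iff K hj a).1 hA,
        (amalgamable_code_iff K hj b).1 hB⟩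
      refine ⟨(a, b), hp, ?_⟩
      obtain ⟨h2, h3⟩ := hf _ hp
      exact Prod.ext (h2.unique ((pushes_iff_code K hj hw a q.1).2 ⟨hA, hA'.symm⟩))
        (h3.unique ((pushes_iff_code K hj hw b q.2).2 ⟨hB, hB'.symm⟩))
    · intro p hp
      obtain ⟨h1, h2⟩ := hf p hp
      obtain ⟨h3, h4⟩ := hsplit p hp
      rw [pullback_apply_of_pushes h1, pullback_apply_of_pushes h2,
        cupCoeff_of_isSplit K ((hS p).1 hp).1, cupCoeff_of_isSplit (K.collapse j) h3,
        h1.deg_eq hw (hw.collapse hj).le hcoll, h2.deg_eq hw (hw.collapse hj).le hcoll,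
        cross_collapse hj (h1.degAt_collapse hj) (h2.degAt_collapse hj)]
      -- Total degrees are preserved, so this is the only term by which the signs of the two
      -- products could differ.
      have h5 : p.1.degAt (j + 1) * p.2.degAt j = 0 := by
        rcases h4 with h4 | h4 <;> rw [h4]
        · exact zero_mul _
        · exact mul_zero _
      rw [h5, add_zero]
      generalize hs : (-1 : R) ^ (p.1.deg * p.2.deg + cross n (f p hp).1.degAt (f p hp).2.degAt) = s
      have e1 := Cell.sgn_mul_self R p.1
      have e2 := Cell.sgn_mul_self R p.2
      have e3 := Cell.sgn_mul_self R c'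
      linear_combination (c.sgn R * (f p hp).1.sgn R * (f p hp).2.sgn R * s * ω (f p hp).1 *
        η (f p hp).2) * (p.2.sgn R * p.2.sgn R * e1 + e2 - e3)
  · intro p _ hp
    by_contra hne
    apply hp
    obtain ⟨a', ha', -⟩ :=
      exists_pushes_of_pullback_ne_zero (left_ne_zero_of_mul (right_ne_zero_of_mul hne))
    obtain ⟨b', hb', -⟩ :=
      exists_pushes_of_pullback_ne_zero (right_ne_zero_of_mul (right_ne_zero_of_mul hne))
    refine (hS p).2 ⟨?_, ha'.pushable, hb'.pushable⟩
    by_contra hs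
    exact left_ne_zero_of_mul hne (cupCoeff_of_not_isSplit K hs)
  · intro p _ hp
    rw [cupCoeff_of_not_isSplit (K.collapse j) fun h => hp ((hS' p).2 h), zero_mul, mul_zero]

end Cup

end BlownUp
namespace BlownUp

/-! ### Sequences of elementary amalgamations -/

section Sequences

variable {R : Type*} [CommRing R] {m n n' : ℕ} {w w' : Fin (m + 1) → ℕ}
  {A : Cochain R n' w' →ₗ[R] Cochain R n w}

/-- `A` is the pull-back by an amalgamation that only gathers factors; it commutes with the
differential and with cup products. -/
structure IsGathering (n : ℕ) (w : Fin (m + 1) → ℕ) (n' : ℕ) (w' : Fin (m + 1) → ℕ)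
    (A : Cochain R n' w' →ₗ[R] Cochain R n w) : Prop where
  isRegularWeight : IsRegularWeight n' w'
  coarsens : Coarsens n w n' w'
  eq_pullback : A = pullback R n w n' w'
  map_cob : ∀ ω, A (cob R ω) = cob R (A ω)
  map_cup : ∀ ω η, A (cup ω η) = cup (A ω) (A η)

/-- Monotonicity of the weights is carried through the induction because the lexicographic coding
depends on it. -/
lemma AmalgSeq.isGathering (h : AmalgSeq R n w n' w' A) (hw : IsRegularWeight n w)
    (hm : Monotone w) : IsGathering n w n' w' A := by
  induction h with
  | refl n w =>
    exact ⟨hw, Coarsens.refl n w, (pullback_self n w).symm, fun _ => rfl, fun _ _ => rfl⟩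
  | @step j n w n' w' A hj h ih =>
    obtain ⟨h1, h2, h3, h4, h5⟩ := ih (hw.collapse hj) ((monotone_collapse j).comp hm)
    have hc := coarsens_collapse hj w
    rw [elemPullback_eq_pullback R hj]
    refine ⟨h1, hc.trans h2, ?_, fun ω => ?_, fun ω η => ?_⟩
    · rw [h3, pullback_comp hw (hw.collapse hj).le h1.le hc h2]
    · rw [LinearMap.comp_apply, LinearMap.comp_apply, h4, pullback_collapse_cob hj hw hm]
    · rw [LinearMap.comp_apply, LinearMap.comp_apply, LinearMap.comp_apply, h5,
        pullback_collapse_cup hj hw hm]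

lemma SimpleAmalgSeq.amalgSeq (h : SimpleAmalgSeq R n w n' w' A) : AmalgSeq R n w n' w' A := by
  induction h with
  | refl n w => exact AmalgSeq.refl n w
  | step hj _ _ ih => exact AmalgSeq.step hj ih

/-- Every amalgamation pull-back is the map `pullback`; it commutes with the differential and with
cup products. -/
lemma IsAmalgPullback.isGathering (h : IsAmalgPullback R n w n' w' A) (hw : IsRegularWeight n w)
    (hm : Monotone w) (hw' : IsRegularWeight n' w') (hm' : Monotone w')
    (hc : Coarsens n w n' w') : IsGathering n w n' w' A := by
  obtain ⟨n₀, w₀, A₁, A₂, h₁, h₂, rfl⟩ := h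
  obtain ⟨hw₀, hc₁, he₁, hcob₁, hcup₁⟩ := h₁.isGathering hw hm
  obtain ⟨-, hc₂, he₂, hcob₂, hcup₂⟩ := h₂.amalgSeq.isGathering hw' hm'
  refine ⟨hw', hc, ?_, fun ω => ?_, fun ω η => ?_⟩
  -- By functoriality the pull-back from `(n', w')` followed after `A₂` is `A₁`; cancelling the
  -- invertible `A₂` shows that the choice of the amalgamation is immaterial.
  · have h3 : pullback R n w n' w' ∘ₗ A₂.toLinearMap = A₁ := by
      rw [he₂, he₁, pullback_comp hw hw'.le hw₀.le hc hc₂]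
    rw [← h3, LinearMap.comp_assoc, LinearEquiv.comp_symm, LinearMap.comp_id]
  · have h3 : A₂.symm (cob R ω) = cob R (A₂.symm ω) := by
      rw [LinearEquiv.symm_apply_eq]
      have := hcob₂ (A₂.symm ω)
      simp only [LinearEquiv.coe_coe, LinearEquiv.apply_symm_apply] at this
      exact this.symm
    simp only [LinearMap.comp_apply, LinearEquiv.coe_coe]
    rw [h3, hcob₁]
  · have h3 : A₂.symm (cup ω η) = cup (A₂.symm ω) (A₂.symm η) := by
      rw [LinearEquiv.symm_apply_eq]
      have := hcup₂ (A₂.symm ω) (A₂.symm η)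
      simp only [LinearEquiv.coe_coe, LinearEquiv.apply_symm_apply] at this
      exact this.symm
    simp only [LinearMap.comp_apply, LinearEquiv.coe_coe]
    rw [h3, hcup₁]

variable (R)

/-- A decomposition can be simplified to one without empty factors. -/
lemma exists_simpleAmalgSeq : ∀ (n : ℕ) (w : Fin (m + 1) → ℕ), IsRegularWeight n w →
    ∃ (n₀ : ℕ) (w₀ : Fin (m + 1) → ℕ) (A : Cochain R n₀ w₀ →ₗ[R] Cochain R n w),
      SimpleAmalgSeq R n w n₀ w₀ A ∧ (∀ i ≤ n₀, ∃ v, w₀ v = i) ∧ Coarsens n₀ w₀ n w := by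
  intro n
  induction n with
  | zero =>
    intro w hw
    refine ⟨0, w, _, SimpleAmalgSeq.refl 0 w, fun i hi => ?_, Coarsens.refl 0 w⟩
    obtain ⟨v, hv⟩ := hw.exists_eq
    exact ⟨v, by omega⟩
  | succ n ih =>
    intro w hw
    by_cases hex : ∃ j ≤ n, ∀ v, w v ≠ j
    · obtain ⟨j, hj, hempty⟩ := hex
      obtain ⟨n₀, w₀, A, hA, hsurj, hc⟩ := ih (collapse j ∘ w) (hw.collapse hj)
      -- Collapsing an empty factor identifies no two weights that occur, so the order of the
      -- weights is also recovered from the collapsed ones.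
      refine ⟨n₀, w₀, _, SimpleAmalgSeq.step hj hempty hA, hsurj, hc.trans ⟨fun u v huv => ?_,
        fun v hv => ?_⟩⟩
      · have h1 := hempty u
        have h2 := hempty v
        simp only [Function.comp_apply] at huv
        unfold collapse at huv
        split_ifs at huv <;> omega
      · have h1 := hempty v
        simp only [Function.comp_apply] at hv
        unfold collapse at hv
        split_ifs at hv <;> omega
    · push Not at hex
      refine ⟨n + 1, w, _, SimpleAmalgSeq.refl _ w, fun i hi => ?_, Coarsens.refl _ w⟩
      rcases hi.lt_or_eq with h | rfl
      · exact hex i (by omega)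
      · exact hw.exists_eq

/-- A decomposition can be amalgamated to every coarser decomposition without empty factors. -/
lemma exists_amalgSeq {n₀ : ℕ} {w₀ : Fin (m + 1) → ℕ} (hw₀ : ∀ v, w₀ v ≤ n₀)
    (hsurj : ∀ i ≤ n₀, ∃ v, w₀ v = i) :
    ∀ (n : ℕ) (w : Fin (m + 1) → ℕ), IsRegularWeight n w → Coarsens n w n₀ w₀ →
      ∃ A : Cochain R n₀ w₀ →ₗ[R] Cochain R n w, AmalgSeq R n w n₀ w₀ A := by
  -- If any two consecutive factors of `w` are non-empty and separated by `w₀`, then `w₀` increases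
  -- at each step; as it omits no value it increases by exactly one, whence `w₀ = w`.
  have hbase : ∀ (n : ℕ) (w : Fin (m + 1) → ℕ), IsRegularWeight n w → Coarsens n w n₀ w₀ →
      (∀ j < n, ∃ u v, w u = j ∧ w v = j + 1 ∧ w₀ u ≠ w₀ v) →
      ∃ A : Cochain R n₀ w₀ →ₗ[R] Cochain R n w, AmalgSeq R n w n₀ w₀ A := by
    intro n w hw hc hne
    have heq : ∀ i ≤ n, ∀ v, w v = i → w₀ v = i := by
      intro i
      induction i with
      | zero =>
        intro _ v hv
        obtain ⟨u, hu⟩ := hsurj 0 (Nat.zero_le _)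
        have := hc.mono v u (by omega)
        omega
      | succ i ih =>
        intro hi v hv
        obtain ⟨x, y, hx, hy, hxy⟩ := hne i (by omega)
        have h1 := ih (by omega) x hx
        have h2 := hc.mono x y (by omega)
        have h3 := hc.congr (hy.trans hv.symm)
        obtain ⟨u, hu⟩ := hsurj (i + 1) (by have := hw₀ v; omega)
        have h4 : w₀ v ≤ w₀ u := by
          refine hc.mono v u ?_
          by_contra hlt
          have := hc.mono u x (by omega)
          omega
        omega
    have hww : w₀ = w := funext fun v => heq _ (hw.le v) v rfl
    obtain ⟨v, hv⟩ := hw.exists_eq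
    have hnn : n₀ = n := by
      rw [← hc.last v hv]
      exact heq n le_rfl v hv
    subst hww hnn
    exact ⟨_, AmalgSeq.refl _ _⟩
  intro n
  induction n with
  | zero => exact fun w hw hc => hbase 0 w hw hc fun j hj => absurd hj (Nat.not_lt_zero j)
  | succ n ih =>
    intro w hw hc
    -- The condition holds vacuously if one of the two factors is empty, so the empty factors of `w`
    -- are absorbed here too.
    by_cases hex : ∃ j ≤ n, ∀ u v, w u = j → w v = j + 1 → w₀ u = w₀ v
    · obtain ⟨j, hj, hjj⟩ := hex
      have hc' : Coarsens n (collapse j ∘ w) n₀ w₀ := by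
        have hmono : ∀ u v, (collapse j ∘ w) u ≤ (collapse j ∘ w) v → w₀ u ≤ w₀ v := by
          intro u v huv
          by_cases hle : w u ≤ w v
          · exact hc.mono u v hle
          · have : w u = j + 1 ∧ w v = j := by
              simp only [Function.comp_apply] at huv
              unfold collapse at huv
              split_ifs at huv <;> omega
            exact (hjj v u this.2 this.1).ge
        -- For `j = n` the new last factor also contains the vertices of old weight `n`, so the last
        -- condition has to come from monotonicity.
        refine ⟨hmono, fun v hv => le_antisymm (hw₀ v) ?_⟩
        obtain ⟨x, hx⟩ := hw.exists_eq
        rw [← hc.last x hx]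
        exact hmono x v (((hw.collapse hj).le x).trans hv.ge)
      obtain ⟨A, hA⟩ := ih (collapse j ∘ w) (hw.collapse hj) hc'
      exact ⟨_, AmalgSeq.step hj hA⟩
    · push Not at hex
      refine hbase (n + 1) w hw hc fun j hj => ?_
      obtain ⟨u, v, h⟩ := hex j (by omega)
      exact ⟨u, v, h⟩

/-- The target is stripped of its empty factors. Both decompositions of the target coarsen each
other, so this stage is invertible, and the source can be gathered onto the stripped decomposition.
-/
lemma isAmalgPullback_pullback (hw : IsRegularWeight n w) (hm : Monotone w)
    (hw' : IsRegularWeight n' w') (hm' : Monotone w') (hc : Coarsens n w n' w') :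
    IsAmalgPullback R n w n' w' (pullback R n w n' w') := by
  obtain ⟨n₀, w₀, A₂, hA₂, hsurj, hback⟩ := exists_simpleAmalgSeq R n' w' hw'
  obtain ⟨hw₀, hc₂, he₂, -, -⟩ := hA₂.amalgSeq.isGathering hw' hm'
  obtain ⟨A₁, hA₁⟩ := exists_amalgSeq R hw₀.le hsurj n w hw (hc.trans hc₂)
  obtain ⟨-, hc₁, he₁, -, -⟩ := hA₁.isGathering hw hm
  have h1 : pullback R n' w' n₀ w₀ ∘ₗ pullback R n₀ w₀ n' w' = LinearMap.id := by
    rw [pullback_comp hw' hw₀.le hw'.le hc₂ hback, pullback_self]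
  have h2 : pullback R n₀ w₀ n' w' ∘ₗ pullback R n' w' n₀ w₀ = LinearMap.id := by
    rw [pullback_comp hw₀ hw'.le hw₀.le hback hc₂, pullback_self]
  subst he₁ he₂
  refine ⟨n₀, w₀, _, LinearEquiv.ofLinearMap _ _ h1 h2, hA₁, hA₂, ?_⟩
  exact (pullback_comp hw hw₀.le hw'.le hc₁ hback).symm

end Sequences

/-! ### Pull-backs and faces -/

section Faces

variable {R : Type*} [CommRing R] {m m' n n' : ℕ} {w w' : Fin (m + 1) → ℕ}
  {u u' : Fin (m' + 1) → ℕ} (e : Fin (m' + 1) ↪o Fin (m + 1)) (h : ∀ v, u v = w (e v))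

lemma Cell.sgn_map (c : Cell n u) : (c.map e h).sgn R = c.sgn R := by
  unfold sgn
  congr 2
  all_goals exact funext fun i => Cell.degAt_map e h c i

lemma Cell.pushable_map_iff (h' : ∀ v, u' v = w' (e v)) (c : Cell n u) : (c.map e h).Pushable w' ↔ c.Pushable u' := by
  have hF : (c.map e h).F = c.F.map e.toEmbedding := rfl
  have hE : (c.map e h).E = c.E := rfl
  unfold Pushable
  rw [hF, hE]
  simp only [Finset.forall_mem_map, RelEmbedding.coe_toEmbedding, ← h, ← h', Cell.degAt_map]

lemma Cell.Pushes.map (h' : ∀ v, u' v = w' (e v)) {c : Cell n u} {c' : Cell n' u'} (hc : c.Pushes c') :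
    (c.map e h).Pushes (c'.map e h') := by
  have hF : (c.map e h).F = c.F.map e.toEmbedding := rfl
  have hE : (c.map e h).E = c.E := rfl
  refine ⟨(c.pushable_map_iff e h h').2 hc.pushable, fun i => ?_, fun v => ?_⟩
  · refine (hc.mem_E i).trans (and_congr_right fun _ => ?_)
    rw [hF, hE]
    simp only [Finset.forall_mem_map, RelEmbedding.coe_toEmbedding, ← h, ← h']
  · rw [hF, hE]
    change v ∈ c'.F.map e.toEmbedding ↔ _
    rw [Finset.mem_map, Finset.mem_map]
    constructor
    · rintro ⟨x, hx, rfl⟩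
      obtain ⟨h1, h2⟩ := (hc.mem_F x).1 hx
      refine ⟨⟨x, h1, rfl⟩, fun y hy hyx hlt => ?_⟩
      obtain ⟨y, hy', rfl⟩ := Finset.mem_map.1 hy
      have h3 := h2 y hy' (by rw [h', h']; exact hyx) (by rw [h, h]; exact hlt)
      rwa [h] at h3
    · rintro ⟨⟨x, hx, rfl⟩, h2⟩
      refine ⟨x, (hc.mem_F x).2 ⟨hx, fun y hy hyx hlt => ?_⟩, rfl⟩
      rw [h]
      rw [h', h'] at hyx
      rw [h, h] at hlt
      exact h2 (e y) (Finset.mem_map_of_mem e.toEmbedding hy) hyx hlt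

/-- The push-forward and the signs depend only on the apexes, the vertices of the face and their
weights, not on the ambient simplex. This makes the family `f^* ω` compatible with regular faces. -/
lemma pullback_map (h' : ∀ v, u' v = w' (e v)) (hc : Coarsens n w n' w') (hw' : ∀ v, w' v ≤ n')
    (ω : Cochain R n' w')
    (c : Cell n u) : pullback R n u n' u' (fun b => ω (b.map e h')) c =
      pullback R n w n' w' ω (c.map e h) := by
  by_cases hp : c.Pushable u'
  · have hcu : Coarsens n u n' u' := by
      refine ⟨fun a b hab => ?_, fun v hv => ?_⟩
      · rw [h', h']
        exact hc.mono _ _ (by rwa [← h, ← h])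
      · rw [h']
        exact hc.last _ (by rwa [← h])
    obtain ⟨c', hc'⟩ := hp.exists_pushes hcu fun v => (h' v).trans_le (hw' _)
    rw [pullback_apply_of_pushes hc', pullback_apply_of_pushes (hc'.map e h h'), Cell.sgn_map,
      Cell.sgn_map]
  · rw [pullback_apply_of_not_pushable hp,
      pullback_apply_of_not_pushable (mt (c.pushable_map_iff e h h').1 hp)]

end Faces

end BlownUp
namespace BlownUp

/-! ### The cap product -/

section Cap

variable {R : Type*} [CommRing R] {m n n' : ℕ} {w w' : Fin (m + 1) → ℕ}

/-- The face of maximal dimension of the blow up. -/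
def topCell (hw : IsRegularWeight n w) : Cell n w where
  F := Finset.univ
  E := Finset.range n
  lt_of_mem _ hi := Finset.mem_range.1 hi
  weight_le v _ := hw.le v
  nonempty i hi hE := by
    obtain ⟨v, hv⟩ := hw.exists_eq
    rw [Finset.mem_range] at hE
    exact ⟨v, Finset.mem_univ v, by omega⟩

lemma deg_topCell (hw : IsRegularWeight n w) : (topCell hw).deg = m := by
  have h := (topCell hw).deg_add
  have h1 : (topCell hw).F.card = m + 1 := (Finset.card_univ).trans (Fintype.card_fin _)
  have h2 : (topCell hw).E.card = n := Finset.card_range n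
  omega

/-- The map `μ_*` sends a face that contains all the apexes to the face spanned by its vertices. -/
lemma Cell.joinFace_of_full {g : Cell n w} (hg : g.E = Finset.range n) :
    g.joinFace.1 = g.F ∧ g.joinFace.1.card = g.deg + 1 := by
  have h1 : g.firstFree = n := by
    have h := g.firstFree_spec
    rw [hg, Finset.mem_range] at h
    omega
  have h2 : g.joinFace.1 = g.F := by
    refine Finset.filter_true_of_mem fun v hv => ?_
    rw [h1]
    exact g.weight_le v hv
  refine ⟨h2, ?_⟩
  have h3 := g.deg_add
  rw [hg, Finset.card_range] at h3
  rw [h2]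
  omega

open Classical in
/-- The cochain `g ↦ ± 1` if `g` is spanned by the apexes and `G`, and `0` otherwise. -/
noncomputable def faceCochain (R : Type*) [CommRing R] (n : ℕ) (w : Fin (m + 1) → ℕ)
    (G : Finset (Fin (m + 1))) : Cochain R n w :=
  fun g => if g.F = G ∧ g.E = Finset.range n then g.sgn R else 0

/-- For a cutting of the top face, `dim Δ_j + 1 = |c_j| + |g_j|` if `j < n`, so `ν` is the sum of
`cross` at `(c, c)` and at `(c, g)`. Hence the cap and cup signs differ only by `(-1)^{|c||g|}` and
by the signs of `g` and of the top face. -/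
lemma capCoeff_eq_cupCoeff (hw : IsRegularWeight n w) (hm : Monotone w) (c g : Cell n w) :
    capCoeff R c g = (topCell hw).sgn R * g.sgn R * (-1) ^ (c.deg * g.deg) *
      cupCoeff R c g (topCell hw) := by
  let K := Coding.lex hm
  have hiff : (c.Compatible g ∧ c.F ∪ g.F = Finset.univ ∧ g.E = Finset.range n) ↔
      IsSplit n K.wt (K.code (topCell hw)) (K.code c) (K.code g) := by
    rw [isSplit_code_iff]
    exact and_congr_right fun _ => and_congr eq_comm eq_comm
  unfold capCoeff
  by_cases h : IsSplit n K.wt (K.code (topCell hw)) (K.code c) (K.code g)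
  · rw [if_pos (hiff.2 h), cupCoeff_of_isSplit K h]
    have hexp : ∑ j ∈ Finset.range n, (Finset.univ.filter fun v => w v = j).card * c.degAbove j =
        cross n c.degAt c.degAt + cross n c.degAt g.degAt := by
      have h1 : ∀ j ∈ Finset.range n, (Finset.univ.filter fun v => w v = j).card * c.degAbove j =
          (c.degAt j + g.degAt j) * c.degAbove j := by
        intro j hj
        rw [← degAt_of_isSplit K h (Finset.mem_range.1 hj).le]
        congr 1
        unfold Cell.degAt
        have : j ∈ (topCell hw).E := hj
        rw [if_pos this, Nat.add_sub_cancel]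
        rfl
      -- The vanishing term `j = n` is added in order to sum over the range used in `cross`.
      have h2 : c.degAbove n = 0 := by
        unfold Cell.degAbove
        rw [Finset.Ioc_self, Finset.sum_empty]
      rw [Finset.sum_congr rfl h1, ← Nat.add_zero (Finset.sum _ _),
        ← Nat.mul_zero (c.degAt n + g.degAt n), ← h2,
        ← Finset.sum_range_succ fun j => (c.degAt j + g.degAt j) * c.degAbove j]
      unfold cross
      rw [← Finset.sum_add_distrib, Finset.sum_congr rfl fun i _ => Finset.sum_add_distrib.symm,
        Finset.sum_comm]
      refine Finset.sum_congr rfl fun j _ => ?_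
      have h3 : c.degAbove j = ∑ i ∈ Finset.range (n + 1), if j < i then c.degAt i else 0 := by
        unfold Cell.degAbove
        rw [← Finset.sum_filter]
        refine Finset.sum_congr ?_ fun _ _ => rfl
        ext i
        simp only [Finset.mem_Ioc, Finset.mem_filter, Finset.mem_range]
        omega
      rw [h3, Finset.mul_sum]
      refine Finset.sum_congr rfl fun i _ => ?_
      split_ifs
      · ring
      · rfl
    have h4 : (-1 : R) ^ (c.deg * g.deg) * (-1) ^ (c.deg * g.deg) = 1 := by
      rw [← pow_add, ← two_mul, pow_mul, neg_one_sq, one_pow]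
    rw [hexp, pow_add, pow_add]
    change c.sgn R * _ = _
    have e1 := Cell.sgn_mul_self R g
    have e2 := Cell.sgn_mul_self R (topCell hw)
    generalize (-1 : R) ^ (c.deg * g.deg) = s at h4 ⊢
    linear_combination (-(c.sgn R * (-1) ^ cross n c.degAt g.degAt)) *
      (e1 + g.sgn R * g.sgn R * e2 +
        g.sgn R * g.sgn R * ((topCell hw).sgn R * (topCell hw).sgn R) * h4)
  · rw [if_neg fun h' => h (hiff.1 h'), cupCoeff_of_not_isSplit K h, mul_zero]

/-- Every `g` in the cap product has all its apexes, and on such faces the dimensions in the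
definition of `μ_*` agree. -/
lemma muMap_capTilde_apply (ω : Cochain R n w) (G : Face m) :
    muMap R (capTilde R ω) G =
      ∑ c, ∑ g, if g.F = G.1 ∧ g.E = Finset.range n then capCoeff R c g * ω c else 0 := by
  simp only [capTilde, LinearMap.coe_mk, AddHom.coe_mk, map_sum, Finsupp.finsetSum_apply]
  refine Finset.sum_congr rfl fun c _ => Finset.sum_congr rfl fun g _ => ?_
  unfold muMap
  rw [Finsupp.linearCombination_single, Finsupp.smul_apply, smul_eq_mul]
  by_cases hg : g.E = Finset.range n
  · obtain ⟨h1, h2⟩ := Cell.joinFace_of_full hg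
    rw [if_pos h2, Finsupp.single_apply]
    by_cases hG : g.F = G.1
    · rw [if_pos (Subtype.ext (h1.trans hG)), if_pos ⟨hG, hg⟩, mul_one]
    · rw [if_neg (fun h => hG (h1.symm.trans (congrArg Subtype.val h))), if_neg fun h => hG h.1,
        mul_zero]
  · have h0 : capCoeff R c g = 0 := by
      unfold capCoeff
      rw [if_neg fun h => hg h.2.2]
    simp only [h0, zero_mul, ite_self]

/-- In the terms that occur `|c| = k` and `|g| = m - k`. Since the sign of `g` is built into
`faceCochain`, the remaining sign depends on the decomposition only through the top face. -/
lemma muMap_capTilde_eq_cup (hw : IsRegularWeight n w) (hm : Monotone w) {k : ℕ}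
    (ω : Cochain R n w) (hω : ∀ c, c.deg ≠ k → ω c = 0) (G : Face m) :
    muMap R (capTilde R ω) G = (topCell hw).sgn R * (-1) ^ (k * (m - k)) *
      cup ω (faceCochain R n w G.1) (topCell hw) := by
  rw [muMap_capTilde_apply]
  unfold cup
  simp only [Finset.mul_sum]
  refine Finset.sum_congr rfl fun c _ => Finset.sum_congr rfl fun g _ => ?_
  unfold faceCochain
  by_cases hg : g.F = G.1 ∧ g.E = Finset.range n
  swap
  · rw [if_neg hg, if_neg hg]
    simp
  rw [if_pos hg, if_pos hg, capCoeff_eq_cupCoeff hw hm]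
  by_cases hc : ω c = 0
  · rw [hc]
    simp
  by_cases hcup : cupCoeff R c g (topCell hw) = 0
  · rw [hcup]
    simp
  have hck : c.deg = k := by
    by_contra h
    exact hc (hω c h)
  have hdeg := deg_of_cupCoeff_ne_zero R _ _ _ hcup
  rw [deg_topCell] at hdeg
  rw [← hck, show m - c.deg = g.deg by omega]
  ring

/-- Amalgamations preserve `μ_*(ω ∩~ Δ~)`. -/
lemma muMap_capTilde_pullback (hw : IsRegularWeight n w) (hm : Monotone w)
    (hw' : IsRegularWeight n' w') (hm' : Monotone w') {A : Cochain R n' w' →ₗ[R] Cochain R n w}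
    (hA : IsGathering n w n' w' A) {k : ℕ} (ω : Cochain R n' w')
    (hω : ∀ c, c.deg ≠ k → ω c = 0) :
    muMap R (capTilde R (A ω)) = muMap R (capTilde R ω) := by
  -- When all the apexes are present no vertex is dropped, and every block but the last keeps its
  -- apex.
  have hfull : ∀ b : Cell n w, b.E = Finset.range n → ∃ b' : Cell n' w', b.Pushes b' ∧
      b'.F = b.F ∧ b'.E = Finset.range n' := by
    intro b hb
    have hlt : ∀ u v, w u < w v → w u ∈ b.E := fun u v huv => by
      rw [hb, Finset.mem_range]
      exact huv.trans_le (hw.le v)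
    have hp : b.Pushable w' := fun u _ v _ _ huv huE => absurd (hlt u v huv) huE
    obtain ⟨b', hb'⟩ := hp.exists_pushes hA.coarsens hw'.le
    refine ⟨b', hb', ?_, ?_⟩
    · ext v
      rw [hb'.mem_F]
      exact and_iff_left fun u _ _ huv => hlt u v huv
    · ext i
      rw [hb'.mem_E, Finset.mem_range]
      refine and_iff_left_of_imp fun hi u _ hui => ?_
      rw [hb, Finset.mem_range]
      refine lt_of_le_of_ne (hw.le u) fun h => ?_
      have := hA.coarsens.last u h
      omega
  have hAω : ∀ c, c.deg ≠ k → A ω c = 0 := by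
    intro c hc
    rw [hA.eq_pullback]
    by_contra hne
    obtain ⟨c', hc', hne'⟩ := exists_pushes_of_pullback_ne_zero hne
    apply hne'
    apply hω
    rwa [hc'.deg_eq hw hw'.le hA.coarsens]
  ext G
  rw [muMap_capTilde_eq_cup hw hm _ hAω, muMap_capTilde_eq_cup hw' hm' _ hω]
  -- The two cochains may differ on faces lacking an apex, but such faces cannot be the second
  -- factor of a product equal to the top face.
  have h1 : cup (A ω) (faceCochain R n w G.1) (topCell hw) =
      cup (A ω) (A (faceCochain R n' w' G.1)) (topCell hw) := by
    unfold cup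
    refine Finset.sum_congr rfl fun a _ => Finset.sum_congr rfl fun b _ => ?_
    by_cases hb : b.E = Finset.range n
    · congr 2
      obtain ⟨b', hb', hF, hE⟩ := hfull b hb
      rw [hA.eq_pullback, pullback_apply_of_pushes hb']
      unfold faceCochain
      rw [hF]
      by_cases hG : b.F = G.1
      · rw [if_pos ⟨hG, hb⟩, if_pos ⟨hG, hE⟩, mul_assoc, Cell.sgn_mul_self, mul_one]
      · rw [if_neg fun h => hG h.1, if_neg fun h => hG h.1, mul_zero]
    · have h0 : cupCoeff R a b (topCell hw) = 0 := by
        unfold cupCoeff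
        rw [if_neg]
        rintro ⟨-, -, h⟩
        exact hb h.symm
      rw [h0, zero_mul, zero_mul]
  obtain ⟨t, ht, hF, hE⟩ := hfull (topCell hw) rfl
  have htop : t = topCell hw' := Cell.ext hF hE
  subst htop
  rw [h1, ← hA.map_cup, hA.eq_pullback, pullback_apply_of_pushes ht]
  have e1 := Cell.sgn_mul_self R (topCell hw)
  linear_combination ((topCell hw').sgn R * (-1) ^ (k * (m - k)) *
    cup ω (faceCochain R n' w' G.1) (topCell hw')) * e1

/-- All faces occurring in the cap product are thus regular, so the value `0` of `simplexMap` on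
non-regular faces plays no role. -/
lemma exists_last_of_muMap_capTilde_ne_zero (ω : Cochain R n w) {G : Face m}
    (h : muMap R (capTilde R ω) G ≠ 0) : ∃ v ∈ G.1, w v = n := by
  rw [muMap_capTilde_apply] at h
  obtain ⟨c, -, hc⟩ := Finset.exists_ne_zero_of_sum_ne_zero h
  obtain ⟨g, -, hg⟩ := Finset.exists_ne_zero_of_sum_ne_zero hc
  split_ifs at hg with h1
  · rw [← h1.1]
    exact g.nonempty n le_rfl g.notMem_E_last
  · exact absurd rfl hg

end Cap

/-! ### Perverse degrees -/

/-- The factor `w v` is free and `c` survives, so the later factors of its block have dimension `0`.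
All other later factors lie in later blocks, whose dimensions add up. -/
lemma Cell.Pushes.degAbove_le {m n n' : ℕ} {w w' : Fin (m + 1) → ℕ} (hw : IsRegularWeight n w)
    (hw' : ∀ v, w' v ≤ n') (h : Coarsens n w n' w') {c : Cell n w} {c' : Cell n' w'}
    (hc : c.Pushes c') {v : Fin (m + 1)} (hv : w v ∉ c.E) :
    c.degAbove (w v) ≤ c'.degAbove (w' v) := by
  obtain ⟨g, hmono, -, hgn, hg⟩ := h.exists_map hw hw'
  obtain ⟨u, hu, huv⟩ := c.nonempty (w v) (hw.le v) hv
  unfold degAbove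
  have h1 : ∑ i ∈ Finset.Ioc (w' v) n', c'.degAt i =
      ∑ i ∈ Finset.Ioc (w' v) n', ∑ k ∈ ((Finset.range (n + 1)).filter
        fun k => w' v < g k).filter (fun k => g k = i), c.degAt k := by
    refine Finset.sum_congr rfl fun i hi => ?_
    obtain ⟨hi1, hi2⟩ := Finset.mem_Ioc.1 hi
    rw [hc.degAt_eq h hg hi2]
    refine Finset.sum_congr ?_ fun _ _ => rfl
    ext k
    rw [Finset.mem_filter, Finset.mem_filter, Finset.mem_filter]
    constructor
    · exact fun hk => ⟨⟨hk.1, by omega⟩, hk.2⟩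
    · exact fun hk => ⟨hk.1.1, hk.2⟩
  rw [h1, Finset.sum_fiberwise_of_maps_to fun k hk =>
    Finset.mem_Ioc.2 ⟨(Finset.mem_filter.1 hk).2, hgn k⟩]
  refine Finset.sum_le_sum_of_ne_zero fun k hk hne => ?_
  obtain ⟨hk1, hk2⟩ := Finset.mem_Ioc.1 hk
  refine Finset.mem_filter.2 ⟨Finset.mem_range.2 (Nat.lt_succ_of_le hk2), ?_⟩
  obtain ⟨x, hx, rfl⟩ := c.exists_mem_of_degAt_ne_zero hne
  rw [← hg]
  refine lt_of_le_of_ne (h.mono v x hk1.le) fun heq => hne ?_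
  exact hc.pushable u hu x hx ((h.congr huv).trans heq) (by omega) (by rwa [huv])

end BlownUp
namespace BlownUp

/-! ### The induced map -/

section Induced

variable {R : Type*} [CommRing R] {X Y : Type*} [TopologicalSpace X] [TopologicalSpace Y]
  {𝒳 : Filtration X} {𝒴 : Filtration Y} {f : X → Y}

lemma RegSimplex.isRegularWeight {m : ℕ} (σ : RegSimplex 𝒳 m) :
    IsRegularWeight 𝒳.dim σ.weight := ⟨fun _ => 𝒳.height_le _, σ.regular⟩

/-- The order is preserved by `height_comp_le`; the last factor is preserved because codimensions do
not increase, so that regular strata go to regular strata. -/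
lemma RegSimplex.coarsens_comp (hf : IsStratifiedMap 𝒳 𝒴 f) {m : ℕ} (σ : RegSimplex 𝒳 m) :
    Coarsens 𝒳.dim σ.weight 𝒴.dim (σ.comp hf).weight where
  mono u v huv := height_comp_le hf σ (stdSimplex.vertex u) (stdSimplex.vertex v) huv
  last v hv := by
    have hS : (𝒳.stratumOf (σ.map (stdSimplex.vertex v))).IsRegular := hv
    have hx : σ.map (stdSimplex.vertex v) ∈
        (𝒳.stratumOf (σ.map (stdSimplex.vertex v))).carrier :=
      mem_connectedComponentIn (𝒳.mem_layer_iff.2 rfl)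
    exact (Filtration.Stratum.height_eq (hf.mapsTo_image _ hx)).trans (hf.isRegular_image hS)

lemma isGathering_of_isAmalgPullback (hf : IsStratifiedMap 𝒳 𝒴 f) {m : ℕ} (σ : RegSimplex 𝒳 m)
    {A : Cochain R 𝒴.dim (σ.comp hf).weight →ₗ[R] Cochain R 𝒳.dim σ.weight}
    (hA : IsAmalgPullback R 𝒳.dim σ.weight 𝒴.dim (σ.comp hf).weight A) :
    IsGathering 𝒳.dim σ.weight 𝒴.dim (σ.comp hf).weight A :=
  hA.isGathering σ.isRegularWeight σ.monotone_weight (σ.comp hf).isRegularWeight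
    (σ.comp hf).monotone_weight (σ.coarsens_comp hf)

variable (R) in
/-- The map `f^* : Ñ^k(Y; R) → Ñ^k(X; R)`. -/
noncomputable def inducedMap (hf : IsStratifiedMap 𝒳 𝒴 f) (k : ℕ) :
    BlownUpCochain R 𝒴 k →ₗ[R] BlownUpCochain R 𝒳 k where
  toFun ω := ⟨fun m σ => pullback R 𝒳.dim σ.weight 𝒴.dim (σ.comp hf).weight (ω.1 m (σ.comp hf)), by
    refine ⟨fun m σ c hc => ?_, fun m m' σ e h c => ?_⟩
    · by_contra hne
      obtain ⟨c', hc', hne'⟩ := exists_pushes_of_pullback_ne_zero hne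
      apply hc
      rw [← hc'.deg_eq σ.isRegularWeight (σ.comp hf).isRegularWeight.le (σ.coarsens_comp hf)]
      exact deg_eq_of_ne_zero ω hne'
    · obtain ⟨v, hv⟩ := h
      have h' : ∃ v, (σ.comp hf).weight (e v) = 𝒴.dim := ⟨v, (σ.coarsens_comp hf).last _ hv⟩
      have h1 := pullback_map e (σ.weight_face e ⟨v, hv⟩) ((σ.comp hf).weight_face e h')
        (σ.coarsens_comp hf) (σ.comp hf).isRegularWeight.le (ω.1 m (σ.comp hf)) c
      refine Eq.trans ?_ h1
      -- Composing with `f` and restricting to a face commute definitionally.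
      change pullback R 𝒳.dim _ 𝒴.dim _ (ω.1 m' ((σ.comp hf).face e h')) c = _
      refine congrArg (fun η => pullback R 𝒳.dim _ 𝒴.dim _ η c) ?_
      funext b
      exact ω.2.2 m m' (σ.comp hf) e h' b⟩
  map_add' ω η := Subtype.ext (funext fun m => funext fun σ =>
    (pullback R 𝒳.dim σ.weight 𝒴.dim (σ.comp hf).weight).map_add (ω.1 m (σ.comp hf))
      (η.1 m (σ.comp hf)))
  map_smul' r ω := Subtype.ext (funext fun m => funext fun σ =>
    (pullback R 𝒳.dim σ.weight 𝒴.dim (σ.comp hf).weight).map_smul r (ω.1 m (σ.comp hf)))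

lemma isInducedMap_inducedMap (hf : IsStratifiedMap 𝒳 𝒴 f) :
    IsInducedMap hf (inducedMap R hf) := fun _ σ =>
  ⟨_, isAmalgPullback_pullback R σ.isRegularWeight σ.monotone_weight (σ.comp hf).isRegularWeight
    (σ.comp hf).monotone_weight (σ.coarsens_comp hf), fun _ _ => rfl⟩

variable {hf : IsStratifiedMap 𝒳 𝒴 f}
  {φ : (k : ℕ) → BlownUpCochain R 𝒴 k →ₗ[R] BlownUpCochain R 𝒳 k}

/-- Whatever amalgamation is chosen for `σ`, its pull-back is `pullback`; uniqueness of `f^*`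
follows. -/
lemma IsInducedMap.apply_eq (hφ : IsInducedMap hf φ) {k : ℕ} (ω : BlownUpCochain R 𝒴 k) {m : ℕ}
    (σ : RegSimplex 𝒳 m) : (φ k ω).1 m σ =
      pullback R 𝒳.dim σ.weight 𝒴.dim (σ.comp hf).weight (ω.1 m (σ.comp hf)) := by
  obtain ⟨A, hA, h⟩ := hφ m σ
  rw [h, (isGathering_of_isAmalgPullback hf σ hA).eq_pullback]

lemma IsInducedMap.unique (hφ : IsInducedMap hf φ)
    {ψ : (k : ℕ) → BlownUpCochain R 𝒴 k →ₗ[R] BlownUpCochain R 𝒳 k} (hψ : IsInducedMap hf ψ) :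
    φ = ψ := by
  funext k
  refine LinearMap.ext fun ω => Subtype.ext (funext fun m => funext fun σ => ?_)
  rw [hφ.apply_eq, hψ.apply_eq]

lemma IsInducedMap.map_coboundary (hφ : IsInducedMap hf φ) (k : ℕ) (ω : BlownUpCochain R 𝒴 k) :
    φ (k + 1) (coboundary k ω) = coboundary k (φ k ω) := by
  refine Subtype.ext (funext fun m => funext fun σ => ?_)
  obtain ⟨A, hA, h⟩ := hφ m σ
  rw [h]
  change A (cob R (ω.1 m (σ.comp hf))) = cob R ((φ k ω).1 m σ)
  rw [h, (isGathering_of_isAmalgPullback hf σ hA).map_cob]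

lemma IsInducedMap.map_cupProduct (hφ : IsInducedMap hf φ) (k l : ℕ) (ω : BlownUpCochain R 𝒴 k)
    (η : BlownUpCochain R 𝒴 l) :
    φ (k + l) (cupProduct ω η) = cupProduct (φ k ω) (φ l η) := by
  refine Subtype.ext (funext fun m => funext fun σ => ?_)
  obtain ⟨A, hA, h⟩ := hφ m σ
  rw [h]
  change A (cup (ω.1 m (σ.comp hf)) (η.1 m (σ.comp hf))) = cup ((φ k ω).1 m σ) ((φ l η).1 m σ)
  rw [h, h, (isGathering_of_isAmalgPullback hf σ hA).map_cup]

lemma chainMap_single (hf : IsStratifiedMap 𝒳 𝒴 f) {m : ℕ} (σ : RegSimplex 𝒳 m) (r : R) :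
    chainMap R hf (Finsupp.single ⟨m, σ⟩ r) = Finsupp.single ⟨m, σ.comp hf⟩ r :=
  Finsupp.mapDomain_single

/-- The hypothesis on `x` cannot be dropped: a non-regular face of `σ`, sent to `0` on the left, may
be a regular face of `f ∘ σ`. -/
lemma chainMap_simplexMap (hf : IsStratifiedMap 𝒳 𝒴 f) {m : ℕ} (σ : RegSimplex 𝒳 m)
    (x : Face m →₀ R) (hx : ∀ G, x G ≠ 0 → ∃ v ∈ G.1, σ.weight v = 𝒳.dim) :
    chainMap R hf (simplexMap R σ x) = simplexMap R (σ.comp hf) x := by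
  unfold simplexMap
  rw [Finsupp.linearCombination_apply, Finsupp.linearCombination_apply, map_finsuppSum]
  refine Finset.sum_congr rfl fun G hG => ?_
  have h1 := hx G (Finsupp.mem_support_iff.1 hG)
  have h2 : ∃ v ∈ G.1, (σ.comp hf).weight v = 𝒴.dim := by
    obtain ⟨v, hv, hvn⟩ := h1
    exact ⟨v, hv, (σ.coarsens_comp hf).last v hvn⟩
  dsimp only
  rw [dif_pos h1, dif_pos h2, map_smul, chainMap_single]
  rfl

lemma capProduct_single {k : ℕ} (ω : BlownUpCochain R 𝒳 k) {m : ℕ} (σ : RegSimplex 𝒳 m) (r : R) :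
    capProduct ω (Finsupp.single ⟨m, σ⟩ r) =
      r • simplexMap R σ (muMap R (capTilde R (ω.1 m σ))) :=
  Finsupp.linearCombination_single _ _ _

lemma IsInducedMap.chainMap_capProduct (hφ : IsInducedMap hf φ) (k : ℕ)
    (ω : BlownUpCochain R 𝒴 k) (ξ : TameChain R 𝒳) :
    chainMap R hf (capProduct (φ k ω) ξ) = capProduct ω (chainMap R hf ξ) := by
  induction ξ using Finsupp.induction_linear with
  | zero => simp only [map_zero]
  | add x y hx hy => rw [map_add, map_add, hx, hy, map_add, map_add]
  | single s r =>
    obtain ⟨m, σ⟩ := s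
    obtain ⟨A, hA, h⟩ := hφ m σ
    rw [capProduct_single, chainMap_single, capProduct_single, map_smul, chainMap_simplexMap hf σ _
      fun G hG => exists_last_of_muMap_capTilde_ne_zero _ hG, h,
      muMap_capTilde_pullback σ.isRegularWeight σ.monotone_weight (σ.comp hf).isRegularWeight
        (σ.comp hf).monotone_weight (isGathering_of_isAmalgPullback hf σ hA) (k := k) _
        fun c hc => ω.2.1 m _ c hc]

/-- If `σ` meets a stratum `S`, then some vertex of `Δ_σ` lies over the level of `S`, and `f` sends
it to the level of `S^f`. -/
lemma RegSimplex.exists_weight_eq (hf : IsStratifiedMap 𝒳 𝒴 f) {m : ℕ} (σ : RegSimplex 𝒳 m)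
    (S : 𝒳.Stratum) (h : (Set.range σ.map ∩ S.carrier).Nonempty) :
    ∃ v, σ.weight v = S.dim ∧ (σ.comp hf).weight v = (hf.image S).dim := by
  obtain ⟨_, ⟨t, rfl⟩, ht⟩ := h
  have h1 := Filtration.Stratum.height_eq ht
  have h2 := Filtration.Stratum.height_eq (hf.mapsTo_image S ht)
  have h3 : ∃ v, t v ≠ 0 ∧ 𝒳.height (σ.map t) ≤ σ.weight v := by
    by_contra hne
    push Not at hne
    -- At height `0` there is no previous level to contradict; there it suffices that some
    -- coordinate of `t` is non-zero.
    by_cases h0 : 𝒳.height (σ.map t) = 0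
    · have hsum := stdSimplex.sum_eq_one t
      rw [Finset.sum_eq_zero fun v _ => ?_] at hsum
      · exact zero_ne_one hsum
      · by_contra hv
        have := hne v hv
        omega
    · have := (σ.height_le_iff t (𝒳.height (σ.map t) - 1)).2 fun v hv => by
        have := hne v hv
        omega
      omega
  obtain ⟨v, hv, hle⟩ := h3
  have h4 := (σ.height_le_iff t _).1 le_rfl v hv
  refine ⟨v, by omega, ?_⟩
  rw [← h2]
  apply le_antisymm
  · exact height_comp_le hf σ (stdSimplex.vertex v) t h4
  · exact height_comp_le hf σ t (stdSimplex.vertex v) hle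

/-- A vertex `v` over the level of `S` translates codimensions into factors: `S` corresponds to the
factor of `v` for `σ`, and `S^f` to the factor of `v` for `f ∘ σ`. If the former has its apex the
degree is `-∞`; otherwise `Cell.Pushes.degAbove_le` compares the two degrees. -/
lemma IsInducedMap.isAllowable (hφ : IsInducedMap hf φ) {p : Perversity 𝒳} {q : Perversity 𝒴}
    (hpq : ∀ S, (q.pullback hf).val S ≤ p.val S) {k : ℕ} {ω : BlownUpCochain R 𝒴 k}
    (hω : IsAllowable q ω) : IsAllowable p (φ k ω) := by
  rw [isAllowable_iff] at hω ⊢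
  intro S hS m σ hσ c hc
  refine le_trans ?_ (hpq S)
  change _ ≤ q.val (hf.image S)
  rw [hφ.apply_eq] at hc
  obtain ⟨c', hc', hne⟩ := exists_pushes_of_pullback_ne_zero hc
  obtain ⟨v, hv, hv'⟩ := σ.exists_weight_eq hf S hσ
  have hdim : 𝒳.dim - S.codim = σ.weight v := by
    have := S.dim_le
    unfold Filtration.Stratum.codim
    omega
  have hdim' : 𝒴.dim - (hf.image S).codim = (σ.comp hf).weight v := by
    have := (hf.image S).dim_le
    unfold Filtration.Stratum.codim
    omega
  unfold Cell.perverseDegree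
  rw [hdim]
  split_ifs with hvE
  · exact bot_le
  have hle := hc'.degAbove_le σ.isRegularWeight (σ.comp hf).isRegularWeight.le
    (σ.coarsens_comp hf) hvE
  -- A singular `S` may have a regular `S^f`, where allowability of `ω` gives no bound. The factor
  -- of `v` for `f ∘ σ` is then the last one, so nothing lies above it and the degree is at most
  -- `0`.
  by_cases hreg : (hf.image S).IsRegular
  · rw [q.val_regular _ hreg]
    have h0 : c'.degAbove ((σ.comp hf).weight v) = 0 := by
      have : (σ.comp hf).weight v = 𝒴.dim := hv'.trans hreg
      unfold Cell.degAbove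
      rw [this, Finset.Ioc_self, Finset.sum_empty]
    have h1 : c.degAbove (σ.weight v) = 0 := by omega
    rw [h1]
    exact le_rfl
  · have hmeet : (Set.range (σ.comp hf).map ∩ (hf.image S).carrier).Nonempty := by
      obtain ⟨_, ⟨t, rfl⟩, ht⟩ := hσ
      exact ⟨f (σ.map t), ⟨t, rfl⟩, hf.mapsTo_image S ht⟩
    refine le_trans ?_ (hω _ hreg m (σ.comp hf) hmeet c' hne)
    unfold Cell.perverseDegree
    rw [hdim', if_neg]
    · exact WithBot.coe_le_coe.2 (WithTop.coe_le_coe.2 (Int.ofNat_le.2 hle))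
    -- The factor of `v` in `c` has no apex and contains a vertex, so its block in `c'` has no apex
    -- either.
    · intro hE
      obtain ⟨u, hu, huv⟩ := c.nonempty _ (σ.isRegularWeight.le v) hvE
      have := ((hc'.mem_E _).1 hE).2 u hu ((σ.coarsens_comp hf).congr huv)
      rw [huv] at this
      exact hvE this

/-! ### Passage to intersection cochains and cohomology -/

lemma IsInducedMap.mem_intersectionCochain (hφ : IsInducedMap hf φ) {p : Perversity 𝒳}
    {q : Perversity 𝒴} (hpq : ∀ S, (q.pullback hf).val S ≤ p.val S) {k : ℕ}
    {ω : BlownUpCochain R 𝒴 k} (hω : ω ∈ IntersectionCochain R q k) :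
    φ k ω ∈ IntersectionCochain R p k := by
  refine ⟨hφ.isAllowable hpq hω.1, ?_⟩
  rw [← hφ.map_coboundary]
  exact hφ.isAllowable hpq hω.2

lemma IsInducedMap.mem_cocycle (hφ : IsInducedMap hf φ) {p : Perversity 𝒳}
    {q : Perversity 𝒴} (hpq : ∀ S, (q.pullback hf).val S ≤ p.val S) {k : ℕ}
    {z : BlownUpCochain R 𝒴 k} (hz : z ∈ Cocycle R q k) : φ k z ∈ Cocycle R p k := by
  refine ⟨hφ.mem_intersectionCochain hpq hz.1, ?_⟩
  have h : coboundary k z = 0 := hz.2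
  change coboundary k (φ k z) = 0
  rw [← hφ.map_coboundary, h, map_zero]

lemma IsInducedMap.mem_coboundary (hφ : IsInducedMap hf φ) {p : Perversity 𝒳}
    {q : Perversity 𝒴} (hpq : ∀ S, (q.pullback hf).val S ≤ p.val S) {k : ℕ}
    {z : BlownUpCochain R 𝒴 k} (hz : z ∈ Coboundary R q k) : φ k z ∈ Coboundary R p k := by
  cases k with
  | zero =>
    have h : z = 0 := hz
    rw [h, map_zero]
    exact Submodule.zero_mem _
  | succ k =>
    obtain ⟨y, hy, rfl⟩ := hz
    rw [hφ.map_coboundary]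
    exact ⟨φ k y, hφ.mem_intersectionCochain hpq hy, rfl⟩

end Induced

end BlownUp

/-! ### The main theorem -/

open BlownUp in
theorem mainTheorem3 {R : Type*} [CommRing R] {X Y : Type*} [TopologicalSpace X]
    [TopologicalSpace Y] (𝒳 : Filtration X) (𝒴 : Filtration Y) (f : X → Y)
    (hf : IsStratifiedMap 𝒳 𝒴 f) :
    (∃! φ : (k : ℕ) → BlownUpCochain R 𝒴 k →ₗ[R] BlownUpCochain R 𝒳 k, IsInducedMap hf φ) ∧
    ∀ φ : (k : ℕ) → BlownUpCochain R 𝒴 k →ₗ[R] BlownUpCochain R 𝒳 k, IsInducedMap hf φ →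
      (∀ (k : ℕ) (ω : BlownUpCochain R 𝒴 k),
        φ (k + 1) (coboundary k ω) = coboundary k (φ k ω)) ∧
      (∀ (k l : ℕ) (ω : BlownUpCochain R 𝒴 k) (η : BlownUpCochain R 𝒴 l),
        φ (k + l) (cupProduct ω η) = cupProduct (φ k ω) (φ l η)) ∧
      (∀ (k : ℕ) (ω : BlownUpCochain R 𝒴 k) (ξ : TameChain R 𝒳),
        chainMap R hf (capProduct (φ k ω) ξ) = capProduct ω (chainMap R hf ξ)) ∧
      (∀ (p : Perversity 𝒳) (q : Perversity 𝒴), (∀ S, (q.pullback hf).val S ≤ p.val S) →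
        (∀ (k : ℕ), ∀ ω ∈ IntersectionCochain R q k, φ k ω ∈ IntersectionCochain R p k) ∧
        ∀ k : ℕ, ∃ h : BlownUpCohomology R q k →ₗ[R] BlownUpCohomology R p k,
          ∀ z : Cocycle R q k, ∃ hz : φ k z ∈ Cocycle R p k,
            h (Submodule.Quotient.mk z) = Submodule.Quotient.mk ⟨φ k z, hz⟩) := by
  refine ⟨⟨inducedMap R hf, isInducedMap_inducedMap hf,
    fun ψ hψ => hψ.unique (isInducedMap_inducedMap hf)⟩, fun φ hφ => ?_⟩
  refine ⟨hφ.map_coboundary, hφ.map_cupProduct, hφ.chainMap_capProduct, fun p q hpq => ?_⟩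
  refine ⟨fun k ω hω => hφ.mem_intersectionCochain hpq hω, fun k => ?_⟩
  let g : Cocycle R q k →ₗ[R] Cocycle R p k :=
    ((φ k).comp (Cocycle R q k).subtype).codRestrict (Cocycle R p k)
      fun z => hφ.mem_cocycle hpq z.2
  refine ⟨Submodule.mapQ _ _ g fun z hz => ?_, fun z => ⟨hφ.mem_cocycle hpq z.2, rfl⟩⟩
  exact hφ.mem_coboundary hpq (Submodule.mem_comap.1 hz)
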